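/- Let $\mathbb{R}_+=(0,\infty)$ and let $D_2=\{(\zeta_1,\zeta_2)\in\mathbb{C}^2:\operatorname{Im}\zeta_2-|\zeta_1|^2>0\}$ be the Siegel domain with Lebesgue measure. For an integer $n\ge 1$ let $\mathcal{A}^2_{(1,n)}(D_2)\subset L^2(D_2)$ be the subspace of all square-integrable $f\in C^\infty(D_2)$ such that $$\Big(\frac{\partial}{\partial\overline{\zeta}_1}-2i\zeta_1\frac{\partial}{\partial\overline{\zeta}_2}\Big)f=0,\qquad \Big(\frac{\partial}{\partial\overline{\zeta}_2}\Big)^{n}f=0 .$$ It is a closed subspace of $L^2(D_2)$; let $B$ be the orthogonal projection of $L^2(D_2)$ onto it. Let $L^\infty_{\{0,+\infty\}}(\mathbb{R}_+)$ be the space of all essentially bounded measurable $b:\mathbb{R}_+\to\mathbb{C}$ that have limits at $0$ and at $+\infty$. For such $b$ let $\tilde b(\zeta)=b(\operatorname{Im}\zeta_2-|\zeta_1|^2)$, let $T_b f=B(\tilde b f)$ be the Toeplitz operator on $\mathcal{A}^2_{(1,n)}(D_2)$, and let $\gamma^b:\mathbb{R}_+\to M_n(\mathbb{C})$ be the matrix-valued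 function with entries $$\gamma^b_{jk}(x)=\int_0^\infty b\Big(\frac{y}{2x}\Big)\,\ell_{j-1}(y)\,\ell_{k-1}(y)\,dy,\qquad j,k=1,\dots,n,$$ where $\ell_m(y)=(-1)^m L_m(y)e^{-y/2}$ and $L_m(y)=\frac{e^{y}}{m!}\frac{d^m}{dy^m}\big(e^{-y}y^m\big)$ are the Laguerre functions and polynomials. Finally, let $$\mathfrak{C}=\{M\in M_n(C([0,\infty])) : M(0),\,M(\infty)\in\mathbb{C}I\},$$ a $C^*$-subalgebra of the $C^*$-algebra $M_n(C([0,\infty]))$ of continuous matrix-valued functions on $[0,\infty]$. Then: 1. For every $b\in L^\infty_{\{0,+\infty\}}(\mathbb{R}_+)$ the function $\gamma^b$ extends continuously to $[0,\infty]$, and the extension, again denoted by $\gamma^b$, belongs to $\mathfrak{C}$. 2. The $C^*$-subalgebra of $M_n(C([0,\infty]))$ generated by all the functions $\gamma^b$, $b\in L^\infty_{\{0,+\infty\}}(\mathbb{R}_+)$, is equal to $\mathfrak{C}$. 3. The $C^*$-algebra generated by all the Toeplitz operators $T_b$, $b\in L^\infty_{\{0,+\infty\}}(\mathbb{R}_+)$,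 is isomorphic to $\mathfrak{C}$ by a $*$-isomorphism that maps $T_b$ to $\gamma^b$ for every $b\in L^\infty_{\{0,+\infty\}}(\mathbb{R}_+)$. -/

import Mathlib

open MeasureTheory Set Filter Topology
open scoped ENNReal ContDiff Matrix.Norms.L2Operator

noncomputable section

namespace SiegelToeplitz

/-- The Siegel domain `D₂ = {(ζ₁, ζ₂) ∈ ℂ² : Im ζ₂ - |ζ₁|² > 0}`. -/
def siegel : Set (ℂ × ℂ) := {ζ | 0 < ζ.2.im - ‖ζ.1‖ ^ 2}

/-- Lebesgue measure on the Siegel domain. -/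
def siegelMeasure : Measure (ℂ × ℂ) := volume.restrict siegel

/-- The Hilbert space `L²(D₂)` with respect to Lebesgue measure. -/
abbrev L2Siegel : Type := Lp ℂ 2 siegelMeasure

/-- The Wirtinger derivative `∂/∂ζ̄₁ = (∂/∂x₁ + i ∂/∂y₁) / 2`. -/
def dbar₁ (f : ℂ × ℂ → ℂ) (ζ : ℂ × ℂ) : ℂ :=
  (1 / 2 : ℂ) * (fderiv ℝ f ζ (1, 0) + Complex.I * fderiv ℝ f ζ (Complex.I, 0))

/-- The Wirtinger derivative `∂/∂ζ̄₂ = (∂/∂x₂ + i ∂/∂y₂) / 2`. -/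
def dbar₂ (f : ℂ × ℂ → ℂ) (ζ : ℂ × ℂ) : ℂ :=
  (1 / 2 : ℂ) * (fderiv ℝ f ζ (0, 1) + Complex.I * fderiv ℝ f ζ (0, Complex.I))

/-- The tangential operator `∂/∂ζ̄₁ - 2 i ζ₁ ∂/∂ζ̄₂`. -/
def dbarTan (f : ℂ × ℂ → ℂ) (ζ : ℂ × ℂ) : ℂ :=
  dbar₁ f ζ - 2 * Complex.I * ζ.1 * dbar₂ f ζ

/-- `(l₁, l₂)`-analytic functions on the Siegel domain: smooth functions annihilated by
`(∂/∂ζ̄₁ - 2 i ζ₁ ∂/∂ζ̄₂) ^ l₁` and by `(∂/∂ζ̄₂) ^ l₂`. -/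
def IsPolyAnalytic (l₁ l₂ : ℕ) (f : ℂ × ℂ → ℂ) : Prop :=
  ContDiffOn ℝ ∞ f siegel ∧
    (∀ ζ ∈ siegel, (dbarTan^[l₁] f) ζ = 0) ∧ ∀ ζ ∈ siegel, (dbar₂^[l₂] f) ζ = 0

theorem isOpen_siegel : IsOpen siegel := by
  unfold siegel
  exact isOpen_lt continuous_const (by fun_prop)

/-- Linear differential operators on the Siegel domain: auxiliary predicate used only to show
that the poly-analytic functions form a vector space. -/
structure IsLinOp (P : (ℂ × ℂ → ℂ) → ℂ × ℂ → ℂ) : Prop where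
  smooth : ∀ f, ContDiffOn ℝ ∞ f siegel → ContDiffOn ℝ ∞ (P f) siegel
  congr : ∀ f g, EqOn f g siegel → EqOn (P f) (P g) siegel
  add : ∀ f g, ContDiffOn ℝ ∞ f siegel → ContDiffOn ℝ ∞ g siegel →
    EqOn (P (f + g)) (P f + P g) siegel
  smul : ∀ (c : ℂ) f, ContDiffOn ℝ ∞ f siegel → EqOn (P (c • f)) (c • P f) siegel

theorem differentiableAt_of_smooth {f : ℂ × ℂ → ℂ} (hf : ContDiffOn ℝ ∞ f siegel)
    {ζ : ℂ × ℂ} (hζ : ζ ∈ siegel) : DifferentiableAt ℝ f ζ :=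
  (hf.contDiffAt (isOpen_siegel.mem_nhds hζ)).differentiableAt (by simp)

theorem smooth_fderiv_apply {f : ℂ × ℂ → ℂ} (hf : ContDiffOn ℝ ∞ f siegel) (v : ℂ × ℂ) :
    ContDiffOn ℝ ∞ (fun ζ => fderiv ℝ f ζ v) siegel :=
  (hf.fderiv_of_isOpen isOpen_siegel (m := ∞) (by simp)).clm_apply contDiffOn_const

theorem fderiv_congr_siegel {f g : ℂ × ℂ → ℂ} (h : EqOn f g siegel) {ζ : ℂ × ℂ}
    (hζ : ζ ∈ siegel) : fderiv ℝ f ζ = fderiv ℝ g ζ :=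
  (h.eventuallyEq_of_mem (isOpen_siegel.mem_nhds hζ)).fderiv_eq

theorem isLinOp_dbar₁ : IsLinOp dbar₁ where
  smooth f hf := contDiffOn_const.mul
    ((smooth_fderiv_apply hf _).add (contDiffOn_const.mul (smooth_fderiv_apply hf _)))
  congr f g h ζ hζ := by simp only [dbar₁, fderiv_congr_siegel h hζ]
  add f g hf hg ζ hζ := by
    simp only [dbar₁, Pi.add_apply, fderiv_add (differentiableAt_of_smooth hf hζ)
      (differentiableAt_of_smooth hg hζ), add_apply]
    ring
  smul c f hf ζ hζ := by
    simp only [dbar₁, Pi.smul_apply, fderiv_const_smul (differentiableAt_of_smooth hf hζ),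
      smul_apply, smul_eq_mul]
    ring

theorem isLinOp_dbar₂ : IsLinOp dbar₂ where
  smooth f hf := contDiffOn_const.mul
    ((smooth_fderiv_apply hf _).add (contDiffOn_const.mul (smooth_fderiv_apply hf _)))
  congr f g h ζ hζ := by simp only [dbar₂, fderiv_congr_siegel h hζ]
  add f g hf hg ζ hζ := by
    simp only [dbar₂, Pi.add_apply, fderiv_add (differentiableAt_of_smooth hf hζ)
      (differentiableAt_of_smooth hg hζ), add_apply]
    ring
  smul c f hf ζ hζ := by
    simp only [dbar₂, Pi.smul_apply, fderiv_const_smul (differentiableAt_of_smooth hf hζ),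
      smul_apply, smul_eq_mul]
    ring

theorem isLinOp_dbarTan : IsLinOp dbarTan where
  smooth f hf := (isLinOp_dbar₁.smooth f hf).sub
    ((contDiffOn_const.mul contDiff_fst.contDiffOn).mul (isLinOp_dbar₂.smooth f hf))
  congr f g h ζ hζ := by
    simp only [dbarTan, isLinOp_dbar₁.congr f g h hζ, isLinOp_dbar₂.congr f g h hζ]
  add f g hf hg ζ hζ := by
    simp only [dbarTan, isLinOp_dbar₁.add f g hf hg hζ, isLinOp_dbar₂.add f g hf hg hζ,
      Pi.add_apply]
    ring
  smul c f hf ζ hζ := by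
    simp only [dbarTan, isLinOp_dbar₁.smul c f hf hζ, isLinOp_dbar₂.smul c f hf hζ,
      Pi.smul_apply, smul_eq_mul]
    ring

theorem IsLinOp.iterate {P : (ℂ × ℂ → ℂ) → ℂ × ℂ → ℂ} (hP : IsLinOp P) (l : ℕ) :
    IsLinOp (P^[l]) := by
  induction l with
  | zero =>
    exact ⟨fun f hf => hf, fun f g h => h, fun f g _ _ ζ _ => rfl, fun c f _ ζ _ => rfl⟩
  | succ l ih =>
    simp only [Function.iterate_succ']
    exact ⟨fun f hf => hP.smooth _ (ih.smooth f hf),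
      fun f g h => hP.congr _ _ (ih.congr f g h),
      fun f g hf hg => (hP.congr _ _ (ih.add f g hf hg)).trans
        (hP.add _ _ (ih.smooth f hf) (ih.smooth g hg)),
      fun c f hf => (hP.congr _ _ (ih.smul c f hf)).trans (hP.smul c _ (ih.smooth f hf))⟩

theorem IsPolyAnalytic.add {l₁ l₂ : ℕ} {f g : ℂ × ℂ → ℂ} (hf : IsPolyAnalytic l₁ l₂ f)
    (hg : IsPolyAnalytic l₁ l₂ g) : IsPolyAnalytic l₁ l₂ (f + g) := by
  refine ⟨hf.1.add hg.1, fun ζ hζ => ?_, fun ζ hζ => ?_⟩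
  · rw [(isLinOp_dbarTan.iterate l₁).add f g hf.1 hg.1 hζ, Pi.add_apply, hf.2.1 ζ hζ,
      hg.2.1 ζ hζ, add_zero]
  · rw [(isLinOp_dbar₂.iterate l₂).add f g hf.1 hg.1 hζ, Pi.add_apply, hf.2.2 ζ hζ,
      hg.2.2 ζ hζ, add_zero]

theorem IsPolyAnalytic.smul {l₁ l₂ : ℕ} {f : ℂ × ℂ → ℂ} (c : ℂ)
    (hf : IsPolyAnalytic l₁ l₂ f) : IsPolyAnalytic l₁ l₂ (c • f) := by
  refine ⟨hf.1.const_smul c, fun ζ hζ => ?_, fun ζ hζ => ?_⟩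
  · rw [(isLinOp_dbarTan.iterate l₁).smul c f hf.1 hζ, Pi.smul_apply, hf.2.1 ζ hζ, smul_zero]
  · rw [(isLinOp_dbar₂.iterate l₂).smul c f hf.1 hζ, Pi.smul_apply, hf.2.2 ζ hζ, smul_zero]

theorem isPolyAnalytic_zero (l₁ l₂ : ℕ) : IsPolyAnalytic l₁ l₂ 0 := by
  refine ⟨contDiffOn_const, fun ζ hζ => ?_, fun ζ hζ => ?_⟩
  · simpa using (isLinOp_dbarTan.iterate l₁).smul 0 0 contDiffOn_const hζ
  · simpa using (isLinOp_dbar₂.iterate l₂).smul 0 0 contDiffOn_const hζ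

/-- The poly-Bergman-type space `A²_{(l₁, l₂)}(D₂)`: the classes in `L²(D₂)` of the
square-integrable `(l₁, l₂)`-analytic functions. -/
def polyBergman (l₁ l₂ : ℕ) : Submodule ℂ L2Siegel where
  carrier := {f | ∃ g, IsPolyAnalytic l₁ l₂ g ∧ f =ᵐ[siegelMeasure] g}
  zero_mem' := ⟨0, isPolyAnalytic_zero l₁ l₂, Lp.coeFn_zero _ _ _⟩
  add_mem' := by
    rintro f₁ f₂ ⟨g₁, h₁, e₁⟩ ⟨g₂, h₂, e₂⟩
    exact ⟨g₁ + g₂, h₁.add h₂, (Lp.coeFn_add f₁ f₂).trans (e₁.add e₂)⟩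
  smul_mem' := by
    rintro c f ⟨g, h, e⟩
    exact ⟨c • g, h.smul c, (Lp.coeFn_smul c f).trans (e.const_smul c)⟩

/-- The space `A²_{(1, n)}(D₂)` as a Hilbert space. It is written as a closure only to have
completeness by construction: `polyBergman 1 n` is itself closed, and this is part of the
assertion of the main theorem. -/
abbrev bergmanSpace (n : ℕ) : Submodule ℂ L2Siegel := (polyBergman 1 n).topologicalClosure

/-- The symbols: essentially bounded measurable functions on `ℝ₊ = (0, ∞)` which have limits
at `0` and at `+∞` (the values on `(-∞, 0]` are irrelevant). -/
structure BSymbol where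
  toFun : ℝ → ℂ
  memLp : MemLp toFun ∞ (volume.restrict (Ioi 0))
  lim_zero : ∃ c : ℂ, Tendsto toFun (𝓝[>] 0) (𝓝 c)
  lim_top : ∃ c : ℂ, Tendsto toFun atTop (𝓝 c)

/-- The height function `ζ ↦ Im ζ₂ - |ζ₁|²`. -/
def height (ζ : ℂ × ℂ) : ℝ := ζ.2.im - ‖ζ.1‖ ^ 2

theorem quasiMeasurePreserving_height :
    Measure.QuasiMeasurePreserving height siegelMeasure (volume.restrict (Ioi 0)) := by
  have h : Measure.QuasiMeasurePreserving height (volume : Measure (ℂ × ℂ)) volume := by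
    refine QuasiMeasurePreserving.prod_of_right (by unfold height; fun_prop)
      (Eventually.of_forall fun z => ?_)
    have h1 : Measure.QuasiMeasurePreserving Complex.im volume volume :=
      (Measure.quasiMeasurePreserving_snd (μ := (volume : Measure ℝ))
        (ν := (volume : Measure ℝ))).comp
        Complex.volume_preserving_equiv_real_prod.quasiMeasurePreserving
    exact (measurePreserving_sub_right volume (‖z‖ ^ 2)).quasiMeasurePreserving.comp h1
  exact h.restrict fun ζ hζ => hζ

/-- The function `b̃(ζ) = b(Im ζ₂ - |ζ₁|²)` on the Siegel domain. -/
def BSymbol.lift (b : BSymbol) (ζ : ℂ × ℂ) : ℂ := b.toFun (height ζ)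

theorem BSymbol.memLp_lift (b : BSymbol) : MemLp b.lift ∞ siegelMeasure := by
  refine ⟨b.memLp.1.comp_quasiMeasurePreserving quasiMeasurePreserving_height, ?_⟩
  have hb : eLpNormEssSup b.toFun (volume.restrict (Ioi 0)) < ⊤ := by
    simpa only [eLpNorm_exponent_top] using b.memLp.2
  rw [eLpNorm_exponent_top]
  refine lt_of_le_of_lt (essSup_le_of_ae_le _ ?_) hb
  exact quasiMeasurePreserving_height.ae ae_le_eLpNormEssSup

/-- The multiplication operator `f ↦ b̃ f` on `L²(D₂)`. -/
def mulOp (b : BSymbol) : L2Siegel →L[ℂ] L2Siegel :=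
  (ContinuousLinearMap.mul ℂ ℂ).holderL siegelMeasure ∞ 2 2 b.memLp_lift.toLp

/-- The Toeplitz operator `T_b f = B(b̃ f)` on `A²_{(1, n)}(D₂)`, where `B` is the orthogonal
projection of `L²(D₂)` onto `A²_{(1, n)}(D₂)`. -/
def toeplitz (n : ℕ) (b : BSymbol) : bergmanSpace n →L[ℂ] bergmanSpace n :=
  (bergmanSpace n).orthogonalProjectionOnto ∘L mulOp b ∘L (bergmanSpace n).subtypeL

/-- The (unital) `C⋆`-subalgebra generated by a subset `s` of a `C⋆`-algebra: the norm closure of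
the `⋆`-subalgebra generated by `s`. -/
def cstarGenerated {A : Type*} [CStarAlgebra A] (s : Set A) : StarSubalgebra ℂ A :=
  (StarAlgebra.adjoin ℂ s).topologicalClosure

theorem mem_cstarGenerated {A : Type*} [CStarAlgebra A] {s : Set A} {a : A} (ha : a ∈ s) :
    a ∈ cstarGenerated s :=
  StarSubalgebra.le_topologicalClosure _ (StarAlgebra.subset_adjoin ℂ _ ha)

/-- The `C⋆`-algebra generated by the Toeplitz operators `T_b`. The identity is itself the
Toeplitz operator with symbol `1`, so that it makes no difference whether the generated algebra
is required to be unital. -/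
def toeplitzAlgebra (n : ℕ) : StarSubalgebra ℂ (bergmanSpace n →L[ℂ] bergmanSpace n) :=
  cstarGenerated (range (toeplitz n))

theorem toeplitz_mem (n : ℕ) (b : BSymbol) : toeplitz n b ∈ toeplitzAlgebra n :=
  mem_cstarGenerated ⟨b, rfl⟩

/-- The Laguerre polynomial `L_m(y) = (e^y / m!) (d/dy)^m (e^{-y} y^m)`. -/
def laguerrePoly (m : ℕ) (y : ℝ) : ℝ :=
  Real.exp y / (m.factorial : ℝ) * iteratedDeriv m (fun t : ℝ => Real.exp (-t) * t ^ m) y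

/-- The Laguerre function `ℓ_m(y) = (-1)^m L_m(y) e^{-y/2}`. -/
def laguerreFun (m : ℕ) (y : ℝ) : ℝ := (-1) ^ m * laguerrePoly m y * Real.exp (-y / 2)

/-- The spectral matrix `γ^b(x)` for `x > 0`, with entries
`∫_0^∞ b(y / (2x)) ℓ_j(y) ℓ_k(y) dy`, where `j` and `k` run over `0, …, n - 1`. -/
def spectralMatrix (n : ℕ) (b : BSymbol) (x : ℝ) : Matrix (Fin n) (Fin n) ℂ :=
  Matrix.of fun j k : Fin n =>
    ∫ y in Ioi (0 : ℝ), b.toFun (y / (2 * x)) *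
      ((laguerreFun j y * laguerreFun k y : ℝ) : ℂ)

/-- The `C⋆`-algebra `M_n(C([0, ∞]))` of continuous matrix-valued functions on `[0, ∞]`, with the
supremum of the operator norm; `[0, ∞]` is the two-point compactification of `(0, ∞)`. -/
abbrev MatFun (n : ℕ) : Type := C(ℝ≥0∞, Matrix (Fin n) (Fin n) ℂ)

/-- The matrix function `M` on `[0, ∞]` is a continuous extension of `γ^b`. -/
def IsSpectralFun (n : ℕ) (b : BSymbol) (M : MatFun n) : Prop :=
  ∀ x : ℝ, 0 < x → M (ENNReal.ofReal x) = spectralMatrix n b x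

/-- The algebra of all `M ∈ M_n(C([0, ∞]))` such that `M(0)` and `M(∞)` are scalar matrices. -/
def scalarEnds (n : ℕ) : StarSubalgebra ℂ (MatFun n) where
  carrier := {M | (∃ c : ℂ, M 0 = c • 1) ∧ ∃ c : ℂ, M ∞ = c • 1}
  mul_mem' := by
    rintro M N ⟨⟨a, ha⟩, a', ha'⟩ ⟨⟨c, hc⟩, c', hc'⟩
    exact ⟨⟨c * a, by simp [ha, hc, mul_smul]⟩, c' * a', by simp [ha', hc', mul_smul]⟩
  add_mem' := by
    rintro M N ⟨⟨a, ha⟩, a', ha'⟩ ⟨⟨c, hc⟩, c', hc'⟩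
    exact ⟨⟨a + c, by simp [ha, hc, add_smul]⟩, a' + c', by simp [ha', hc', add_smul]⟩
  algebraMap_mem' c := ⟨⟨c, by simp [Algebra.algebraMap_eq_smul_one]⟩,
    c, by simp [Algebra.algebraMap_eq_smul_one]⟩
  star_mem' := by
    rintro M ⟨⟨a, ha⟩, a', ha'⟩
    exact ⟨⟨star a, by simp [ha]⟩, star a', by simp [ha']⟩

/-- The `C⋆`-subalgebra of `M_n(C([0, ∞]))` generated by all the functions `γ^b`; the identity is
itself `γ^b` for `b = 1`. -/
def spectralAlgebra (n : ℕ) : StarSubalgebra ℂ (MatFun n) :=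
  cstarGenerated {M : MatFun n | ∃ b, IsSpectralFun n b M}

end SiegelToeplitz

end

/-! In the coordinates `ζ = (z, u + i(v + |z|²))` the domain is `v > 0`, `v` is the height, and the
problem is invariant under translations in `u` and rotations of `z`. Since `∂̄₂` sends the height to
`i/2` and the tangential operator kills it, the functions in question are the polynomials of degree
`< n` in the height with holomorphic coefficients (`IsPolyAnalytic.exists_holo`). Diagonalising both
symmetries leaves, for every degree `p` in `z` and every frequency `t > 0`, the functions `z^p
e^{2πitζ₂} P(v)` with `deg P < n`, and the polynomials `L_j(4πtv)`, `j < n`, form an orthogonal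
basis of this copy of `ℂⁿ`. Plancherel in `u` turns this into isometries `waveOp n p` from `L²(ℝ₊;
ℂⁿ)` with mutually orthogonal ranges. Multiplication by `b(v)` respects both symmetries, and its
compression at `(p, t)` has the matrix `γ^b(2πt)` (`inner_waveOp_mulOp_self`,
`inner_waveOp_mulOp_of_ne`).

The waves exhaust the space (`eq_zero_of_orthogonal`). The `p`-th rotation mode of `f` is `z^p ∑ h^k
a_k(ζ₂)`, where `h` is the height and the `a_k` are holomorphic in the half-plane with weighted
square-integrability. A Paley–Wiener theorem (`exists_fourier_line`) makes each `a_k` a Laplace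
integral, so the mode is a wave; if `f` is orthogonal to all waves, every mode vanishes and so does
`f`. Hence the space is the Hilbert sum of the wave ranges. This gives closedness, and `T_b` acts on
each summand as multiplication by `γ^b(2πt)`.

The algebra of the `γ^b` is found by a Stone–Weierstrass theorem for `C⋆`-valued functions
(`mem_of_pointwise_mem`): it remains to compute pointwise values and to separate points. Indicators
of short intervals produce the rank-one matrices `2x ℓ(2xv) ℓ(2xv)ᵀ`. Different `x` give exponential
polynomials in `v` with different exponents, hence independent values, and products at one `x` span
all matrices (`exists_interior_value`). At the ends only scalars occur.

Finally, the pairs `(T, M)` such that every `waveOp n p` intertwines `T` with `M` and `T⋆` with `M⋆`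
form a closed `⋆`-algebra on which both projections are injective. The algebra generated by the
pairs `(T_b, γ^b)` therefore projects isomorphically onto both algebras. -/

open scoped ENNReal ContDiff Matrix.Norms.L2Operator

noncomputable section

namespace SiegelToeplitz

/-! ### Stone–Weierstrass for functions with values in a `C⋆`-algebra. -/

section StoneWeierstrass

variable {X B : Type*} [TopologicalSpace X] [CompactSpace X] [CStarAlgebra B]

/-- A continuous cutoff on the plane: `0` where `re z ≤ 1/4`, `1` where `1/2 ≤ re z`. -/
def ramp (z : ℂ) : ℂ := (max 0 (min 1 (4 * z.re - 1)) : ℝ)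

theorem continuous_ramp : Continuous ramp := by unfold ramp; fun_prop

theorem ramp_of_le {z : ℂ} (h : z.re ≤ 1 / 4) : ramp z = 0 := by
  rw [ramp, max_eq_left ((min_le_right _ _).trans (by linarith)), Complex.ofReal_zero]

theorem ramp_of_ge {z : ℂ} (h : 1 / 2 ≤ z.re) : ramp z = 1 := by
  rw [ramp, min_eq_left (by linarith), max_eq_right zero_le_one, Complex.ofReal_one]

theorem norm_ramp_le (z : ℂ) : ‖ramp z‖ ≤ 1 := by
  rw [ramp, Complex.norm_real, Real.norm_eq_abs, abs_of_nonneg (le_max_left _ _)]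
  exact max_le zero_le_one (min_le_left _ _)

/-- The spectrum lies in the disc of radius `‖b‖`, where the cutoff vanishes. Normality is not
needed: for other `b` the functional calculus has the default value `0`. -/
theorem cfc_ramp_eq_zero {b : B} (hb : ‖b‖ ≤ 1 / 4) : cfc ramp b = 0 := by
  nontriviality B
  rw [cfc_congr (g := fun _ => (0 : ℂ)), cfc_const_zero]
  intro z hz
  exact ramp_of_le (((Complex.re_le_norm z).trans (spectrum.norm_le_norm_of_mem hz)).trans hb)

theorem cfc_ramp_eq_one {b : B} (hb : ‖b - 1‖ ≤ 1 / 2) (hn : IsStarNormal b) :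
    cfc ramp b = 1 := by
  nontriviality B
  rw [cfc_congr (g := fun _ => (1 : ℂ)), cfc_const_one ℂ b]
  intro z hz
  have h1 : z - 1 ∈ spectrum ℂ (b - 1) := by
    have := spectrum.sub_singleton_eq (R := ℂ) b 1
    rw [map_one] at this
    rw [← this]
    exact ⟨z, hz, 1, rfl, rfl⟩
  have h2 := ((Complex.abs_re_le_norm _).trans (spectrum.norm_le_norm_of_mem h1)).trans hb
  have h3 := neg_abs_le (z - 1).re
  simp only [Complex.sub_re, Complex.one_re] at h2 h3
  exact ramp_of_ge (by linarith)

/-- Evaluation at a point as a `⋆`-homomorphism. -/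
def evalHom (y : X) : C(X, B) →⋆ₐ[ℂ] B where
  toFun a := a y
  map_one' := rfl
  map_mul' _ _ := rfl
  map_zero' := rfl
  map_add' _ _ := rfl
  commutes' _ := rfl
  map_star' _ := rfl

theorem cfc_ramp_apply (a : C(X, B)) (y : X) :
    cfc ramp (star a * a) y = cfc ramp (star (a y) * a y) :=
  StarAlgHomClass.map_cfc (evalHom y) ramp (star a * a)
    (continuous_ramp.continuousOn) (ContinuousEvalConst.continuous_eval_const y)
    (IsSelfAdjoint.star_mul_self a).isStarNormal (IsSelfAdjoint.star_mul_self (a y)).isStarNormal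

variable {A : StarSubalgebra ℂ C(X, B)}

/-- Functional calculus on `star a * a` makes values close to `0` exactly `0` and values close to
`1` exactly `1`, so separation of two points becomes separation of two neighbourhoods. -/
theorem exists_local_zero_one (hA : IsClosed (A : Set C(X, B))) {x y : X}
    (h : ∃ a ∈ A, a x = 0 ∧ a y = 1) :
    ∃ e ∈ A, (∀ᶠ x' in 𝓝 x, e x' = 0) ∧ ∀ᶠ y' in 𝓝 y, e y' = 1 := by
  obtain ⟨a, ha, hx, hy⟩ := h
  refine ⟨cfc ramp (star a * a), cfc_mem (hs := hA) ramp (mul_mem (star_mem ha) ha), ?_, ?_⟩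
  · have h1 : Tendsto (fun x' => ‖star (a x') * a x'‖) (𝓝 x) (𝓝 0) := by
      have : Continuous fun x' => ‖star (a x') * a x'‖ := by fun_prop
      simpa [hx] using this.tendsto x
    filter_upwards [h1.eventually (ge_mem_nhds (show (0 : ℝ) < 1 / 4 by norm_num))] with x' hx'
    rw [cfc_ramp_apply]
    exact cfc_ramp_eq_zero hx'
  · have h1 : Tendsto (fun x' => ‖star (a x') * a x' - 1‖) (𝓝 y) (𝓝 0) := by
      have : Continuous fun x' => ‖star (a x') * a x' - 1‖ := by fun_prop
      simpa [hy] using this.tendsto y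
    filter_upwards [h1.eventually (ge_mem_nhds (show (0 : ℝ) < 1 / 2 by norm_num))] with x' hx'
    rw [cfc_ramp_apply]
    exact cfc_ramp_eq_one hx' (IsSelfAdjoint.star_mul_self _).isStarNormal

/-- Products of local `0`-`1` elements: if `L` is compact and near each point of `L` some element
of `A` vanishes while being `1` on `P`, then some element vanishes on `L` and is `1` on `P`. -/
theorem exists_zero_on_of_local {L : Set X} (hL : IsCompact L) {l : Filter X}
    (h : ∀ x ∈ L, ∃ e ∈ A, (∀ᶠ x' in 𝓝 x, e x' = 0) ∧ ∀ᶠ y in l, e y = 1) :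
    ∃ e ∈ A, (∀ x ∈ L, e x = 0) ∧ ∀ᶠ y in l, e y = 1 := by
  refine hL.induction_on (p := fun S => ∃ e ∈ A, (∀ x ∈ S, e x = 0) ∧ ∀ᶠ y in l, e y = 1)
    ⟨1, one_mem _, by simp, by simp⟩ ?_ ?_ ?_
  · rintro s t hst ⟨e, he, h0, h1⟩
    exact ⟨e, he, fun x hx => h0 x (hst hx), h1⟩
  · rintro s t ⟨e, he, h0, h1⟩ ⟨e', he', h0', h1'⟩
    refine ⟨e * e', mul_mem he he', ?_, ?_⟩
    · rintro x (hx | hx) <;> simp [h0, h0', hx]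
    · filter_upwards [h1, h1'] with y hy hy'
      simp [hy, hy']
  · intro x hx
    obtain ⟨e, he, h0, h1⟩ := h x hx
    exact ⟨{x' | e x' = 0}, mem_nhdsWithin_of_mem_nhds h0, e, he, fun _ h => h, h1⟩

/-- Noncommutative Urysohn lemma. -/
theorem exists_zero_on_one_on (hA : IsClosed (A : Set C(X, B)))
    (hsep : ∀ x y, x ≠ y → ∃ a ∈ A, a x = 0 ∧ a y = 1) {K L : Set X} (hK : IsClosed K)
    (hL : IsClosed L) (hKL : Disjoint K L) :
    ∃ e ∈ A, (∀ x ∈ K, e x = 0) ∧ (∀ x ∈ L, e x = 1) ∧ ∀ x, ‖e x‖ ≤ 1 := by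
  have h1 : ∀ y ∈ K, ∃ e ∈ A, (∀ᶠ y' in 𝓝 y, e y' = 0) ∧ ∀ᶠ x in 𝓟 L, e x = 1 := by
    intro y hy
    obtain ⟨e, he, h0, h1⟩ := exists_zero_on_of_local (A := A) hL.isCompact (l := 𝓝 y)
      fun x hx => exists_local_zero_one hA
        (hsep x y fun hxy => hKL.le_bot ⟨hy, hxy ▸ hx⟩)
    -- The first compactness argument gave `e = 0` on `L` and `e = 1` near `y`. Passing to `1 - e`
    -- exchanges the roles, so that a second one can run over `K`.
    refine ⟨1 - e, sub_mem (one_mem _) he, ?_, ?_⟩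
    · filter_upwards [h1] with y' hy'
      simp [hy']
    · simpa using h0
  obtain ⟨e, he, h0, h1⟩ := exists_zero_on_of_local hK.isCompact h1
  rw [eventually_principal] at h1
  -- The values on `K` and `L` are already right; this last cutoff only forces norm at most `1`.
  refine ⟨cfc ramp (star e * e), cfc_mem (hs := hA) ramp (mul_mem (star_mem he) he), ?_, ?_, ?_⟩
  · intro x hx
    rw [cfc_ramp_apply, h0 x hx]
    exact cfc_ramp_eq_zero (by simp)
  · intro x hx
    rw [cfc_ramp_apply, h1 x hx]
    exact cfc_ramp_eq_one (by simp) (IsSelfAdjoint.star_mul_self _).isStarNormal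
  · intro x
    rw [cfc_ramp_apply]
    exact norm_cfc_le zero_le_one fun z _ => norm_ramp_le z

/-- The truncations of `s` between consecutive integers add up to `s`. -/
theorem sum_truncations (N : ℕ) {s : ℝ} (h0 : 0 ≤ s) (hN : s ≤ N) :
    ∑ k ∈ Finset.range N, max 0 (min 1 (s - k)) = s := by
  have key : ∀ M : ℕ, ∑ k ∈ Finset.range M, max 0 (min 1 (s - k)) = min s M := by
    intro M
    induction M with
    | zero => simp [h0]
    | succ M ih =>
      rw [Finset.sum_range_succ, ih]
      push_cast
      rcases le_total s M with h | h
      · rw [min_eq_left h, max_eq_left ((min_le_right _ _).trans (by linarith)), add_zero,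
          min_eq_left (by linarith)]
      · rw [min_eq_right h, max_eq_right (le_min zero_le_one (by linarith)), ← min_add_add_left,
          min_comm]
        congr 1
        ring
  rw [key, min_eq_left hN]

theorem norm_algebraMap_le (c : ℂ) : ‖(c • 1 : B)‖ ≤ ‖c‖ := by
  nontriviality B
  rw [norm_smul, norm_one, mul_one]

/-- The scalar functions belong to a closed `⋆`-subalgebra which separates points by `0` and `1`. -/
theorem scalar_mem (hA : IsClosed (A : Set C(X, B)))
    (hsep : ∀ x y, x ≠ y → ∃ a ∈ A, a x = 0 ∧ a y = 1) (f : C(X, ℝ))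
    (hf0 : ∀ x, 0 ≤ f x) (hf1 : ∀ x, f x ≤ 1) (F : C(X, B))
    (hF : ∀ x, F x = ((f x : ℝ) : ℂ) • (1 : B)) : F ∈ A := by
  rw [← SetLike.mem_coe, ← hA.closure_eq, Metric.mem_closure_iff]
  intro ε hε
  -- `N f` is the sum of its truncations between consecutive integers. Replacing the `k`-th
  -- truncation by a Urysohn element `e k` changes nothing at `x` unless `k = ⌊N f x⌋₊`, and that
  -- single term costs at most `2`; the total error is `2 / N`.
  obtain ⟨N, hN⟩ := exists_nat_gt (2 / ε)
  have hN0 : (0 : ℝ) < N := (by positivity : (0 : ℝ) < 2 / ε).trans hN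
  have hlev : ∀ k : ℕ, ∃ e ∈ A, (∀ x, N * f x ≤ k → e x = 0) ∧ (∀ x, k + 1 ≤ N * f x → e x = 1) ∧
      ∀ x, ‖e x‖ ≤ 1 := by
    intro k
    exact exists_zero_on_one_on hA hsep (K := {x | N * f x ≤ k}) (L := {x | k + 1 ≤ N * f x})
      (isClosed_le (by fun_prop) (by fun_prop)) (isClosed_le (by fun_prop) (by fun_prop))
      (Set.disjoint_left.2 fun x (h1 : N * f x ≤ k) (h2 : k + 1 ≤ N * f x) => by linarith)
  choose e heA he0 he1 hen using hlev
  refine ⟨((N : ℂ)⁻¹) • ∑ k ∈ Finset.range N, e k, A.smul_mem (sum_mem fun k _ => heA k) _, ?_⟩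
  refine lt_of_le_of_lt ((ContinuousMap.dist_le (C := 2 / N) (by positivity)).2 fun x => ?_)
    ((div_lt_comm₀ hε hN0).1 hN)
  have hs0 : 0 ≤ N * f x := mul_nonneg hN0.le (hf0 x)
  have hs1 : N * f x ≤ N := mul_le_of_le_one_right hN0.le (hf1 x)
  have hsum := sum_truncations N hs0 hs1
  have h1 : F x = (N : ℂ)⁻¹ • ∑ k ∈ Finset.range N,
      (((max 0 (min 1 (N * f x - k)) : ℝ) : ℂ) • (1 : B)) := by
    rw [← Finset.sum_smul, ← Complex.ofReal_sum, hsum, hF, smul_smul]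
    congr 1
    push_cast
    rw [inv_mul_cancel_left₀ (by exact_mod_cast hN0.ne')]
  rw [dist_eq_norm, h1, ContinuousMap.smul_apply, ContinuousMap.sum_apply, ← smul_sub,
    ← Finset.sum_sub_distrib, norm_smul, norm_inv, Complex.norm_natCast, inv_mul_eq_div]
  gcongr
  have hterm : ∀ k ∈ Finset.range N, k ≠ ⌊N * f x⌋₊ →
      ‖((max 0 (min 1 (N * f x - k)) : ℝ) : ℂ) • (1 : B) - e k x‖ = 0 := by
    intro k _ hk
    rcases lt_or_gt_of_ne hk with h | h
    · have h2 : (k : ℝ) + 1 ≤ N * f x := by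
        have := (Nat.le_floor_iff hs0).1 (Nat.succ_le_of_lt h)
        exact_mod_cast this
      rw [he1 k x h2, min_eq_left (by linarith), max_eq_right zero_le_one]
      simp
    · have h2 : N * f x ≤ k := ((Nat.floor_lt hs0).1 h).le
      rw [he0 k x h2, max_eq_left ((min_le_right _ _).trans (by linarith))]
      simp
  refine (norm_sum_le _ _).trans ?_
  have hbd : ∀ k : ℕ, ‖((max 0 (min 1 (N * f x - k)) : ℝ) : ℂ) • (1 : B) - e k x‖ ≤ 2 := by
    intro k
    refine (norm_sub_le _ _).trans ?_
    have := hen k x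
    have h3 := norm_algebraMap_le (B := B) ((max 0 (min 1 (N * f x - k)) : ℝ) : ℂ)
    rw [Complex.norm_real, Real.norm_eq_abs, abs_of_nonneg (le_max_left _ _)] at h3
    have h4 : max 0 (min 1 (N * f x - k)) ≤ 1 := max_le zero_le_one (min_le_left _ _)
    linarith
  -- When `f x = 1` the exceptional index is `N`, outside the range, and every term is exact.
  by_cases hm : ⌊N * f x⌋₊ ∈ Finset.range N
  · rw [Finset.sum_eq_single_of_mem _ hm hterm]
    exact hbd _
  · rw [Finset.sum_eq_zero fun k hk => hterm k hk fun h => hm (h ▸ hk)]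
    norm_num

/-- Stone–Weierstrass theorem for `C⋆`-algebra valued functions. -/
theorem mem_of_pointwise_mem [T2Space X] (hA : IsClosed (A : Set C(X, B)))
    (hsep : ∀ x y, x ≠ y → ∃ a ∈ A, a x = 0 ∧ a y = 1) (M : C(X, B))
    (hM : ∀ x, ∃ a ∈ A, a x = M x) : M ∈ A := by
  rw [← SetLike.mem_coe, ← hA.closure_eq, Metric.mem_closure_iff]
  intro ε hε
  choose a haA hax using hM
  obtain ⟨t, ht⟩ := isCompact_univ.elim_finite_subcover
    (fun x : X => {y | ‖a x y - M y‖ < ε / 2})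
    (fun x => isOpen_lt (by fun_prop) continuous_const)
    (fun x _ => mem_iUnion.2 ⟨x, by simp [hax, hε]⟩)
  obtain ⟨φ, hφ⟩ := PartitionOfUnity.exists_isSubordinate isClosed_univ
    (fun x : t => {y | ‖a x y - M y‖ < ε / 2})
    (fun x => isOpen_lt (by fun_prop) continuous_const)
    (fun y hy => by
      obtain ⟨x, hx, hxy⟩ := mem_iUnion₂.1 (ht hy)
      exact mem_iUnion.2 ⟨⟨x, hx⟩, hxy⟩)
  -- The weights lie in `A` by `scalar_mem`, and `∑ F x * a x` is at each point a convex combination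
  -- of values within `ε / 2` of `M`.
  let F : t → C(X, B) := fun x => ⟨fun y => ((φ x y : ℝ) : ℂ) • (1 : B), by fun_prop⟩
  have hF : ∀ x, F x ∈ A := fun x => scalar_mem hA hsep (φ x) (fun y => φ.nonneg x y)
    (fun y => φ.le_one x y) (F x) fun _ => rfl
  refine ⟨∑ x : t, F x * a x, sum_mem fun x _ => mul_mem (hF x) (haA x), ?_⟩
  refine lt_of_le_of_lt ((ContinuousMap.dist_le (C := ε / 2) (by positivity)).2 fun y => ?_)
    (half_lt_self hε)
  have hone : ∑ x : t, φ x y = 1 := by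
    rw [← finsum_eq_sum_of_fintype]
    exact φ.sum_eq_one (mem_univ y)
  have h1 : M y = ∑ x : t, ((φ x y : ℝ) : ℂ) • M y := by
    rw [← Finset.sum_smul, ← Complex.ofReal_sum, hone, Complex.ofReal_one, one_smul]
  rw [dist_comm, dist_eq_norm, ContinuousMap.sum_apply]
  conv_lhs => rw [h1]
  rw [← Finset.sum_sub_distrib]
  refine (norm_sum_le _ _).trans ?_
  calc ∑ x : t, ‖(F x * a x) y - ((φ x y : ℝ) : ℂ) • M y‖ ≤ ∑ x : t, φ x y * (ε / 2) := by
        refine Finset.sum_le_sum fun x _ => ?_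
        have h2 : (F x * a x) y - ((φ x y : ℝ) : ℂ) • M y
            = ((φ x y : ℝ) : ℂ) • (a x y - M y) := by
          simp [F, smul_sub]
        rw [h2, norm_smul, Complex.norm_real, Real.norm_eq_abs, abs_of_nonneg (φ.nonneg x y)]
        by_cases hy : φ x y = 0
        · simp [hy]
        · exact mul_le_mul_of_nonneg_left
            (le_of_lt (hφ x (subset_closure (Function.mem_support.2 hy)))) (φ.nonneg x y)
    _ = ε / 2 := by rw [← Finset.sum_mul, hone, one_mul]

end StoneWeierstrass

/-! ### Laguerre polynomials: orthonormality, decay, independence. -/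

section Laguerre

open Polynomial

/-- `P ↦ P' - P`, the operator `e^t (d/dt) e^{-t}` on polynomials. -/
def twist : ℝ[X] →ₗ[ℝ] ℝ[X] := derivative - LinearMap.id

theorem twist_apply (P : ℝ[X]) : twist P = derivative P - P := rfl

theorem hasDerivAt_exp_neg_mul (P : ℝ[X]) (y : ℝ) :
    HasDerivAt (fun t => Real.exp (-t) * P.eval t) (Real.exp (-y) * (twist P).eval y) y := by
  have h1 : HasDerivAt (fun t : ℝ => Real.exp (-t)) (-Real.exp (-y)) y := by
    simpa using (hasDerivAt_neg y).exp
  have := h1.mul (P.hasDerivAt y)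
  refine this.congr_deriv ?_
  rw [twist_apply, eval_sub]
  ring

theorem iteratedDeriv_exp_neg_mul (P : ℝ[X]) (m : ℕ) :
    iteratedDeriv m (fun t => Real.exp (-t) * P.eval t) =
      fun t => Real.exp (-t) * ((twist^[m]) P).eval t := by
  induction m with
  | zero => simp
  | succ m ih =>
    rw [iteratedDeriv_succ, ih, Function.iterate_succ_apply']
    ext y
    exact (hasDerivAt_exp_neg_mul _ y).deriv

/-- The Laguerre polynomial as a formal polynomial. -/
def lagP (m : ℕ) : ℝ[X] := C ((m.factorial : ℝ)⁻¹) * (twist^[m]) (X ^ m)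

theorem laguerrePoly_eq (m : ℕ) (y : ℝ) : laguerrePoly m y = (lagP m).eval y := by
  have h := congrFun (iteratedDeriv_exp_neg_mul (X ^ m) m) y
  simp only [eval_pow, eval_X] at h
  rw [laguerrePoly, h, lagP, eval_mul, eval_C]
  have : Real.exp y * Real.exp (-y) = 1 := by rw [← Real.exp_add]; simp
  linear_combination (((twist^[m]) (X ^ m)).eval y / (m.factorial : ℝ)) * this

/-- Differentiation lowers the degree, so on the coefficient of `X ^ m` only `-id` acts. -/
theorem natDegree_twist_iterate_le (k m : ℕ) {P : ℝ[X]} (hP : P.natDegree ≤ m) :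
    ((twist^[k]) P).natDegree ≤ m ∧ ((twist^[k]) P).coeff m = (-1) ^ k * P.coeff m := by
  induction k with
  | zero => simpa using hP
  | succ k ih =>
    rw [Function.iterate_succ_apply', twist_apply]
    refine ⟨(natDegree_sub_le _ _).trans (max_le ?_ ih.1), ?_⟩
    · exact (natDegree_derivative_le _).trans ((Nat.sub_le _ _).trans ih.1)
    · rw [coeff_sub, ih.2, coeff_derivative, coeff_eq_zero_of_natDegree_lt (by have := ih.1; omega)]
      ring

theorem natDegree_lagP_le (m : ℕ) : (lagP m).natDegree ≤ m := by
  refine (natDegree_C_mul_le _ _).trans ?_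
  exact (natDegree_twist_iterate_le m m (natDegree_X_pow_le m)).1

theorem coeff_lagP (m : ℕ) : (lagP m).coeff m = (-1) ^ m * (m.factorial : ℝ)⁻¹ := by
  rw [lagP, coeff_C_mul, (natDegree_twist_iterate_le m m (natDegree_X_pow_le m)).2]
  simp [mul_comm]

/-- Each application removes at most one factor `X`. This makes the boundary terms at `0` vanish in
the repeated integration by parts. -/
theorem eval_zero_twist_iterate {k m : ℕ} (h : k < m) : ((twist^[k]) (X ^ m : ℝ[X])).eval 0 = 0 := by
  have : ∀ k, ∃ Q : ℝ[X], k ≤ m → (twist^[k]) (X ^ m : ℝ[X]) = X ^ (m - k) * Q := by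
    intro k
    induction k with
    | zero => exact ⟨1, fun _ => by simp⟩
    | succ k ih =>
      obtain ⟨Q, hQ⟩ := ih
      refine ⟨C ((m - k : ℕ) : ℝ) * Q + X * derivative Q - X * Q, fun hk => ?_⟩
      rw [Function.iterate_succ_apply', hQ (by omega), twist_apply, derivative_mul,
        derivative_X_pow]
      obtain ⟨d, hd⟩ : ∃ d, m - k = d + 1 := ⟨m - k - 1, by omega⟩
      rw [show m - (k + 1) = d by omega, hd]
      simp only [Nat.add_sub_cancel]
      ring
  obtain ⟨Q, hQ⟩ := this k
  rw [hQ h.le, eval_mul, eval_pow, eval_X, zero_pow (by omega), zero_mul]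

theorem integrableOn_eval_mul_exp_neg (P : ℝ[X]) :
    IntegrableOn (fun y => P.eval y * Real.exp (-y)) (Ioi 0) := by
  induction P using Polynomial.induction_on' with
  | add p q hp hq =>
    refine (hp.add hq).congr (Eventually.of_forall fun y => ?_)
    simp [add_mul]
  | monomial k a =>
    have := (Real.GammaIntegral_convergent (s := k + 1) (by positivity)).const_mul a
    refine IntegrableOn.congr_fun this (fun y hy => ?_) measurableSet_Ioi
    simp only [add_sub_cancel_right, Real.rpow_natCast, eval_monomial]
    ring

/-- The integral of a polynomial against `e^{-y}` on the half line. -/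
def expInt (P : ℝ[X]) : ℝ := ∫ y in Ioi (0 : ℝ), P.eval y * Real.exp (-y)

theorem expInt_add (P Q : ℝ[X]) : expInt (P + Q) = expInt P + expInt Q := by
  rw [expInt, expInt, expInt,
    ← integral_add (integrableOn_eval_mul_exp_neg P) (integrableOn_eval_mul_exp_neg Q)]
  simp only [eval_add, add_mul]

theorem expInt_C_mul (c : ℝ) (P : ℝ[X]) : expInt (C c * P) = c * expInt P := by
  simp only [expInt, eval_mul, eval_C, mul_assoc, integral_const_mul]

/-- The integrand is the derivative of `e^{-y} P(y)`, which tends to `0` at infinity. -/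
theorem expInt_twist (P : ℝ[X]) : expInt (twist P) = -P.eval 0 := by
  have h := integral_Ioi_of_hasDerivAt_of_tendsto' (a := 0) (m := 0)
    (f := fun t => Real.exp (-t) * P.eval t) (f' := fun y => Real.exp (-y) * (twist P).eval y)
    (fun y _ => hasDerivAt_exp_neg_mul P y)
    ((integrableOn_eval_mul_exp_neg (twist P)).congr_fun (fun y _ => mul_comm _ _)
      measurableSet_Ioi) ?_
  · simp only [expInt]
    simp only [mul_comm (Real.exp _)] at h
    rw [h]
    simp
  · refine (P.tendsto_div_exp_atTop).congr fun y => ?_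
    rw [Real.exp_neg, div_eq_inv_mul]

theorem expInt_mul_twist (P Q : ℝ[X]) :
    expInt (Q * twist P) = -(Q.eval 0 * P.eval 0) - expInt (derivative Q * P) := by
  have h : Q * twist P = twist (Q * P) + C (-1) * (derivative Q * P) := by
    simp only [twist_apply, derivative_mul, map_neg, map_one]
    ring
  rw [h, expInt_add, expInt_C_mul, expInt_twist, eval_mul]
  ring

theorem expInt_mul_twist_iterate (m : ℕ) (Q : ℝ[X]) {k : ℕ} (hk : k ≤ m) :
    expInt (Q * (twist^[k]) (X ^ m)) = (-1) ^ k * expInt ((derivative^[k]) Q * X ^ m) := by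
  induction k generalizing Q with
  | zero => simp
  | succ k ih =>
    rw [Function.iterate_succ_apply', expInt_mul_twist, eval_zero_twist_iterate (by omega),
      ih _ (by omega), Function.iterate_succ_apply]
    ring

theorem expInt_X_pow (m : ℕ) : expInt (X ^ m) = m.factorial := by
  induction m with
  | zero =>
    have := expInt_twist (-1)
    simpa [twist_apply] using this
  | succ m ih =>
    have h : (X ^ (m + 1) : ℝ[X]) = C (-1) * twist (X ^ (m + 1)) + C ((m + 1 : ℕ) : ℝ) * X ^ m := by
      rw [twist_apply, derivative_X_pow]
      simp
    rw [h, expInt_add, expInt_C_mul, expInt_C_mul, expInt_twist, ih]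
    simp [Nat.factorial_succ]

/-- After `m` integrations by parts all derivatives sit on `Q`, and only its coefficient of degree
`m` survives. Orthonormality follows by taking for `Q` a Laguerre polynomial of degree at most `m`.
-/
theorem expInt_mul_lagP (m : ℕ) {Q : ℝ[X]} (hQ : Q.natDegree ≤ m) :
    expInt (Q * lagP m) = (-1) ^ m * m.factorial * Q.coeff m := by
  have h1 : (derivative^[m]) Q = C (m.factorial * Q.coeff m) := by
    have hd : ((derivative^[m]) Q).natDegree ≤ 0 :=
      (natDegree_iterate_derivative Q m).trans (by omega)
    rw [eq_C_of_natDegree_le_zero hd, coeff_iterate_derivative]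
    simp [Nat.descFactorial_self]
  have h2 : Q * lagP m = C ((m.factorial : ℝ)⁻¹) * (Q * (twist^[m]) (X ^ m)) := by
    rw [lagP]; ring
  rw [h2, expInt_C_mul, expInt_mul_twist_iterate m Q le_rfl, h1, expInt_C_mul, expInt_X_pow]
  field_simp

theorem expInt_lagP_mul_lagP (j k : ℕ) :
    expInt (lagP j * lagP k) = if j = k then 1 else 0 := by
  have key : ∀ j k, j ≤ k → expInt (lagP j * lagP k) = if j = k then 1 else 0 := by
    intro j k hjk
    rw [expInt_mul_lagP k ((natDegree_lagP_le j).trans hjk)]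
    split_ifs with h
    · subst h
      rw [coeff_lagP]
      have : ((-1 : ℝ) ^ j) * (-1) ^ j = 1 := by rw [← mul_pow]; simp
      field_simp
      linear_combination this
    · rw [coeff_eq_zero_of_natDegree_lt ((natDegree_lagP_le j).trans_lt (lt_of_le_of_ne hjk h)),
        mul_zero]
  rcases le_total j k with h | h
  · exact key j k h
  · rw [mul_comm, key k j h]
    simp only [eq_comm]

theorem laguerreFun_mul (j k : ℕ) (y : ℝ) : laguerreFun j y * laguerreFun k y =
    (-1) ^ (j + k) * ((lagP j * lagP k).eval y * Real.exp (-y)) := by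
  have : Real.exp (-y) = Real.exp (-y / 2) * Real.exp (-y / 2) := by
    rw [← Real.exp_add]; ring_nf
  rw [laguerreFun, laguerreFun, laguerrePoly_eq, laguerrePoly_eq, this, eval_mul, pow_add]
  ring

theorem continuous_laguerreFun (j : ℕ) : Continuous (laguerreFun j) := by
  have : laguerreFun j = fun y => (-1) ^ j * (lagP j).eval y * Real.exp (-y / 2) := by
    ext y; rw [laguerreFun, laguerrePoly_eq]
  rw [this]
  fun_prop

theorem integrableOn_laguerreFun_mul (j k : ℕ) :
    IntegrableOn (fun y => laguerreFun j y * laguerreFun k y) (Ioi 0) := by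
  simp only [laguerreFun_mul]
  exact (integrableOn_eval_mul_exp_neg _).const_mul _

theorem integral_laguerreFun_mul (j k : ℕ) :
    ∫ y in Ioi (0 : ℝ), laguerreFun j y * laguerreFun k y = if j = k then 1 else 0 := by
  simp only [laguerreFun_mul, integral_const_mul]
  have := expInt_lagP_mul_lagP j k
  rw [expInt] at this
  rw [this]
  split_ifs with h
  · simp [h, ← two_mul]
  · simp

/-- A polynomial times `e^{-y}` is bounded by a multiple of `e^{-y/2}` on the half line. -/
theorem exists_eval_mul_exp_le (P : ℝ[X]) :
    ∃ C : ℝ, 0 ≤ C ∧ ∀ y, 0 ≤ y → |P.eval y| * Real.exp (-y) ≤ C * Real.exp (-y / 2) := by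
  have h1 : ∃ C : ℝ, 0 ≤ C ∧ ∀ y, 0 ≤ y → |P.eval y| ≤ C * Real.exp (y / 2) := by
    induction P using Polynomial.induction_on' with
    | add p q hp hq =>
      obtain ⟨C, hC, h⟩ := hp
      obtain ⟨C', hC', h'⟩ := hq
      refine ⟨C + C', by positivity, fun y hy => ?_⟩
      rw [eval_add, add_mul]
      exact (abs_add_le _ _).trans (add_le_add (h y hy) (h' y hy))
    | monomial k a =>
      refine ⟨|a| * (2 ^ k * k.factorial), by positivity, fun y hy => ?_⟩
      have := Real.pow_div_factorial_le_exp (y / 2) (by positivity) k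
      rw [div_le_iff₀ (by positivity), div_pow, div_le_iff₀ (by positivity)] at this
      rw [eval_monomial, abs_mul, abs_of_nonneg (pow_nonneg hy k), mul_assoc]
      gcongr
      linarith
  obtain ⟨C, hC, h⟩ := h1
  refine ⟨C, hC, fun y hy => ?_⟩
  calc |P.eval y| * Real.exp (-y) ≤ C * Real.exp (y / 2) * Real.exp (-y) := by
        gcongr; exact h y hy
    _ = C * Real.exp (-y / 2) := by rw [mul_assoc, ← Real.exp_add]; ring_nf

theorem exists_laguerreFun_mul_le (j k : ℕ) :
    ∃ C : ℝ, 0 ≤ C ∧ ∀ y, 0 ≤ y → |laguerreFun j y * laguerreFun k y| ≤ C * Real.exp (-y / 2) := by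
  obtain ⟨C, hC, h⟩ := exists_eval_mul_exp_le (lagP j * lagP k)
  refine ⟨C, hC, fun y hy => ?_⟩
  rw [laguerreFun_mul, abs_mul, abs_mul, abs_pow, abs_neg, abs_one, one_pow, one_mul,
    Real.abs_exp]
  exact h y hy

/-- Laguerre functions are linearly independent on the half line. -/
theorem laguerreFun_linearIndependent {n : ℕ} (c : Fin n → ℂ)
    (h : ∀ y : ℝ, 0 < y → ∑ j, c j * (laguerreFun j y : ℂ) = 0) : c = 0 := by
  ext k
  have h1 : ∫ y in Ioi (0 : ℝ), ∑ j, c j * ((laguerreFun j y * laguerreFun k y : ℝ) : ℂ) = 0 := by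
    rw [setIntegral_congr_fun (g := fun _ => (0 : ℂ)) measurableSet_Ioi, integral_zero]
    intro y hy
    have := congrArg (· * (laguerreFun k y : ℂ)) (h y hy)
    simp only [Finset.sum_mul, zero_mul] at this
    simp only [Complex.ofReal_mul, ← mul_assoc]
    exact this
  rw [integral_finsetSum _ fun j _ => (integrableOn_laguerreFun_mul _ _).ofReal.const_mul _] at h1
  simp only [integral_const_mul, integral_complex_ofReal, integral_laguerreFun_mul, Fin.val_inj] at h1
  simpa [apply_ite] using h1

end Laguerre

/-! ### Continuity of `γ^b` and its limits at the two ends. -/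

section SpectralFunction

theorem exists_continuousMap_ennreal {E : Type*} [TopologicalSpace E] {f : ℝ → E} {a c : E}
    (hf : ContinuousOn f (Ioi 0)) (h0 : Tendsto f (𝓝[>] 0) (𝓝 a)) (h1 : Tendsto f atTop (𝓝 c)) :
    ∃ M : C(ℝ≥0∞, E), M 0 = a ∧ M ⊤ = c ∧ ∀ x : ℝ, 0 < x → M (ENNReal.ofReal x) = f x := by
  classical
  let g : ℝ≥0∞ → E := fun t => if t = 0 then a else if t = ⊤ then c else f t.toReal
  have hg : Continuous g := by
    rw [continuous_iff_continuousAt]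
    intro t
    rcases eq_or_ne t 0 with rfl | ht0
    · rw [continuousAt_iff_punctured_nhds]
      have hlim : Tendsto ENNReal.toReal (𝓝[≠] 0) (𝓝[>] 0) := by
        refine tendsto_nhdsWithin_iff.2 ⟨?_, ?_⟩
        · exact (ENNReal.tendsto_toReal ENNReal.zero_ne_top).mono_left nhdsWithin_le_nhds
        · filter_upwards [self_mem_nhdsWithin,
            mem_nhdsWithin_of_mem_nhds (isOpen_Iio.mem_nhds ENNReal.zero_lt_top)] with s hs hs'
          exact ENNReal.toReal_pos hs (ne_of_lt (show s < ⊤ from hs'))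
      have : g 0 = a := by simp [g]
      rw [this]
      refine (h0.comp hlim).congr' ?_
      filter_upwards [self_mem_nhdsWithin,
        mem_nhdsWithin_of_mem_nhds (isOpen_Iio.mem_nhds ENNReal.zero_lt_top)] with s hs hs'
      simp [g, show s ≠ 0 from hs, ne_of_lt (show s < ⊤ from hs')]
    rcases eq_or_ne t ⊤ with rfl | ht1
    · rw [continuousAt_iff_punctured_nhds]
      have hlim : Tendsto ENNReal.toReal (𝓝[≠] ⊤) atTop := by
        refine tendsto_atTop.2 fun r => ?_
        filter_upwards [self_mem_nhdsWithin, mem_nhdsWithin_of_mem_nhds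
          (isOpen_Ioi.mem_nhds (ENNReal.ofReal_lt_top (r := r)))] with s hs hs'
        exact (ENNReal.ofReal_le_iff_le_toReal hs).1 (le_of_lt hs')
      have : g ⊤ = c := by simp [g]
      rw [this]
      refine (h1.comp hlim).congr' ?_
      filter_upwards [self_mem_nhdsWithin, mem_nhdsWithin_of_mem_nhds
        (isOpen_Ioi.mem_nhds ENNReal.zero_lt_top)] with s hs hs'
      simp [g, show s ≠ ⊤ from hs, ne_of_gt (show 0 < s from hs')]
    · have h2 : ContinuousAt (fun s : ℝ≥0∞ => f s.toReal) t :=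
        (hf.continuousAt (Ioi_mem_nhds (ENNReal.toReal_pos ht0 ht1))).comp
          (ENNReal.tendsto_toReal ht1)
      refine h2.congr ?_
      filter_upwards [isOpen_ne.mem_nhds ht0, isOpen_ne.mem_nhds ht1] with s hs hs'
      simp [g, hs, hs']
  refine ⟨⟨g, hg⟩, by simp [g], by simp [g], fun x hx => ?_⟩
  simp [g, not_le.2 hx, ENNReal.toReal_ofReal hx.le]

theorem BSymbol.exists_bound (b : BSymbol) :
    ∃ C : ℝ, 0 ≤ C ∧ ∀ᵐ y ∂volume.restrict (Ioi (0 : ℝ)), ‖b.toFun y‖ ≤ C := by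
  refine ⟨(eLpNormEssSup b.toFun (volume.restrict (Ioi 0))).toReal, ENNReal.toReal_nonneg, ?_⟩
  have hb : eLpNormEssSup b.toFun (volume.restrict (Ioi 0)) ≠ ⊤ := by
    simpa only [eLpNorm_exponent_top] using b.memLp.2.ne
  filter_upwards [ae_le_eLpNormEssSup (f := b.toFun) (μ := volume.restrict (Ioi (0 : ℝ)))]
    with y hy
  rw [← toReal_enorm]
  exact ENNReal.toReal_mono hb hy

theorem quasiMeasurePreserving_mul_left {a : ℝ} (ha : 0 < a) :
    Measure.QuasiMeasurePreserving (fun y : ℝ => a * y) (volume.restrict (Ioi 0))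
      (volume.restrict (Ioi 0)) := by
  have h : Measure.QuasiMeasurePreserving (fun y : ℝ => a * y) volume volume := by
    refine ⟨by fun_prop, ?_⟩
    rw [Real.map_volume_mul_left ha.ne']
    exact Measure.smul_absolutelyContinuous
  exact h.restrict fun y (hy : 0 < y) => mul_pos ha hy

/-- The spectral density `2 x ℓ_j(2 x v) ℓ_k(2 x v)`. -/
def density (j k : ℕ) (x v : ℝ) : ℝ :=
  2 * x * (laguerreFun j (2 * x * v) * laguerreFun k (2 * x * v))

theorem continuous_density (j k : ℕ) : Continuous fun q : ℝ × ℝ => density j k q.1 q.2 := by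
  have := continuous_laguerreFun
  unfold density
  fun_prop

/-- The bound is uniform for `x` in a compact interval, as domination in the proof of continuity
requires. -/
theorem exists_density_le (j k : ℕ) {x₁ x₂ : ℝ} (h1 : 0 < x₁) :
    ∃ C : ℝ, ∀ x ∈ Icc x₁ x₂, ∀ v, 0 < v → |density j k x v| ≤ C * Real.exp (-x₁ * v) := by
  obtain ⟨C, hC, h⟩ := exists_laguerreFun_mul_le j k
  refine ⟨2 * x₂ * C, fun x hx v hv => ?_⟩
  have hx0 : 0 < x := h1.trans_le hx.1
  have h2 := h (2 * x * v) (by positivity)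
  rw [density, abs_mul, abs_of_pos (by positivity : 0 < 2 * x), mul_assoc (2 * x₂)]
  have h3 : Real.exp (-(2 * x * v) / 2) ≤ Real.exp (-x₁ * v) := by
    apply Real.exp_le_exp.2
    have := mul_le_mul_of_nonneg_right hx.1 hv.le
    linarith
  have h4 : x ≤ x₂ := hx.2
  have h5 := h2.trans (mul_le_mul_of_nonneg_left h3 hC)
  have h6 : 0 ≤ 2 * x₂ := by linarith
  gcongr

theorem integrableOn_density (j k : ℕ) {x : ℝ} (hx : 0 < x) :
    IntegrableOn (density j k x) (Ioi 0) := by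
  obtain ⟨C, hC⟩ := exists_density_le j k (x₂ := x) hx
  refine ((exp_neg_integrableOn_Ioi 0 hx).const_mul C).mono'
    ((continuous_density j k).comp (by fun_prop : Continuous fun v => (x, v))
      |>.aestronglyMeasurable) ?_
  exact (ae_restrict_iff' measurableSet_Ioi).2
    (Eventually.of_forall fun v hv => hC x ⟨le_rfl, le_rfl⟩ v hv)

variable {n : ℕ} (b : BSymbol)

/-- The substitution `y = 2xv` moves `x` from the merely measurable `b` into the smooth kernel. In
this form continuity in `x` is dominated convergence. -/
theorem spectralMatrix_eq_density {x : ℝ} (hx : 0 < x) (j k : Fin n) :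
    spectralMatrix n b x j k = ∫ v in Ioi (0 : ℝ), b.toFun v * (density j k x v : ℂ) := by
  have h := integral_comp_mul_left_Ioi (fun y => b.toFun (y / (2 * x)) *
      ((laguerreFun j y * laguerreFun k y : ℝ) : ℂ)) 0 (mul_pos two_pos hx)
  rw [mul_zero] at h
  rw [spectralMatrix, Matrix.of_apply, eq_comm]
  have h2 : ∫ v in Ioi (0 : ℝ), b.toFun v * (density j k x v : ℂ) = ((2 * x : ℝ) : ℂ) *
      ∫ v in Ioi (0 : ℝ), b.toFun (2 * x * v / (2 * x)) *
      ((laguerreFun j (2 * x * v) * laguerreFun k (2 * x * v) : ℝ) : ℂ) := by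
    rw [← integral_const_mul]
    refine integral_congr_ae (Eventually.of_forall fun v => ?_)
    simp only [density]
    rw [mul_div_cancel_left₀ v (by positivity)]
    push_cast
    ring
  rw [h2, h, ← Complex.real_smul, smul_smul, mul_inv_cancel₀ (by positivity), one_smul]

theorem aestronglyMeasurable_mul_density (j k : ℕ) (x : ℝ) :
    AEStronglyMeasurable (fun v => b.toFun v * (density j k x v : ℂ))
      (volume.restrict (Ioi 0)) := by
  refine b.memLp.1.mul (Continuous.aestronglyMeasurable ?_)
  exact Complex.continuous_ofReal.comp
    ((continuous_density j k).comp (by fun_prop : Continuous fun v => (x, v)))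

theorem integrableOn_mul_density (j k : ℕ) {x : ℝ} (hx : 0 < x) :
    IntegrableOn (fun v => b.toFun v * (density j k x v : ℂ)) (Ioi 0) := by
  obtain ⟨C, hC, hb⟩ := b.exists_bound
  refine ((integrableOn_density j k hx).norm.const_mul C).mono'
    (aestronglyMeasurable_mul_density b j k x) ?_
  filter_upwards [hb] with v hv
  rw [norm_mul, Complex.norm_real]
  gcongr

theorem continuousOn_spectralMatrix : ContinuousOn (spectralMatrix n b) (Ioi 0) := by
  refine continuousOn_pi.2 fun j => continuousOn_pi.2 fun k => ?_
  refine ContinuousOn.congr (f := fun x => ∫ v in Ioi (0 : ℝ), b.toFun v * (density j k x v : ℂ))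
    ?_ fun x hx => spectralMatrix_eq_density b hx j k
  intro x (hx : 0 < x)
  refine ContinuousAt.continuousWithinAt ?_
  obtain ⟨C, hC, hb⟩ := b.exists_bound
  obtain ⟨D, hD⟩ := exists_density_le j k (x₁ := x / 2) (x₂ := 2 * x) (by positivity)
  refine continuousAt_of_dominated (bound := fun v => C * (D * Real.exp (-(x / 2) * v)))
    (Eventually.of_forall fun x => aestronglyMeasurable_mul_density b j k x) ?_
    (((exp_neg_integrableOn_Ioi 0 (by positivity)).const_mul D).const_mul C) ?_
  · filter_upwards [Icc_mem_nhds (show x / 2 < x by linarith) (show x < 2 * x by linarith)]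
      with x' hx'
    filter_upwards [hb, ae_restrict_mem measurableSet_Ioi] with v hv hv0
    rw [norm_mul, Complex.norm_real]
    gcongr
    exact hD x' hx' v hv0
  · refine Eventually.of_forall fun v => Continuous.continuousAt ?_
    have := (continuous_density j k).comp (by fun_prop : Continuous fun x => (x, v))
    exact continuous_const.mul (Complex.continuous_ofReal.comp this)

/-- Here the original form of the integral is the right one: `b(y / 2x)` tends to the constant `c`
for each `y`, and orthonormality of the Laguerre functions turns the limit into `c I`. -/
theorem tendsto_spectralMatrix {l : Filter ℝ} [l.IsCountablyGenerated] {c : ℂ}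
    (hl : ∀ᶠ x in l, 0 < x)
    (h : ∀ y : ℝ, 0 < y → Tendsto (fun x => b.toFun (y / (2 * x))) l (𝓝 c)) :
    Tendsto (spectralMatrix n b) l (𝓝 (c • 1)) := by
  refine tendsto_pi_nhds.2 fun j => tendsto_pi_nhds.2 fun k => ?_
  obtain ⟨C, hC, hb⟩ := b.exists_bound
  have hlim : (c • (1 : Matrix (Fin n) (Fin n) ℂ)) j k = ∫ y in Ioi (0 : ℝ),
      c * ((laguerreFun j y * laguerreFun k y : ℝ) : ℂ) := by
    rw [integral_const_mul, integral_complex_ofReal, integral_laguerreFun_mul, Matrix.smul_apply,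
      Matrix.one_apply]
    by_cases hjk : j = k <;> simp [Fin.val_inj, hjk]
  rw [hlim]
  have hq : ∀ x : ℝ, 0 < x → Measure.QuasiMeasurePreserving (fun y : ℝ => y / (2 * x))
      (volume.restrict (Ioi 0)) (volume.restrict (Ioi 0)) := fun x hx => by
    simpa only [div_eq_inv_mul] using
      quasiMeasurePreserving_mul_left (inv_pos.2 (mul_pos two_pos hx))
  refine tendsto_integral_filter_of_dominated_convergence
    (fun y => C * ‖laguerreFun j y * laguerreFun k y‖) ?_ ?_
    ((integrableOn_laguerreFun_mul _ _).norm.const_mul C) ?_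
  · filter_upwards [hl] with x hx
    refine (b.memLp.1.comp_quasiMeasurePreserving (hq x hx)).mul (Continuous.aestronglyMeasurable ?_)
    exact Complex.continuous_ofReal.comp ((continuous_laguerreFun _).mul (continuous_laguerreFun _))
  · filter_upwards [hl] with x hx
    filter_upwards [(hq x hx).ae hb] with y hy
    rw [norm_mul, Complex.norm_real]
    gcongr
  · filter_upwards [ae_restrict_mem measurableSet_Ioi] with y hy
    exact (h y hy).mul_const _

/-- `γ^b` extends continuously to `[0, ∞]`; its values at the ends are the limits of `b` at the
opposite ends. -/
theorem exists_spectralFun {c₀ c₁ : ℂ} (h0 : Tendsto b.toFun (𝓝[>] 0) (𝓝 c₀))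
    (h1 : Tendsto b.toFun atTop (𝓝 c₁)) :
    ∃ M : MatFun n, M 0 = c₁ • 1 ∧ M ⊤ = c₀ • 1 ∧ IsSpectralFun n b M := by
  refine exists_continuousMap_ennreal (continuousOn_spectralMatrix b)
    (tendsto_spectralMatrix b self_mem_nhdsWithin fun y hy => h1.comp ?_)
    (tendsto_spectralMatrix b (eventually_gt_atTop 0) fun y hy => h0.comp ?_)
  · have : Tendsto (fun x : ℝ => y / 2 * x⁻¹) (𝓝[>] 0) atTop :=
      tendsto_inv_nhdsGT_zero.const_mul_atTop (by positivity)
    refine this.congr fun x => ?_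
    field_simp
  · refine tendsto_nhdsWithin_iff.2 ⟨?_, ?_⟩
    · have : Tendsto (fun x : ℝ => y / 2 * x⁻¹) atTop (𝓝 (y / 2 * 0)) :=
        tendsto_inv_atTop_zero.const_mul _
      rw [mul_zero] at this
      refine this.congr fun x => ?_
      field_simp
    · filter_upwards [eventually_gt_atTop 0] with x hx
      exact div_pos hy (mul_pos two_pos hx)

theorem exists_mem_scalarEnds : ∃ M ∈ scalarEnds n, IsSpectralFun n b M := by
  obtain ⟨c₀, h0⟩ := b.lim_zero
  obtain ⟨c₁, h1⟩ := b.lim_top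
  obtain ⟨M, hM0, hM1, hM⟩ := exists_spectralFun (n := n) b h0 h1
  exact ⟨M, ⟨⟨c₁, hM0⟩, c₀, hM1⟩, hM⟩

/-- Removing the two ends from `[0, ∞]` leaves a dense set. -/
theorem isSpectralFun_unique {M N : MatFun n} (hM : IsSpectralFun n b M)
    (hN : IsSpectralFun n b N) : M = N := by
  refine DFunLike.coe_injective (Continuous.ext_on (s := {0, ⊤}ᶜ) ?_ M.continuous N.continuous ?_)
  · exact by simpa [compl_eq_univ_sdiff] using dense_univ.sdiff_finite (Set.toFinite ({0, ⊤} : Set ℝ≥0∞))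
  · intro t ht
    simp only [mem_compl_iff, mem_insert_iff, mem_singleton_iff, not_or] at ht
    rw [← ENNReal.ofReal_toReal ht.2, hM _ (ENNReal.toReal_pos ht.1 ht.2),
      hN _ (ENNReal.toReal_pos ht.1 ht.2)]

end SpectralFunction

/-! ### Independence of exponential polynomials with different exponents. -/

section ExpPoly

open Polynomial

/-- The polynomial factor of a Laguerre function. -/
def lagC (j : ℕ) : ℂ[X] := C ((-1) ^ j) * (lagP j).map Complex.ofRealHom

theorem eval_lagC (j : ℕ) (y : ℝ) :
    (lagC j).eval (y : ℂ) = (((-1) ^ j * (lagP j).eval y : ℝ) : ℂ) := by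
  rw [lagC, eval_mul, eval_C, ← Complex.ofRealHom_eq_coe, eval_map_apply]
  simp

theorem laguerreFun_eq_lagC (j : ℕ) (y : ℝ) :
    (laguerreFun j y : ℂ) = (lagC j).eval (y : ℂ) * (Real.exp (-y / 2) : ℂ) := by
  rw [eval_lagC, laguerreFun, laguerrePoly_eq]
  push_cast
  ring

theorem polynomial_eq_zero_of_pos {p : ℂ[X]} (h : ∀ v : ℝ, 0 < v → p.eval (v : ℂ) = 0) :
    p = 0 := by
  refine p.eq_zero_of_infinite_isRoot (Set.Infinite.mono (s := (fun v : ℝ => (v : ℂ)) '' Ioi 0) ?_ ?_)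
  · rintro _ ⟨v, hv, rfl⟩
    exact h v hv
  · exact (Set.Ioi_infinite 0).image Complex.ofReal_injective.injOn

theorem tendsto_exp_mul_polynomial {δ : ℝ} (hδ : 0 < δ) (q : ℂ[X]) :
    Tendsto (fun v : ℝ => (Real.exp (-δ * v) : ℂ) * q.eval (v : ℂ)) atTop (𝓝 0) := by
  induction q using Polynomial.induction_on' with
  | add p q hp hq => simpa [mul_add] using hp.add hq
  | monomial k a =>
    have h := tendsto_rpow_mul_exp_neg_mul_atTop_nhds_zero k δ hδ
    have h2 := (Complex.continuous_ofReal.tendsto 0).comp h |>.mul_const a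
    rw [Complex.ofReal_zero, zero_mul] at h2
    refine h2.congr fun v => ?_
    simp only [Function.comp_apply, Real.rpow_natCast, eval_monomial]
    push_cast
    ring

theorem polynomial_eq_zero_of_tendsto {p : ℂ[X]}
    (h : Tendsto (fun v : ℝ => p.eval (v : ℂ)) atTop (𝓝 0)) : p = 0 := by
  by_contra hp
  rcases lt_or_ge 0 p.degree with hd | hd
  · have h1 : Tendsto (fun v : ℝ => ‖(v : ℂ)‖) atTop atTop := by
      simpa using tendsto_abs_atTop_atTop
    exact not_tendsto_nhds_of_tendsto_atTop (p.tendsto_norm_atTop hd h1) _ h.norm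
  · rw [eq_C_of_degree_le_zero hd] at h hp
    simp only [eval_C] at h
    exact hp (by rw [tendsto_nhds_unique tendsto_const_nhds h, map_zero])

/-- Multiplied by the inverse of the slower exponential, the relation says that one polynomial tends
to `0` at infinity, so it vanishes. If `p` carries the faster exponential, the argument first
removes `q`. -/
theorem exp_mul_polynomial_independent {a c : ℝ} (hac : a ≠ c) {p q : ℂ[X]}
    (h : ∀ v : ℝ, 0 < v → (Real.exp (-a * v) : ℂ) * p.eval (v : ℂ) +
      (Real.exp (-c * v) : ℂ) * q.eval (v : ℂ) = 0) : p = 0 := by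
  have key : ∀ {a c : ℝ} {p q : ℂ[X]}, a < c → (∀ v : ℝ, 0 < v →
      (Real.exp (-a * v) : ℂ) * p.eval (v : ℂ) +
      (Real.exp (-c * v) : ℂ) * q.eval (v : ℂ) = 0) → p = 0 := by
    intro a c p q hac h
    refine polynomial_eq_zero_of_tendsto ?_
    have h1 := (tendsto_exp_mul_polynomial (sub_pos.2 hac) q).neg
    rw [neg_zero] at h1
    refine h1.congr' ?_
    filter_upwards [eventually_gt_atTop 0] with v hv
    have h2 : (Real.exp (a * v) : ℂ) * (Real.exp (-a * v) : ℂ) = 1 := by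
      rw [← Complex.ofReal_mul, ← Real.exp_add]; simp
    have h3 : (Real.exp (a * v) : ℂ) * (Real.exp (-c * v) : ℂ) = (Real.exp (-(c - a) * v) : ℂ) := by
      rw [← Complex.ofReal_mul, ← Real.exp_add]; ring_nf
    linear_combination (-(Real.exp (a * v) : ℂ)) * h v hv + p.eval (v : ℂ) * h2 +
      q.eval (v : ℂ) * h3
  rcases lt_or_gt_of_ne hac with hlt | hgt
  · exact key hlt h
  · have hq : q = 0 := key hgt fun v hv => by rw [add_comm]; exact h v hv
    refine polynomial_eq_zero_of_pos fun v hv => ?_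
    have := h v hv
    simpa [hq] using this

end ExpPoly

/-! ### Linear functionals on the density matrices. -/

section Density

variable {n : ℕ}

/-- The matrix of spectral densities. -/
def densityMatrix (n : ℕ) (x v : ℝ) : Matrix (Fin n) (Fin n) ℂ :=
  Matrix.of fun j k => (density j k x v : ℂ)

theorem exists_coeff (f : Module.Dual ℂ (Matrix (Fin n) (Fin n) ℂ)) :
    ∃ α : Fin n → Fin n → ℂ, ∀ P, f P = ∑ j, ∑ k, α j k * P j k := by
  refine ⟨fun j k => f (Matrix.single j k 1), fun P => ?_⟩
  conv_lhs => rw [Matrix.matrix_eq_sum_single P]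
  simp only [map_sum]
  refine Finset.sum_congr rfl fun j _ => Finset.sum_congr rfl fun k _ => ?_
  have h : Matrix.single j k (P j k) = P j k • Matrix.single j k (1 : ℂ) := by
    rw [Matrix.smul_single, smul_eq_mul, mul_one]
  rw [h, map_smul, smul_eq_mul, mul_comm]

/-- A functional of the density matrix is an exponential polynomial. -/
theorem exists_polynomial_density (f : Module.Dual ℂ (Matrix (Fin n) (Fin n) ℂ)) (x : ℝ) :
    ∃ p : Polynomial ℂ, ∀ v, f (densityMatrix n x v) =
      (Real.exp (-(2 * x) * v) : ℂ) * p.eval (v : ℂ) := by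
  obtain ⟨α, hα⟩ := exists_coeff f
  refine ⟨∑ j : Fin n, ∑ k : Fin n, Polynomial.C (α j k * (2 * x : ℝ)) *
    (lagC j * lagC k).comp (Polynomial.C ((2 * x : ℝ) : ℂ) * Polynomial.X), fun v => ?_⟩
  rw [hα]
  simp only [Polynomial.eval_finsetSum, Finset.mul_sum]
  refine Finset.sum_congr rfl fun j _ => Finset.sum_congr rfl fun k _ => ?_
  have h1 : Real.exp (-(2 * x) * v) = Real.exp (-(2 * x * v) / 2) * Real.exp (-(2 * x * v) / 2) := by
    rw [← Real.exp_add]; ring_nf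
  simp only [Polynomial.eval_mul, Polynomial.eval_C, Polynomial.eval_comp, Polynomial.eval_X,
    densityMatrix, Matrix.of_apply, density]
  rw [Complex.ofReal_mul (2 * x), Complex.ofReal_mul (laguerreFun _ _), laguerreFun_eq_lagC,
    laguerreFun_eq_lagC, h1, Complex.ofReal_mul (2 * x) v, Complex.ofReal_mul (Real.exp _)]
  ring

theorem continuous_functional_density (f : Module.Dual ℂ (Matrix (Fin n) (Fin n) ℂ)) (x : ℝ) :
    Continuous fun v => f (densityMatrix n x v) := by
  obtain ⟨p, hp⟩ := exists_polynomial_density f x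
  simp only [hp]
  fun_prop

theorem functional_density_eq_zero {f g : Module.Dual ℂ (Matrix (Fin n) (Fin n) ℂ)} {x y : ℝ}
    (hxy : x ≠ y)
    (h : ∀ v : ℝ, 0 < v → f (densityMatrix n x v) + g (densityMatrix n y v) = 0) (v : ℝ) :
    f (densityMatrix n x v) = 0 := by
  obtain ⟨p, hp⟩ := exists_polynomial_density f x
  obtain ⟨q, hq⟩ := exists_polynomial_density g y
  simp only [hp, hq] at h
  have : p = 0 := exp_mul_polynomial_independent (by simpa using hxy) h
  rw [hp, this]
  simp

/-- With `ℓ` the vector of Laguerre functions, the density matrix is the rank-one matrix `2x ℓ(2xv)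
ℓ(2xv)ᵀ`. A product of two of them is therefore a scalar kernel times `ℓ(2xs) ℓ(2xr)ᵀ`. -/
theorem densityMatrix_mul_apply (x s r : ℝ) (j k : Fin n) :
    (densityMatrix n x s * densityMatrix n x r) j k = (2 * x) ^ 2 *
      (∑ i : Fin n, (laguerreFun i (2 * x * s) : ℂ) * laguerreFun i (2 * x * r)) *
      (laguerreFun j (2 * x * s) * laguerreFun k (2 * x * r)) := by
  rw [Matrix.mul_apply, Finset.mul_sum, Finset.sum_mul]
  refine Finset.sum_congr rfl fun i _ => ?_
  simp only [densityMatrix, Matrix.of_apply, density]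
  push_cast
  ring

/-- Products of density matrices at one point span all matrices. -/
theorem functional_eq_zero_of_density_mul (f : Module.Dual ℂ (Matrix (Fin n) (Fin n) ℂ)) {x : ℝ}
    (hx : 0 < x)
    (h : ∀ s r : ℝ, 0 < s → 0 < r → f (densityMatrix n x s * densityMatrix n x r) = 0) : f = 0 := by
  obtain ⟨α, hα⟩ := exists_coeff f
  have h1 : ∀ s r : ℝ, 0 < s → 0 < r →
      (∑ i : Fin n, (laguerreFun i s : ℂ) * laguerreFun i r) *
      (∑ k : Fin n, (∑ j : Fin n, α j k * laguerreFun j s) * (laguerreFun k r : ℂ)) = 0 := by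
    intro s r hs hr
    have h2 := h (s / (2 * x)) (r / (2 * x)) (by positivity) (by positivity)
    simp only [hα, densityMatrix_mul_apply] at h2
    rw [mul_div_cancel₀ s (by positivity), mul_div_cancel₀ r (by positivity)] at h2
    have h3 : ((2 * x : ℂ)) ^ 2 ≠ 0 := by
      have : (x : ℂ) ≠ 0 := by exact_mod_cast hx.ne'
      simp [this]
    refine (mul_eq_zero.1 (?_ : (2 * x : ℂ) ^ 2 * _ = 0)).resolve_left h3
    rw [← h2, Finset.sum_comm, ← mul_assoc, Finset.mul_sum]
    refine Finset.sum_congr rfl fun k _ => ?_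
    rw [Finset.sum_mul, Finset.mul_sum]
    refine Finset.sum_congr rfl fun j _ => ?_
    ring
  have h4 : ∀ s : ℝ, 0 < s → ∀ k : Fin n, ∑ j : Fin n, α j k * laguerreFun j s = 0 := by
    intro s hs k
    let U : Polynomial ℂ := ∑ i : Fin n, Polynomial.C (laguerreFun i s : ℂ) * lagC i
    let V : Polynomial ℂ := ∑ k : Fin n,
      Polynomial.C (∑ j : Fin n, α j k * laguerreFun j s) * lagC k
    have hU : ∀ r : ℝ, ∑ i : Fin n, (laguerreFun i s : ℂ) * laguerreFun i r =
        U.eval (r : ℂ) * (Real.exp (-r / 2) : ℂ) := by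
      intro r
      simp only [U, Polynomial.eval_finsetSum, Finset.sum_mul, Polynomial.eval_mul,
        Polynomial.eval_C, laguerreFun_eq_lagC _ r, mul_assoc]
    have hV : ∀ r : ℝ, ∑ k : Fin n, (∑ j : Fin n, α j k * laguerreFun j s) * (laguerreFun k r : ℂ) =
        V.eval (r : ℂ) * (Real.exp (-r / 2) : ℂ) := by
      intro r
      simp only [V, Polynomial.eval_finsetSum, Finset.sum_mul _ _ (Real.exp (-r / 2) : ℂ),
        Polynomial.eval_mul, Polynomial.eval_C, laguerreFun_eq_lagC _ r, mul_assoc]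
    have hexp : ∀ r : ℝ, (Real.exp (-r / 2) : ℂ) ≠ 0 := fun r => by
      exact_mod_cast (Real.exp_pos _).ne'
    -- For fixed `s` both factors are polynomials in `r` times `e^{-r/2}`, so the vanishing product
    -- splits in the integral domain `ℂ[X]`.
    have hUV : U * V = 0 := by
      refine polynomial_eq_zero_of_pos fun r hr => ?_
      have := h1 s r hs hr
      rw [hU, hV] at this
      rw [Polynomial.eval_mul]
      simpa [hexp] using this
    -- At `r = s` the kernel is a sum of squares containing `ℓ₀(s)² > 0`; the index `0` exists
    -- because `k : Fin n` does.
    have hU0 : U ≠ 0 := by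
      intro h0
      have h5 := hU s
      rw [h0, Polynomial.eval_zero, zero_mul] at h5
      have h6 : ∑ i : Fin n, laguerreFun i s * laguerreFun i s = 0 := by exact_mod_cast h5
      have h7 := (Finset.sum_eq_zero_iff_of_nonneg fun i _ => mul_self_nonneg _).1 h6
        ⟨0, k.pos⟩ (Finset.mem_univ _)
      simp [laguerreFun, laguerrePoly] at h7
    have hV0 : V = 0 := (mul_eq_zero.1 hUV).resolve_left hU0
    exact congrFun (laguerreFun_linearIndependent
      (fun k => ∑ j : Fin n, α j k * laguerreFun j s) fun r _ => by rw [hV, hV0]; simp) k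
  have h5 : ∀ j k, α j k = 0 := fun j k =>
    congrFun (laguerreFun_linearIndependent (fun j => α j k) fun s hs => h4 s hs k) j
  ext1 P
  simp [hα, h5]

end Density

/-! ### The `C⋆`-algebra generated by the functions `γ^b`. -/

section SpectralAlgebra

variable {n : ℕ}

/-- Indicator functions of intervals bounded away from `0` and `∞` as symbols. -/
def indicatorIoc (s r : ℝ) (hs : 0 < s) : BSymbol where
  toFun := (Ioc s r).indicator 1
  memLp := memLp_top_of_bound
    ((measurable_const.indicator measurableSet_Ioc).aestronglyMeasurable) 1
    (Eventually.of_forall fun y => by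
      by_cases hy : y ∈ Ioc s r <;> simp [hy])
  lim_zero := ⟨0, tendsto_const_nhds.congr' (by
    filter_upwards [mem_nhdsWithin_of_mem_nhds (Iio_mem_nhds hs)] with y hy
    rw [indicator_of_notMem fun h => (lt_asymm h.1 hy).elim])⟩
  lim_top := ⟨0, tendsto_const_nhds.congr' (by
    filter_upwards [eventually_gt_atTop r] with y hy
    rw [indicator_of_notMem fun h => (not_lt.2 h.2 hy).elim])⟩

/-- The indicator function of `(0, 1]` as a symbol. -/
def indicatorIic : BSymbol where
  toFun := (Iic 1).indicator 1
  memLp := memLp_top_of_bound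
    ((measurable_const.indicator measurableSet_Iic).aestronglyMeasurable) 1
    (Eventually.of_forall fun y => by
      by_cases hy : y ∈ Iic (1 : ℝ) <;> simp [hy])
  lim_zero := ⟨1, tendsto_const_nhds.congr' (by
    filter_upwards [mem_nhdsWithin_of_mem_nhds (Iio_mem_nhds zero_lt_one)] with y hy
    rw [indicator_of_mem (mem_Iic.2 (le_of_lt (mem_Iio.1 hy))), Pi.one_apply])⟩
  lim_top := ⟨0, tendsto_const_nhds.congr' (by
    filter_upwards [eventually_gt_atTop 1] with y hy
    rw [indicator_of_notMem (notMem_Iic.2 hy)])⟩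

theorem isClosed_spectralAlgebra : IsClosed (spectralAlgebra n : Set (MatFun n)) :=
  StarSubalgebra.isClosed_topologicalClosure _

theorem mem_spectralAlgebra {b : BSymbol} {M : MatFun n} (hM : IsSpectralFun n b M) :
    M ∈ spectralAlgebra n :=
  mem_cstarGenerated ⟨b, hM⟩

theorem exists_mem_spectralAlgebra (b : BSymbol) {c₀ c₁ : ℂ}
    (h0 : Tendsto b.toFun (𝓝[>] 0) (𝓝 c₀)) (h1 : Tendsto b.toFun atTop (𝓝 c₁)) :
    ∃ M ∈ spectralAlgebra n, M 0 = c₁ • 1 ∧ M ⊤ = c₀ • 1 ∧ IsSpectralFun n b M := by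
  obtain ⟨M, hM0, hM1, hM⟩ := exists_spectralFun (n := n) b h0 h1
  exact ⟨M, mem_spectralAlgebra hM, hM0, hM1, hM⟩

theorem spectralMatrix_indicatorIoc {s r : ℝ} (hs : 0 < s) (hsr : s ≤ r) {x : ℝ} (hx : 0 < x)
    (f : Module.Dual ℂ (Matrix (Fin n) (Fin n) ℂ)) :
    f (spectralMatrix n (indicatorIoc s r hs) x) = ∫ v in s..r, f (densityMatrix n x v) := by
  obtain ⟨α, hα⟩ := exists_coeff f
  simp only [hα]
  rw [intervalIntegral.integral_of_le hsr]
  have hint : ∀ j k : Fin n, IntegrableOn (fun v => α j k * densityMatrix n x v j k) (Ioc s r) := by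
    intro j k
    refine Integrable.const_mul ?_ _
    have := (integrableOn_density j k hx).ofReal (𝕜 := ℂ)
    exact IntegrableOn.mono_set this fun v hv => hs.trans hv.1
  rw [integral_finsetSum _ fun j _ => integrable_finsetSum _ fun k _ => hint j k]
  refine Finset.sum_congr rfl fun j _ => ?_
  rw [integral_finsetSum _ fun k _ => hint j k]
  refine Finset.sum_congr rfl fun k _ => ?_
  rw [integral_const_mul, spectralMatrix_eq_density _ hx]
  congr 1
  have : ∀ v, (indicatorIoc s r hs).toFun v * (density j k x v : ℂ) =
      (Ioc s r).indicator (fun v => densityMatrix n x v j k) v := by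
    intro v
    by_cases hv : v ∈ Ioc s r <;> simp [indicatorIoc, densityMatrix, hv]
  simp only [this]
  have hsub : Ioi 0 ∩ Ioc s r = Ioc s r := inter_eq_right.2 fun v hv => hs.trans hv.1
  rw [setIntegral_indicator measurableSet_Ioc, hsub]

/-- Differentiate the integral in its upper limit. Interval indicators thus give access to the
density matrices themselves. -/
theorem eq_zero_of_intervalIntegral_eq_zero {φ : ℝ → ℂ} (hφ : Continuous φ)
    (h : ∀ s r, 0 < s → s ≤ r → ∫ v in s..r, φ v = 0) {v : ℝ} (hv : 0 < v) : φ v = 0 := by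
  have h1 : HasDerivAt (fun r => ∫ t in (v / 2)..r, φ t) (φ v) v :=
    intervalIntegral.integral_hasDerivAt_right (hφ.intervalIntegrable _ _)
      (hφ.stronglyMeasurableAtFilter _ _) hφ.continuousAt
  have h2 : HasDerivAt (fun r => ∫ t in (v / 2)..r, φ t) 0 v := by
    refine (hasDerivAt_const v (0 : ℂ)).congr_of_eventuallyEq ?_
    filter_upwards [Ioi_mem_nhds (show v / 2 < v by linarith)] with r hr
    exact h _ _ (by positivity) (le_of_lt hr)
  exact h1.unique h2

/-- Pairs of values at two interior points of the elements of the spectral algebra which vanish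
at both ends. -/
def valuePairs (n : ℕ) (x y : ℝ) :
    Submodule ℂ (Matrix (Fin n) (Fin n) ℂ × Matrix (Fin n) (Fin n) ℂ) where
  carrier := {q | ∃ a ∈ spectralAlgebra n, a 0 = 0 ∧ a ⊤ = 0 ∧
    a (ENNReal.ofReal x) = q.1 ∧ a (ENNReal.ofReal y) = q.2}
  zero_mem' := ⟨0, zero_mem _, rfl, rfl, rfl, rfl⟩
  add_mem' := by
    rintro q q' ⟨a, ha, h0, h1, hx, hy⟩ ⟨a', ha', h0', h1', hx', hy'⟩
    exact ⟨a + a', add_mem ha ha', by simp [h0, h0'], by simp [h1, h1'], by simp [hx, hx'],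
      by simp [hy, hy']⟩
  smul_mem' := by
    rintro c q ⟨a, ha, h0, h1, hx, hy⟩
    exact ⟨c • a, (spectralAlgebra n).smul_mem ha c, by simp [h0], by simp [h1], by simp [hx],
      by simp [hy]⟩

theorem valuePairs_mul {x y : ℝ} {q q' : Matrix (Fin n) (Fin n) ℂ × Matrix (Fin n) (Fin n) ℂ}
    (hq : q ∈ valuePairs n x y) (hq' : q' ∈ valuePairs n x y) : q * q' ∈ valuePairs n x y := by
  obtain ⟨a, ha, h0, h1, hx, hy⟩ := hq
  obtain ⟨a', ha', h0', h1', hx', hy'⟩ := hq'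
  exact ⟨a * a', mul_mem ha ha', by simp [h0], by simp [h1], by simp [hx, hx'], by simp [hy, hy']⟩

theorem mem_of_forall_dual {V : Type*} [AddCommGroup V] [Module ℂ V] (R : Submodule ℂ V) (z : V)
    (h : ∀ f : Module.Dual ℂ V, (∀ q ∈ R, f q = 0) → f z = 0) : z ∈ R := by
  by_contra hz
  obtain ⟨f, hf, hR⟩ := R.exists_le_ker_of_notMem hz
  exact hf (h f fun q hq => hR hq)

/-- A functional that kills all value pairs kills the integrals of the density pair over all
intervals `(s, r]`, because the indicators of these intervals have spectral functions vanishing at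
both ends. Hence it kills the integrand. -/
theorem density_mem_valuePairs {x y : ℝ} (hx : 0 < x) (hy : 0 < y) {v : ℝ} (hv : 0 < v) :
    (densityMatrix n x v, densityMatrix n y v) ∈ valuePairs n x y := by
  refine mem_of_forall_dual _ _ fun f hf => ?_
  let f₁ : Module.Dual ℂ (Matrix (Fin n) (Fin n) ℂ) := f ∘ₗ LinearMap.inl ℂ _ _
  let f₂ : Module.Dual ℂ (Matrix (Fin n) (Fin n) ℂ) := f ∘ₗ LinearMap.inr ℂ _ _
  have hsplit : ∀ P Q, f (P, Q) = f₁ P + f₂ Q := fun P Q => by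
    simp [f₁, f₂, ← map_add]
  rw [hsplit]
  refine eq_zero_of_intervalIntegral_eq_zero (φ := fun v => f₁ (densityMatrix n x v) +
    f₂ (densityMatrix n y v)) ((continuous_functional_density _ _).add
      (continuous_functional_density _ _)) (fun s r hs hsr => ?_) hv
  rw [intervalIntegral.integral_add
    ((continuous_functional_density _ _).intervalIntegrable _ _)
    ((continuous_functional_density _ _).intervalIntegrable _ _),
    ← spectralMatrix_indicatorIoc hs hsr hx, ← spectralMatrix_indicatorIoc hs hsr hy, ← hsplit]
  apply hf
  have h0 : Tendsto (indicatorIoc s r hs).toFun (𝓝[>] 0) (𝓝 0) := tendsto_const_nhds.congr' (by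
    filter_upwards [mem_nhdsWithin_of_mem_nhds (Iio_mem_nhds hs)] with y hy
    exact (indicator_of_notMem (fun h => (lt_asymm h.1 hy).elim) _).symm)
  have h1 : Tendsto (indicatorIoc s r hs).toFun atTop (𝓝 0) := tendsto_const_nhds.congr' (by
    filter_upwards [eventually_gt_atTop r] with y hy
    exact (indicator_of_notMem (fun h => (not_lt.2 h.2 hy).elim) _).symm)
  obtain ⟨M, hM, hM0, hM1, hMs⟩ := exists_mem_spectralAlgebra (n := n) _ h0 h1
  exact ⟨M, hM, by simpa using hM0, by simpa using hM1, hMs x hx, hMs y hy⟩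

/-- The two components are exponential polynomials in `v` with exponents `2x ≠ 2y`, so a functional
killing their pair kills each separately. -/
theorem density_zero_mem_valuePairs {x y : ℝ} (hx : 0 < x) (hy : 0 < y) (hxy : x ≠ y) {v : ℝ} :
    (densityMatrix n x v, 0) ∈ valuePairs n x y := by
  refine mem_of_forall_dual _ _ fun f hf => ?_
  refine functional_density_eq_zero (f := f ∘ₗ LinearMap.inl ℂ _ _)
    (g := f ∘ₗ LinearMap.inr ℂ _ _) hxy (fun v hv => ?_) v
  have := hf _ (density_mem_valuePairs (n := n) hx hy hv)
  simpa [← map_add] using this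

/-- The pairs `(D, 0)`, with `D` a density matrix at `x`, may be multiplied inside the algebra, and
products of two density matrices at `x` span all matrices. -/
theorem exists_interior_value {x y : ℝ} (hx : 0 < x) (hy : 0 < y) (hxy : x ≠ y)
    (E : Matrix (Fin n) (Fin n) ℂ) :
    ∃ a ∈ spectralAlgebra n, a 0 = 0 ∧ a ⊤ = 0 ∧ a (ENNReal.ofReal x) = E ∧
      a (ENNReal.ofReal y) = 0 := by
  suffices h : (E, 0) ∈ valuePairs n x y from h
  refine mem_of_forall_dual _ _ fun f hf => ?_
  have h1 : f ∘ₗ LinearMap.inl ℂ _ _ = 0 := by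
    refine functional_eq_zero_of_density_mul _ hx fun s r hs hr => ?_
    have := hf _ (valuePairs_mul (density_zero_mem_valuePairs (n := n) hx hy hxy (v := s))
      (density_zero_mem_valuePairs (n := n) hx hy hxy (v := r)))
    simpa using this
  exact LinearMap.congr_fun h1 E

theorem isClosed_scalarEnds : IsClosed (scalarEnds n : Set (MatFun n)) := by
  have hcl : IsClosed {P : Matrix (Fin n) (Fin n) ℂ | ∃ c : ℂ, P = c • 1} := by
    have := (Submodule.span ℂ {(1 : Matrix (Fin n) (Fin n) ℂ)}).closed_of_finiteDimensional
    convert this using 1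
    ext P
    simp [Submodule.mem_span_singleton, eq_comm]
  exact (hcl.preimage (ContinuousEvalConst.continuous_eval_const (0 : ℝ≥0∞))).inter
    (hcl.preimage (ContinuousEvalConst.continuous_eval_const (⊤ : ℝ≥0∞)))

theorem spectralAlgebra_le : spectralAlgebra n ≤ scalarEnds n := by
  refine StarSubalgebra.topologicalClosure_minimal (StarAlgebra.adjoin_le ?_) isClosed_scalarEnds
  rintro M ⟨b, hM⟩
  obtain ⟨N, hN, hNs⟩ := exists_mem_scalarEnds (n := n) b
  rw [isSpectralFun_unique b hM hNs]
  exact hN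

theorem spectralAlgebra_separates (x y : ℝ≥0∞) (hxy : x ≠ y) :
    ∃ a ∈ spectralAlgebra n, a x = 0 ∧ a y = 1 := by
  have hint : ∀ y : ℝ≥0∞, y ≠ 0 → y ≠ ⊤ → ∀ x, x ≠ y →
      ∃ a ∈ spectralAlgebra n, a x = 0 ∧ a y = 1 := by
    intro y hy0 hy1 x hxy
    have hy := ENNReal.toReal_pos hy0 hy1
    by_cases hx : x = 0 ∨ x = ⊤
    · obtain ⟨a, ha, h0, h1, h2, -⟩ := exists_interior_value (n := n) hy (y := y.toReal + 1)
        (by positivity) (by simp) 1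
      rw [ENNReal.ofReal_toReal hy1] at h2
      exact ⟨a, ha, by rcases hx with rfl | rfl <;> assumption, h2⟩
    · rw [not_or] at hx
      have hx' := ENNReal.toReal_pos hx.1 hx.2
      obtain ⟨a, ha, h0, h1, h2, h3⟩ := exists_interior_value (n := n) hy hx'
        (fun h => hxy ((ENNReal.toReal_eq_toReal_iff' hx.2 hy1).1 h.symm)) 1
      rw [ENNReal.ofReal_toReal hy1] at h2
      rw [ENNReal.ofReal_toReal hx.2] at h3
      exact ⟨a, ha, h3, h2⟩
  have hflip : ∀ x y : ℝ≥0∞, (∃ a ∈ spectralAlgebra n, a x = 0 ∧ a y = 1) →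
      ∃ a ∈ spectralAlgebra n, a y = 0 ∧ a x = 1 := by
    rintro x y ⟨a, ha, h0, h1⟩
    exact ⟨1 - a, sub_mem (one_mem _) ha, by simp [h1], by simp [h0]⟩
  -- The symbol `1` on `(0, 1]` and `0` beyond has `γ = 0` at `0` and `γ = I` at `∞`.
  have hends : ∃ a ∈ spectralAlgebra n, a 0 = 0 ∧ a ⊤ = 1 := by
    have h0 : Tendsto indicatorIic.toFun (𝓝[>] 0) (𝓝 1) := tendsto_const_nhds.congr' (by
      filter_upwards [mem_nhdsWithin_of_mem_nhds (Iio_mem_nhds zero_lt_one)] with y hy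
      exact (indicator_of_mem (mem_Iic.2 (le_of_lt (mem_Iio.1 hy))) (1 : ℝ → ℂ)).symm)
    have h1 : Tendsto indicatorIic.toFun atTop (𝓝 0) := tendsto_const_nhds.congr' (by
      filter_upwards [eventually_gt_atTop 1] with y hy
      exact (indicator_of_notMem (notMem_Iic.2 hy) _).symm)
    obtain ⟨M, hM, hM0, hM1, -⟩ := exists_mem_spectralAlgebra (n := n) _ h0 h1
    exact ⟨M, hM, by simpa using hM0, by simpa using hM1⟩
  by_cases hy : y = 0 ∨ y = ⊤
  · by_cases hx : x = 0 ∨ x = ⊤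
    · rcases hx with rfl | rfl <;> rcases hy with rfl | rfl
      · exact absurd rfl hxy
      · exact hends
      · exact hflip _ _ hends
      · exact absurd rfl hxy
    · rw [not_or] at hx
      exact hflip _ _ (hint x hx.1 hx.2 y hxy.symm)
  · rw [not_or] at hy
    exact hint y hy.1 hy.2 x hxy

/-- At each interior point the algebra takes every matrix value, and at the ends every scalar one.
By Stone–Weierstrass nothing but these pointwise constraints remains. -/
theorem spectralAlgebra_eq : spectralAlgebra n = scalarEnds n := by
  refine le_antisymm spectralAlgebra_le fun M hM => ?_
  refine mem_of_pointwise_mem isClosed_spectralAlgebra spectralAlgebra_separates M fun x => ?_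
  obtain ⟨⟨c, hc⟩, c', hc'⟩ := hM
  rcases eq_or_ne x 0 with rfl | hx0
  · exact ⟨c • 1, (spectralAlgebra n).smul_mem (one_mem _) c, by rw [hc]; rfl⟩
  rcases eq_or_ne x ⊤ with rfl | hx1
  · exact ⟨c' • 1, (spectralAlgebra n).smul_mem (one_mem _) c', by rw [hc']; rfl⟩
  obtain ⟨a, ha, -, -, h2, -⟩ := exists_interior_value (n := n) (ENNReal.toReal_pos hx0 hx1)
    (y := x.toReal + 1) (by positivity) (by simp) (M x)
  rw [ENNReal.ofReal_toReal hx1] at h2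
  exact ⟨a, ha, h2⟩

end SpectralAlgebra

/-! ### Matrix functions as multiplication operators on `L²(ℝ₊; ℂⁿ)`. -/

section Representation

variable {n : ℕ}

/-- The Hilbert space `L²(ℝ₊; ℂⁿ)`. -/
abbrev L2Freq (n : ℕ) : Type := Lp (EuclideanSpace ℂ (Fin n)) 2 (volume.restrict (Ioi (0 : ℝ)))

/-- The operator-valued function `t ↦ M(2πt)`. -/
def freqSymbol (M : MatFun n) (t : ℝ) : EuclideanSpace ℂ (Fin n) →L[ℂ] EuclideanSpace ℂ (Fin n) :=
  Matrix.toEuclideanCLM (𝕜 := ℂ) (M (ENNReal.ofReal (2 * Real.pi * t)))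

theorem continuous_freqSymbol (M : MatFun n) : Continuous (freqSymbol M) := by
  have h : Continuous (Matrix.toEuclideanCLM (n := Fin n) (𝕜 := ℂ)) :=
    LinearMap.continuous_of_finiteDimensional
      (Matrix.toEuclideanCLM (n := Fin n) (𝕜 := ℂ)).toAlgEquiv.toLinearMap
  exact h.comp (M.continuous.comp (ENNReal.continuous_ofReal.comp (by fun_prop)))

theorem norm_freqSymbol_le (M : MatFun n) (t : ℝ) : ‖freqSymbol M t‖ ≤ ‖M‖ := by
  have h := M.norm_coe_le_norm (ENNReal.ofReal (2 * Real.pi * t))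
  rwa [Matrix.l2_opNorm_def] at h

theorem memLp_freqSymbol (M : MatFun n) :
    MemLp (freqSymbol M) ⊤ (volume.restrict (Ioi (0 : ℝ))) :=
  memLp_top_of_bound (continuous_freqSymbol M).aestronglyMeasurable ‖M‖
    (Eventually.of_forall (norm_freqSymbol_le M))

/-- Pointwise multiplication by `t ↦ M(2πt)` on `L²(ℝ₊; ℂⁿ)`. -/
def freqMul (M : MatFun n) : L2Freq n →L[ℂ] L2Freq n :=
  (ContinuousLinearMap.id ℂ (EuclideanSpace ℂ (Fin n) →L[ℂ] EuclideanSpace ℂ (Fin n))).holderL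
    (volume.restrict (Ioi (0 : ℝ))) ⊤ 2 2 (memLp_freqSymbol M).toLp

theorem coeFn_freqMul (M : MatFun n) (ψ : L2Freq n) :
    freqMul M ψ =ᵐ[volume.restrict (Ioi 0)] fun t => freqSymbol M t (ψ t) := by
  refine (ContinuousLinearMap.coeFn_holder _ _ _).trans ?_
  filter_upwards [(memLp_freqSymbol M).coeFn_toLp] with t ht
  rw [ht]
  rfl

/-- The representation of matrix functions by multiplication operators. -/
def freqRep (n : ℕ) : MatFun n →⋆ₐ[ℂ] (L2Freq n →L[ℂ] L2Freq n) where
  toFun := freqMul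
  map_one' := by
    ext1 ψ
    apply Lp.ext
    filter_upwards [coeFn_freqMul 1 ψ] with t ht
    rw [ht]
    simp [freqSymbol]
  map_mul' M N := by
    ext1 ψ
    apply Lp.ext
    filter_upwards [coeFn_freqMul (M * N) ψ, coeFn_freqMul M (freqMul N ψ), coeFn_freqMul N ψ]
      with t h1 h2 h3
    rw [h1, mul_apply_eq_comp, h2, h3]
    simp [freqSymbol]
  map_zero' := by
    ext1 ψ
    apply Lp.ext
    filter_upwards [coeFn_freqMul 0 ψ, Lp.coeFn_zero (EuclideanSpace ℂ (Fin n)) 2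
      (volume.restrict (Ioi (0 : ℝ)))] with t ht h0
    rw [ht, zero_apply, h0]
    simp [freqSymbol]
  map_add' M N := by
    ext1 ψ
    apply Lp.ext
    filter_upwards [coeFn_freqMul (M + N) ψ, coeFn_freqMul M ψ, coeFn_freqMul N ψ,
      Lp.coeFn_add (freqMul M ψ) (freqMul N ψ)] with t h1 h2 h3 h4
    rw [h1, add_apply, h4, Pi.add_apply, h2, h3]
    simp [freqSymbol]
  commutes' c := by
    ext1 ψ
    apply Lp.ext
    filter_upwards [coeFn_freqMul (algebraMap ℂ _ c) ψ, Lp.coeFn_smul c ψ] with t h1 h2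
    rw [h1, Algebra.algebraMap_eq_smul_one, Algebra.algebraMap_eq_smul_one, smul_apply,
      one_apply_eq_self, h2, Pi.smul_apply]
    simp [freqSymbol]
  map_star' M := by
    rw [ContinuousLinearMap.star_eq_adjoint, ContinuousLinearMap.eq_adjoint_iff]
    intro ψ φ
    rw [L2.inner_def, L2.inner_def]
    refine integral_congr_ae ?_
    filter_upwards [coeFn_freqMul (star M) ψ, coeFn_freqMul M φ] with t h1 h2
    rw [h1, h2]
    have : freqSymbol (star M) t = star (freqSymbol M t) := by
      simp only [freqSymbol, ContinuousMap.star_apply, map_star]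
    rw [this, ContinuousLinearMap.star_eq_adjoint, ContinuousLinearMap.adjoint_inner_left]

theorem freqRep_apply (M : MatFun n) : freqRep n M = freqMul M := rfl

theorem freqRep_injective : Function.Injective (freqRep n) := by
  rw [injective_iff_map_eq_zero]
  intro M hM
  have h1 : ∀ t : ℝ, 0 < t → freqSymbol M t = 0 := by
    intro t ht
    ext1 e
    -- A constant vector is not square-integrable on the half line; cutting it off beyond `t` does
    -- not affect the symbol at `t`.
    have hmem : MemLp ((Iio (t + 1)).indicator fun _ => e) 2 (volume.restrict (Ioi (0 : ℝ))) := by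
      refine memLp_indicator_const 2 measurableSet_Iio e (Or.inr ?_)
      rw [Measure.restrict_apply measurableSet_Iio, inter_comm, Ioi_inter_Iio]
      simp
    have h2 : freqMul M hmem.toLp = 0 := by
      rw [← freqRep_apply, hM, zero_apply]
    have h3 : ∀ᵐ s ∂volume.restrict (Ioo 0 (t + 1)), freqSymbol M s e = 0 := by
      have hle : volume.restrict (Ioo 0 (t + 1)) ≤ volume.restrict (Ioi (0 : ℝ)) :=
        Measure.restrict_mono (fun s hs => hs.1) le_rfl
      have h4 := coeFn_freqMul M hmem.toLp
      rw [h2] at h4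
      filter_upwards [ae_mono hle h4, ae_mono hle hmem.coeFn_toLp, ae_mono hle
        (Lp.coeFn_zero (EuclideanSpace ℂ (Fin n)) 2 (volume.restrict (Ioi (0 : ℝ)))),
        ae_restrict_mem measurableSet_Ioo] with s h5 h6 h7 h8
      rw [h7, h6, indicator_of_mem (mem_Iio.2 h8.2)] at h5
      exact h5.symm
    exact Measure.eqOn_open_of_ae_eq (μ := volume) (g := fun _ => 0) h3 isOpen_Ioo
      ((continuous_freqSymbol M).clm_apply continuous_const).continuousOn continuousOn_const
      ⟨ht, by linarith⟩
  refine DFunLike.coe_injective (Continuous.ext_on (s := {0, ⊤}ᶜ) ?_ M.continuous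
    (0 : MatFun n).continuous ?_)
  · simpa [compl_eq_univ_sdiff] using dense_univ.sdiff_finite (Set.toFinite ({0, ⊤} : Set ℝ≥0∞))
  · intro t ht
    simp only [mem_compl_iff, mem_insert_iff, mem_singleton_iff, not_or] at ht
    have hpos := ENNReal.toReal_pos ht.1 ht.2
    have h2 := h1 (t.toReal / (2 * Real.pi)) (by positivity)
    rw [freqSymbol, mul_div_cancel₀ _ (by positivity), ENNReal.ofReal_toReal ht.2] at h2
    exact (map_eq_zero_iff _ (Matrix.toEuclideanCLM (n := Fin n) (𝕜 := ℂ)).injective).1 h2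

end Representation

/-! ### The `L²` Fourier transform compared with the Fourier integral. -/

section FourierPlancherel

open FourierTransform SchwartzMap

theorem integral_fourierInv_mul_eq {f g : ℝ → ℂ} (hf : Integrable f) (hg : Integrable g) :
    ∫ x, 𝓕⁻ f x * g x = ∫ x, f x * 𝓕⁻ g x := by
  have h := VectorFourier.integral_fourierIntegral_smul_eq_flip (𝕜 := ℝ) (e := Real.fourierChar)
    (μ := (volume : Measure ℝ)) (ν := (volume : Measure ℝ)) (L := -innerₗ ℝ) (f := f) (g := g)
    Real.continuous_fourierChar (by fun_prop) hf hg
  have hflip : (-innerₗ ℝ : ℝ →ₗ[ℝ] ℝ →ₗ[ℝ] ℝ).flip = -innerₗ ℝ := by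
    ext
    simp
  rw [hflip] at h
  exact h

theorem continuous_fourierInv {f : ℝ → ℂ} (hf : Integrable f) : Continuous (𝓕⁻ f) :=
  VectorFourier.fourierIntegral_continuous (L := -innerₗ ℝ) Real.continuous_fourierChar
    (by fun_prop) hf

/-- The inverse Fourier transform of an integrable square-integrable function agrees with its
inverse Fourier transform in `L²`. -/
theorem coeFn_fourierInv_toLp {f : ℝ → ℂ} (h1 : Integrable f) (h2 : MemLp f 2) :
    (𝓕⁻ h2.toLp : Lp ℂ 2 (volume : Measure ℝ)) =ᵐ[volume] 𝓕⁻ f := by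
  have hcont : Continuous (𝓕⁻ f) := continuous_fourierInv h1
  -- Both sides are tested against smooth compactly supported functions: the `L²` transform is moved
  -- onto the test function as a tempered distribution, the integral one by Fubini.
  refine ae_eq_of_integral_contDiff_smul_eq
    ((Lp.memLp _).locallyIntegrable one_le_two) hcont.locallyIntegrable fun g hg hgc => ?_
  have hgc' : HasCompactSupport fun x => (g x : ℂ) := hgc.comp_left Complex.ofReal_zero
  have hg' : ContDiff ℝ ∞ fun x => (g x : ℂ) := Complex.ofRealCLM.contDiff.comp hg
  let G : 𝓢(ℝ, ℂ) := hgc'.toSchwartzMap hg'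
  have hG : ∀ x, G x = g x := fun x => rfl
  have h3 := congrArg (fun T => T G) (Lp.fourierInv_toTemperedDistribution_eq h2.toLp)
  simp only [TemperedDistribution.fourierInv_apply, Lp.toTemperedDistribution_apply,
    smul_eq_mul] at h3
  have h4 : ∫ x, g x • (𝓕⁻ h2.toLp : Lp ℂ 2 (volume : Measure ℝ)) x =
      ∫ x, G x * (𝓕⁻ h2.toLp : Lp ℂ 2 (volume : Measure ℝ)) x := by
    simp only [hG, Complex.real_smul]
  rw [h4, ← h3]
  have h5 : ∫ x, (𝓕⁻ G) x * (h2.toLp : Lp ℂ 2 (volume : Measure ℝ)) x = ∫ x, 𝓕⁻ (G : ℝ → ℂ) x * f x := by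
    refine integral_congr_ae ?_
    filter_upwards [h2.coeFn_toLp] with x hx
    rw [hx, fourierInv_coe]
  rw [h5, integral_fourierInv_mul_eq G.integrable h1]
  simp only [hG, Complex.real_smul]

theorem eLpNorm_fourierInv {f : ℝ → ℂ} (h1 : Integrable f) (h2 : MemLp f 2) :
    eLpNorm (𝓕⁻ f) 2 = eLpNorm f 2 := by
  rw [← eLpNorm_congr_ae (coeFn_fourierInv_toLp h1 h2), ← eLpNorm_congr_ae h2.coeFn_toLp]
  have h := (Lp.fourierTransformₗᵢ ℝ ℂ).symm.norm_map h2.toLp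
  rw [Lp.norm_def, Lp.norm_def] at h
  exact (ENNReal.toReal_eq_toReal_iff' (Lp.eLpNorm_ne_top _) (Lp.eLpNorm_ne_top _)).1 h

/-- Plancherel's theorem for a pair of functions, one of which is integrable. -/
theorem integral_fourierInv_mul_conj {f g : ℝ → ℂ} (hf1 : Integrable f) (hf2 : MemLp f 2)
    (hg1 : Integrable g) (hg2 : MemLp g 2) :
    ∫ x, 𝓕⁻ f x * (starRingEnd ℂ) (𝓕⁻ g x) = ∫ x, f x * (starRingEnd ℂ) (g x) := by
  have h := (Lp.fourierTransformₗᵢ ℝ ℂ).symm.inner_map_map hg2.toLp hf2.toLp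
  rw [L2.inner_def, L2.inner_def] at h
  have e1 : (Lp.fourierTransformₗᵢ ℝ ℂ).symm hg2.toLp = 𝓕⁻ hg2.toLp := rfl
  have e2 : (Lp.fourierTransformₗᵢ ℝ ℂ).symm hf2.toLp = 𝓕⁻ hf2.toLp := rfl
  rw [e1, e2] at h
  refine (integral_congr_ae ?_).trans (h.trans (integral_congr_ae ?_))
  · filter_upwards [coeFn_fourierInv_toLp hf1 hf2, coeFn_fourierInv_toLp hg1 hg2] with x hx hx'
    rw [hx, hx', RCLike.inner_apply]
  filter_upwards [hf2.coeFn_toLp, hg2.coeFn_toLp] with x hx hx'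
  rw [hx, hx', RCLike.inner_apply]

end FourierPlancherel

/-! ### Poly-analytic functions as polynomials in the height. -/

section Holomorphic

/-- Smooth functions on the Siegel domain satisfying the Cauchy–Riemann equations. -/
structure IsHolo (g : ℂ × ℂ → ℂ) : Prop where
  smooth : ContDiffOn ℝ ∞ g siegel
  dbar₁_eq : ∀ ζ ∈ siegel, dbar₁ g ζ = 0
  dbar₂_eq : ∀ ζ ∈ siegel, dbar₂ g ζ = 0

theorem dbar_eq_zero_of_hasFDerivAt {g : ℂ × ℂ → ℂ} {L : ℂ × ℂ →L[ℂ] ℂ} {ζ : ℂ × ℂ}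
    (h : HasFDerivAt g L ζ) : dbar₁ g ζ = 0 ∧ dbar₂ g ζ = 0 := by
  have h1 : fderiv ℝ g ζ = L.restrictScalars ℝ := (h.restrictScalars ℝ).fderiv
  have h2 : L (Complex.I, 0) = Complex.I * L (1, 0) := by
    rw [← smul_eq_mul, ← map_smul]; simp
  have h3 : L (0, Complex.I) = Complex.I * L (0, 1) := by
    rw [← smul_eq_mul, ← map_smul]; simp
  simp only [dbar₁, dbar₂, h1, ContinuousLinearMap.coe_restrictScalars', h2, h3, ← mul_assoc,
    Complex.I_mul_I]
  constructor <;> ring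

theorem isHolo_of_contDiffOn {g : ℂ × ℂ → ℂ} (h : ContDiffOn ℂ ∞ g siegel) : IsHolo g := by
  have h1 : ∀ ζ ∈ siegel, HasFDerivAt g (fderiv ℂ g ζ) ζ := fun ζ hζ =>
    ((h.contDiffAt (isOpen_siegel.mem_nhds hζ)).differentiableAt (by simp)).hasFDerivAt
  exact ⟨h.restrict_scalars ℝ, fun ζ hζ => (dbar_eq_zero_of_hasFDerivAt (h1 ζ hζ)).1,
    fun ζ hζ => (dbar_eq_zero_of_hasFDerivAt (h1 ζ hζ)).2⟩

theorem IsHolo.hasFDerivAt {g : ℂ × ℂ → ℂ} (hg : IsHolo g) {ζ : ℂ × ℂ} (hζ : ζ ∈ siegel) :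
    HasFDerivAt g (fderiv ℝ g ζ (1, 0) • ContinuousLinearMap.fst ℂ ℂ ℂ +
      fderiv ℝ g ζ (0, 1) • ContinuousLinearMap.snd ℂ ℂ ℂ) ζ := by
  refine hasFDerivAt_of_restrictScalars ℝ (differentiableAt_of_smooth hg.smooth hζ).hasFDerivAt ?_
  have h1 := hg.dbar₁_eq ζ hζ
  have h2 := hg.dbar₂_eq ζ hζ
  rw [dbar₁] at h1
  rw [dbar₂] at h2
  have e1 : fderiv ℝ g ζ (Complex.I, 0) = Complex.I * fderiv ℝ g ζ (1, 0) := by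
    linear_combination (-2 * Complex.I) * h1 + (fderiv ℝ g ζ (Complex.I, 0)) * Complex.I_mul_I
  have e2 : fderiv ℝ g ζ (0, Complex.I) = Complex.I * fderiv ℝ g ζ (0, 1) := by
    linear_combination (-2 * Complex.I) * h2 + (fderiv ℝ g ζ (0, Complex.I)) * Complex.I_mul_I
  refine ContinuousLinearMap.ext fun x => ?_
  have hx : x = x.1.re • ((1, 0) : ℂ × ℂ) + x.1.im • ((Complex.I, 0) : ℂ × ℂ) +
      x.2.re • ((0, 1) : ℂ × ℂ) + x.2.im • ((0, Complex.I) : ℂ × ℂ) := by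
    ext <;> simp
  conv_rhs => rw [hx]
  simp only [map_add, map_smul, e1, e2, ContinuousLinearMap.coe_restrictScalars', add_apply,
    smul_apply, ContinuousLinearMap.coe_fst', ContinuousLinearMap.coe_snd', smul_eq_mul,
    Complex.real_smul]
  conv_lhs => rw [← Complex.re_add_im x.1, ← Complex.re_add_im x.2]
  ring

theorem IsHolo.smul {g : ℂ × ℂ → ℂ} (c : ℂ) (hg : IsHolo g) : IsHolo (c • g) where
  smooth := hg.smooth.const_smul c
  dbar₁_eq ζ hζ := by
    rw [isLinOp_dbar₁.smul c g hg.smooth hζ, Pi.smul_apply, hg.dbar₁_eq ζ hζ, smul_zero]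
  dbar₂_eq ζ hζ := by
    rw [isLinOp_dbar₂.smul c g hg.smooth hζ, Pi.smul_apply, hg.dbar₂_eq ζ hζ, smul_zero]

theorem dbar₁_mul {f g : ℂ × ℂ → ℂ} {ζ : ℂ × ℂ} (hf : DifferentiableAt ℝ f ζ)
    (hg : DifferentiableAt ℝ g ζ) : dbar₁ (f * g) ζ = f ζ * dbar₁ g ζ + dbar₁ f ζ * g ζ := by
  simp only [dbar₁, fderiv_mul hf hg, add_apply, smul_apply, smul_eq_mul]
  ring

theorem dbar₂_mul {f g : ℂ × ℂ → ℂ} {ζ : ℂ × ℂ} (hf : DifferentiableAt ℝ f ζ)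
    (hg : DifferentiableAt ℝ g ζ) : dbar₂ (f * g) ζ = f ζ * dbar₂ g ζ + dbar₂ f ζ * g ζ := by
  simp only [dbar₂, fderiv_mul hf hg, add_apply, smul_apply, smul_eq_mul]
  ring

theorem dbarTan_mul {f g : ℂ × ℂ → ℂ} {ζ : ℂ × ℂ} (hf : DifferentiableAt ℝ f ζ)
    (hg : DifferentiableAt ℝ g ζ) : dbarTan (f * g) ζ = f ζ * dbarTan g ζ + dbarTan f ζ * g ζ := by
  simp only [dbarTan, dbar₁_mul hf hg, dbar₂_mul hf hg]
  ring

/-- The height as a complex-valued function. -/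
def heightC (ζ : ℂ × ℂ) : ℂ := (height ζ : ℂ)

theorem contDiff_heightC : ContDiff ℝ ∞ heightC := by
  have h : ContDiff ℝ ∞ height := by
    have h1 : ContDiff ℝ ∞ fun ζ : ℂ × ℂ => ζ.2.im := Complex.imCLM.contDiff.comp contDiff_snd
    exact h1.sub (contDiff_fst.norm_sq ℝ)
  exact Complex.ofRealCLM.contDiff.comp h

theorem fderiv_heightC (ζ w : ℂ × ℂ) : fderiv ℝ heightC ζ w =
    ((w.2.im - 2 * (ζ.1.re * w.1.re + ζ.1.im * w.1.im) : ℝ) : ℂ) := by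
  have h1 : HasFDerivAt (fun ζ : ℂ × ℂ => ζ.2.im)
      (Complex.imCLM.comp (ContinuousLinearMap.snd ℝ ℂ ℂ)) ζ :=
    (Complex.imCLM.comp (ContinuousLinearMap.snd ℝ ℂ ℂ)).hasFDerivAt
  have h2 : HasFDerivAt (fun ζ : ℂ × ℂ => ‖ζ.1‖ ^ 2) _ ζ :=
    (ContinuousLinearMap.fst ℝ ℂ ℂ).hasFDerivAt.norm_sq
  have h3 : HasFDerivAt heightC _ ζ := Complex.ofRealCLM.hasFDerivAt.comp ζ (h1.sub h2)
  rw [h3.fderiv]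
  simp [Complex.inner]
  ring

theorem dbar₂_heightC (ζ : ℂ × ℂ) : dbar₂ heightC ζ = Complex.I / 2 := by
  simp [dbar₂, fderiv_heightC]
  ring

/-- The derivative `∂̄₁` of the height is `-ζ₁`, and the correction `2iζ₁ · (i/2)` is also `-ζ₁`. -/
theorem dbarTan_heightC (ζ : ℂ × ℂ) : dbarTan heightC ζ = 0 := by
  rw [dbarTan, dbar₂_heightC]
  simp only [dbar₁, fderiv_heightC]
  push_cast
  simp
  conv_rhs => rw [← mul_zero (1 : ℂ)]
  have h := Complex.re_add_im ζ.1
  linear_combination (-1 + 0 * Complex.I) * h - ζ.1 * Complex.I_mul_I 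

theorem IsHolo.dbarTan_eq {g : ℂ × ℂ → ℂ} (hg : IsHolo g) {ζ : ℂ × ℂ} (hζ : ζ ∈ siegel) :
    dbarTan g ζ = 0 := by
  rw [dbarTan, hg.dbar₁_eq ζ hζ, hg.dbar₂_eq ζ hζ]
  ring

theorem dbarTan_heightC_pow_mul {g : ℂ × ℂ → ℂ} (hg : IsHolo g) (k : ℕ) {ζ : ℂ × ℂ}
    (hζ : ζ ∈ siegel) : dbarTan (heightC ^ k * g) ζ = 0 := by
  have hd := (contDiff_heightC.differentiable (by simp)) ζ
  induction k with
  | zero => rw [pow_zero, one_mul, hg.dbarTan_eq hζ]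
  | succ k ih =>
    have hgd := differentiableAt_of_smooth hg.smooth hζ
    rw [pow_succ', mul_assoc, dbarTan_mul hd ((hd.pow k).mul hgd), ih, dbarTan_heightC]
    ring

theorem dbar₂_heightC_pow_mul {g : ℂ × ℂ → ℂ} (hg : IsHolo g) (k : ℕ) {ζ : ℂ × ℂ}
    (hζ : ζ ∈ siegel) : dbar₂ (heightC ^ (k + 1) * g) ζ =
      ((k + 1) * (Complex.I / 2)) * (heightC ^ k * g) ζ := by
  have hd := (contDiff_heightC.differentiable (by simp)) ζ
  have hgd := differentiableAt_of_smooth hg.smooth hζ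
  induction k with
  | zero =>
    rw [zero_add, pow_one, dbar₂_mul hd hgd, hg.dbar₂_eq ζ hζ, dbar₂_heightC]
    simp
  | succ k ih =>
    rw [pow_succ', mul_assoc, dbar₂_mul hd ((hd.pow (k + 1)).mul hgd), ih, dbar₂_heightC]
    simp only [Pi.mul_apply, Pi.pow_apply]
    push_cast
    ring

theorem contDiffOn_heightC_pow_mul {g : ℂ × ℂ → ℂ} (hg : IsHolo g) (k : ℕ) :
    ContDiffOn ℝ ∞ (heightC ^ k * g) siegel :=
  (contDiff_heightC.pow k).contDiffOn.mul hg.smooth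

/-- Each `∂̄₂` lowers the power of the height by one and only rescales the holomorphic factor. -/
theorem dbar₂_iterate_heightC_pow_mul {k m : ℕ} (hkm : k < m) {g : ℂ × ℂ → ℂ} (hg : IsHolo g)
    {ζ : ℂ × ℂ} (hζ : ζ ∈ siegel) : (dbar₂^[m] (heightC ^ k * g)) ζ = 0 := by
  have h0 : ∀ m ζ, ζ ∈ siegel → (dbar₂^[m] (0 : ℂ × ℂ → ℂ)) ζ = 0 := fun m ζ hζ =>
    (isPolyAnalytic_zero 0 m).2.2 ζ hζ
  induction k generalizing m g with
  | zero =>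
    obtain ⟨m, rfl⟩ : ∃ m', m = m' + 1 := ⟨m - 1, by omega⟩
    rw [pow_zero, one_mul, Function.iterate_succ_apply,
      (isLinOp_dbar₂.iterate m).congr _ 0 (fun ζ hζ => hg.dbar₂_eq ζ hζ) hζ]
    exact h0 m ζ hζ
  | succ k ih =>
    obtain ⟨m, rfl⟩ : ∃ m', m = m' + 1 := ⟨m - 1, by omega⟩
    rw [Function.iterate_succ_apply, (isLinOp_dbar₂.iterate m).congr _
      (heightC ^ k * (((k + 1) * (Complex.I / 2) : ℂ) • g)) (fun ζ hζ => ?_) hζ]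
    · exact ih (by omega) (hg.smul _)
    · rw [dbar₂_heightC_pow_mul hg k hζ]
      simp only [Pi.mul_apply, Pi.smul_apply, smul_eq_mul]
      ring

theorem isPolyAnalytic_heightC_pow_mul {k n : ℕ} (hkn : k < n) {g : ℂ × ℂ → ℂ} (hg : IsHolo g) :
    IsPolyAnalytic 1 n (heightC ^ k * g) :=
  ⟨contDiffOn_heightC_pow_mul hg k, fun _ hζ => dbarTan_heightC_pow_mul hg k hζ,
    fun _ hζ => dbar₂_iterate_heightC_pow_mul hkn hg hζ⟩

theorem isPolyAnalytic_sum {n : ℕ} {g : Fin n → ℂ × ℂ → ℂ} (hg : ∀ k, IsHolo (g k)) :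
    IsPolyAnalytic 1 n (∑ k : Fin n, heightC ^ (k : ℕ) * g k) := by
  have : ∀ s : Finset (Fin n), IsPolyAnalytic 1 n (∑ k ∈ s, heightC ^ (k : ℕ) * g k) := by
    intro s
    induction s using Finset.cons_induction with
    | empty => simpa using isPolyAnalytic_zero 1 n
    | cons a s ha ih =>
      rw [Finset.sum_cons]
      exact (isPolyAnalytic_heightC_pow_mul a.2 (hg a)).add ih
  exact this _

theorem dbar₂_sub {f g : ℂ × ℂ → ℂ} {ζ : ℂ × ℂ} (hf : DifferentiableAt ℝ f ζ)
    (hg : DifferentiableAt ℝ g ζ) : dbar₂ (f - g) ζ = dbar₂ f ζ - dbar₂ g ζ := by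
  simp only [dbar₂, fderiv_sub hf hg, sub_apply]
  ring

theorem dbarTan_sub {f g : ℂ × ℂ → ℂ} {ζ : ℂ × ℂ} (hf : DifferentiableAt ℝ f ζ)
    (hg : DifferentiableAt ℝ g ζ) : dbarTan (f - g) ζ = dbarTan f ζ - dbarTan g ζ := by
  rw [dbarTan, dbar₂_sub hf hg, dbarTan, dbarTan]
  simp only [dbar₁, fderiv_sub hf hg, sub_apply]
  ring

theorem fderiv_fderiv_apply {f : ℂ × ℂ → ℂ} (hf : ContDiffOn ℝ ∞ f siegel) {ζ : ℂ × ℂ}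
    (hζ : ζ ∈ siegel) (v w : ℂ × ℂ) :
    fderiv ℝ (fun η => fderiv ℝ f η v) ζ w = fderiv ℝ (fun η => fderiv ℝ f η w) ζ v := by
  have h1 : DifferentiableAt ℝ (fderiv ℝ f) ζ :=
    ((hf.fderiv_of_isOpen isOpen_siegel (m := ∞) (by simp)).contDiffAt
      (isOpen_siegel.mem_nhds hζ)).differentiableAt (by simp)
  rw [fderiv_clm_apply h1 (differentiableAt_const v), fderiv_clm_apply h1 (differentiableAt_const w)]
  have := (hf.contDiffAt (isOpen_siegel.mem_nhds hζ)).isSymmSndFDerivAt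
    (by rw [minSmoothness_of_isRCLikeNormedField]; exact WithTop.coe_le_coe.2 (le_top : (2 : ℕ∞) ≤ ⊤)) v w
  simpa using this.symm

/-- Second derivatives are symmetric, and the only variable coefficient, `2iζ₁`, is killed by `∂̄₂`.
-/
theorem dbarTan_dbar₂_comm {f : ℂ × ℂ → ℂ} (hf : ContDiffOn ℝ ∞ f siegel) {ζ : ℂ × ℂ}
    (hζ : ζ ∈ siegel) : dbarTan (dbar₂ f) ζ = dbar₂ (dbarTan f) ζ := by
  have hd : ∀ v, DifferentiableAt ℝ (fun η => fderiv ℝ f η v) ζ := fun v =>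
    differentiableAt_of_smooth (smooth_fderiv_apply hf v) hζ
  have e : ∀ v w, fderiv ℝ (fun η => (1 / 2 : ℂ) * (fderiv ℝ f η v + Complex.I * fderiv ℝ f η w)) ζ
      = (1 / 2 : ℂ) • (fderiv ℝ (fun η => fderiv ℝ f η v) ζ +
        Complex.I • fderiv ℝ (fun η => fderiv ℝ f η w) ζ) := by
    intro v w
    exact (((hd v).hasFDerivAt.add ((hd w).hasFDerivAt.const_mul _)).const_mul _).fderiv
  have h1 : dbar₁ (dbar₂ f) ζ = dbar₂ (dbar₁ f) ζ := by
    have e1 : dbar₁ f = fun η => (1 / 2 : ℂ) * (fderiv ℝ f η (1, 0) +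
      Complex.I * fderiv ℝ f η (Complex.I, 0)) := rfl
    have e2 : dbar₂ f = fun η => (1 / 2 : ℂ) * (fderiv ℝ f η (0, 1) +
      Complex.I * fderiv ℝ f η (0, Complex.I)) := rfl
    rw [dbar₁, dbar₂, e1, e2, e, e]
    simp only [smul_apply, add_apply, smul_eq_mul,
      fderiv_fderiv_apply hf hζ (0, 1) (1, 0), fderiv_fderiv_apply hf hζ (0, 1) (Complex.I, 0),
      fderiv_fderiv_apply hf hζ (0, Complex.I) (1, 0),
      fderiv_fderiv_apply hf hζ (0, Complex.I) (Complex.I, 0)]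
    ring
  have hs1 := differentiableAt_of_smooth (isLinOp_dbar₁.smooth f hf) hζ
  have hs2 := differentiableAt_of_smooth (isLinOp_dbar₂.smooth f hf) hζ
  have hz : DifferentiableAt ℝ (fun η : ℂ × ℂ => 2 * Complex.I * η.1) ζ := by fun_prop
  have h2 : dbarTan f = dbar₁ f - (fun η : ℂ × ℂ => 2 * Complex.I * η.1) * dbar₂ f := rfl
  have h3 : dbar₂ (fun η : ℂ × ℂ => 2 * Complex.I * η.1) ζ = 0 := by
    have h4 : HasFDerivAt (𝕜 := ℂ) (fun η : ℂ × ℂ => 2 * Complex.I * η.1)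
        ((2 * Complex.I) • ContinuousLinearMap.fst ℂ ℂ ℂ) ζ :=
      ((2 * Complex.I) • ContinuousLinearMap.fst ℂ ℂ ℂ).hasFDerivAt
    exact (dbar_eq_zero_of_hasFDerivAt h4).2
  rw [h2, dbar₂_sub hs1 (hz.mul hs2), dbar₂_mul hz hs2, h3, dbarTan, h1]
  ring

/-- Poly-analytic functions are polynomials in the height with holomorphic coefficients. -/
theorem IsPolyAnalytic.exists_holo {n : ℕ} {f : ℂ × ℂ → ℂ} (hf : IsPolyAnalytic 1 n f) :
    ∃ g : Fin n → ℂ × ℂ → ℂ, (∀ k, IsHolo (g k)) ∧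
      EqOn f (∑ k : Fin n, heightC ^ (k : ℕ) * g k) siegel := by
  induction n generalizing f with
  | zero => exact ⟨fun _ => 0, fun k => k.elim0, fun ζ hζ => by simpa using hf.2.2 ζ hζ⟩
  | succ n ih =>
    have hf2 : IsPolyAnalytic 1 n (dbar₂ f) := by
      refine ⟨isLinOp_dbar₂.smooth f hf.1, fun ζ hζ => ?_, fun ζ hζ => ?_⟩
      · have h0 : EqOn (dbarTan f) 0 siegel := fun ζ hζ => hf.2.1 ζ hζ
        show dbarTan (dbar₂ f) ζ = 0
        rw [dbarTan_dbar₂_comm hf.1 hζ, isLinOp_dbar₂.congr _ _ h0 hζ]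
        exact (isPolyAnalytic_zero 0 1).2.2 ζ hζ
      · rw [← Function.iterate_succ_apply]
        exact hf.2.2 ζ hζ
    obtain ⟨g, hg, hfg⟩ := ih hf2
    -- These constants make `F` a `∂̄₂`-primitive of `∂̄₂ f`: they cancel the factor `(k + 1) i / 2`
    -- produced by `h^{k+1}`.
    let g' : Fin n → ℂ × ℂ → ℂ := fun k => ((((k : ℕ) + 1) * (Complex.I / 2) : ℂ)⁻¹) • g k
    have hg' : ∀ k, IsHolo (g' k) := fun k => (hg k).smul _
    let F : ℂ × ℂ → ℂ := ∑ k : Fin n, heightC ^ ((k : ℕ) + 1) * g' k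
    have hF : IsPolyAnalytic 1 (n + 1) F := by
      have : ∀ s : Finset (Fin n),
          IsPolyAnalytic 1 (n + 1) (∑ k ∈ s, heightC ^ ((k : ℕ) + 1) * g' k) := by
        intro s
        induction s using Finset.cons_induction with
        | empty => simpa using isPolyAnalytic_zero 1 (n + 1)
        | cons a s ha ih =>
          rw [Finset.sum_cons]
          exact (isPolyAnalytic_heightC_pow_mul (by omega) (hg' a)).add ih
      exact this _
    have hdF : EqOn (dbar₂ F) (dbar₂ f) siegel := by
      have : ∀ s : Finset (Fin n), ∀ ζ ∈ siegel,
          DifferentiableAt ℝ (∑ k ∈ s, heightC ^ ((k : ℕ) + 1) * g' k) ζ ∧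
          dbar₂ (∑ k ∈ s, heightC ^ ((k : ℕ) + 1) * g' k) ζ =
            ∑ k ∈ s, (heightC ^ (k : ℕ) * g k) ζ := by
        intro s ζ hζ
        induction s using Finset.cons_induction with
        | empty =>
          simp only [Finset.sum_empty]
          exact ⟨differentiableAt_const _, (isPolyAnalytic_zero 0 1).2.2 ζ hζ⟩
        | cons a s ha ih =>
          have hda := differentiableAt_of_smooth
            (contDiffOn_heightC_pow_mul (hg' a) ((a : ℕ) + 1)) hζ
          simp only [Finset.sum_cons]
          refine ⟨hda.add ih.1, ?_⟩
          have hadd : dbar₂ (heightC ^ ((a : ℕ) + 1) * g' a +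
              ∑ k ∈ s, heightC ^ ((k : ℕ) + 1) * g' k) ζ =
              dbar₂ (heightC ^ ((a : ℕ) + 1) * g' a) ζ +
              dbar₂ (∑ k ∈ s, heightC ^ ((k : ℕ) + 1) * g' k) ζ := by
            simp only [dbar₂, fderiv_add hda ih.1, add_apply]
            ring
          rw [hadd, ih.2, dbar₂_heightC_pow_mul (hg' a) _ hζ]
          congr 1
          have hne : (((a : ℕ) + 1) * (Complex.I / 2) : ℂ) ≠ 0 :=
            mul_ne_zero (Nat.cast_add_one_ne_zero (a : ℕ)) (by simp)
          simp only [g', Pi.mul_apply, Pi.smul_apply, smul_eq_mul]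
          field_simp
      intro ζ hζ
      rw [(this Finset.univ ζ hζ).2, hfg hζ, Finset.sum_apply]
    -- The difference is killed by `∂̄₂` and by the tangential operator, hence also by `∂̄₁`; it is
    -- the coefficient of `h⁰`.
    have h0 : IsHolo (f - F) := by
      have hd2 : ∀ ζ ∈ siegel, dbar₂ (f - F) ζ = 0 := fun ζ hζ => by
        rw [dbar₂_sub (differentiableAt_of_smooth hf.1 hζ) (differentiableAt_of_smooth hF.1 hζ),
          hdF hζ, sub_self]
      refine ⟨hf.1.sub hF.1, fun ζ hζ => ?_, hd2⟩
      have ht : dbarTan (f - F) ζ = 0 := by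
        rw [dbarTan_sub (differentiableAt_of_smooth hf.1 hζ) (differentiableAt_of_smooth hF.1 hζ)]
        have e1 : dbarTan f ζ = 0 := hf.2.1 ζ hζ
        have e2 : dbarTan F ζ = 0 := hF.2.1 ζ hζ
        rw [e1, e2, sub_self]
      rwa [dbarTan, hd2 ζ hζ, mul_zero, sub_zero] at ht
    refine ⟨Fin.cons (f - F) g', fun k => ?_, fun ζ hζ => ?_⟩
    · refine Fin.cases ?_ (fun k => ?_) k
      · simpa using h0
      · simpa using hg' k
    · rw [Fin.sum_univ_succ]
      simp [F]

end Holomorphic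

/-! ### Holomorphy of superpositions of `ζ₁ ^ N exp (2πisζ₂)`. -/

section Synthesis

variable {Y : Type*} [MeasurableSpace Y] {μ : Measure Y} {c : Y → ℂ} {N : Y → ℕ} {s : Y → ℝ}

/-- Coefficients for which the superposition of the functions `ζ₁ ^ N exp (2 π i s ζ₂)` converges
absolutely on the Siegel domain. -/
structure IsSynthesis (μ : Measure Y) (c : Y → ℂ) (N : Y → ℕ) (s : Y → ℝ) : Prop where
  aesm : AEStronglyMeasurable c μ
  measN : Measurable N
  measS : Measurable s
  nonneg : ∀ᵐ y ∂μ, 0 ≤ s y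
  integrable : ∀ r σ : ℝ, 0 ≤ r → r ^ 2 < σ →
    Integrable (fun y => ‖c y‖ * r ^ N y * Real.exp (-(2 * Real.pi * s y * σ))) μ

/-- The superposition of the functions `ζ₁ ^ N exp (2 π i s ζ₂)` with coefficients `c`. -/
def synthesis (μ : Measure Y) (c : Y → ℂ) (N : Y → ℕ) (s : Y → ℝ) (ζ : ℂ × ℂ) : ℂ :=
  ∫ y, c y * ζ.1 ^ N y * Complex.exp (2 * Real.pi * Complex.I * s y * ζ.2) ∂μ

theorem norm_exp_two_pi (a : ℝ) (w : ℂ) :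
    ‖Complex.exp (2 * Real.pi * Complex.I * a * w)‖ = Real.exp (-(2 * Real.pi * a * w.im)) := by
  rw [Complex.norm_exp]
  simp

theorem norm_synthesis_integrand (a : ℂ) (k : ℕ) (t : ℝ) (ζ : ℂ × ℂ) :
    ‖a * ζ.1 ^ k * Complex.exp (2 * Real.pi * Complex.I * t * ζ.2)‖ =
      ‖a‖ * ‖ζ.1‖ ^ k * Real.exp (-(2 * Real.pi * t * ζ.2.im)) := by
  rw [norm_mul, norm_mul, norm_pow, norm_exp_two_pi]

theorem IsSynthesis.aesm_integrand (h : IsSynthesis μ c N s) (ζ : ℂ × ℂ) :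
    AEStronglyMeasurable
      (fun y => c y * ζ.1 ^ N y * Complex.exp (2 * Real.pi * Complex.I * s y * ζ.2)) μ := by
  have h1 : Measurable fun y => ζ.1 ^ N y := measurable_const.pow h.measN
  have h2 : Measurable fun y => Complex.exp (2 * Real.pi * Complex.I * s y * ζ.2) :=
    ((measurable_const.mul (Complex.measurable_ofReal.comp h.measS)).mul_const _).cexp
  exact (h.aesm.mul h1.aestronglyMeasurable).mul h2.aestronglyMeasurable

theorem mem_siegel {ζ : ℂ × ℂ} : ζ ∈ siegel ↔ ‖ζ.1‖ ^ 2 < ζ.2.im := by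
  simp [siegel]

theorem IsSynthesis.integrable_integrand (h : IsSynthesis μ c N s) {ζ : ℂ × ℂ} (hζ : ζ ∈ siegel) :
    Integrable
      (fun y => c y * ζ.1 ^ N y * Complex.exp (2 * Real.pi * Complex.I * s y * ζ.2)) μ := by
  refine (h.integrable ‖ζ.1‖ ζ.2.im (norm_nonneg _) (mem_siegel.1 hζ)).mono' (h.aesm_integrand ζ) ?_
  exact Eventually.of_forall fun y => (norm_synthesis_integrand _ _ _ _).le

/-- The left side is one term of the binomial expansion. The factor `k` created by `∂/∂ζ₁` is paid
for by a slightly larger radius. -/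
theorem nat_mul_pow_mul_le {r δ : ℝ} (hr : 0 ≤ r) (hδ : 0 ≤ δ) (k : ℕ) :
    k * r ^ (k - 1) * δ ≤ (r + δ) ^ k := by
  induction k with
  | zero => simp
  | succ k ih =>
    rcases Nat.eq_zero_or_pos k with rfl | hk
    · simpa using hr
    · obtain ⟨m, rfl⟩ : ∃ m, k = m + 1 := ⟨k - 1, by omega⟩
      simp only [Nat.add_sub_cancel] at ih ⊢
      have h1 : r ^ (m + 1) ≤ (r + δ) ^ (m + 1) := pow_le_pow_left₀ hr (by linarith) _
      have h2 := mul_le_mul_of_nonneg_left ih hr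
      have h3 := mul_le_mul_of_nonneg_left h1 hδ
      rw [pow_succ (r + δ) (m + 1)]
      push_cast at h2 ⊢
      rw [pow_succ r m] at h3 ⊢
      nlinarith

theorem exists_between_siegel {r σ : ℝ} (h : r ^ 2 < σ) :
    ∃ δ > 0, (r + δ) ^ 2 < σ - δ := by
  have hc : Tendsto (fun δ : ℝ => (σ - δ) - (r + δ) ^ 2) (𝓝[>] 0) (𝓝 (σ - 0 - (r + 0) ^ 2)) := by
    refine Tendsto.mono_left (Continuous.tendsto (by fun_prop) 0) nhdsWithin_le_nhds
  have h0 : 0 < σ - 0 - (r + 0) ^ 2 := by simpa using h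
  obtain ⟨δ, h1, h2⟩ := ((hc.eventually (lt_mem_nhds h0)).and self_mem_nhdsWithin).exists
  exact ⟨δ, h2, by linarith⟩

/-- The integrability condition holds at every point of an open region, so room `δ` is available to
absorb the new factor `N y`. The class of syntheses is thus stable under differentiation. -/
theorem IsSynthesis.deriv_fst (h : IsSynthesis μ c N s) :
    IsSynthesis μ (fun y => c y * N y) (fun y => N y - 1) s where
  aesm := h.aesm.mul
    ((measurable_from_nat (f := fun k : ℕ => (k : ℂ))).comp h.measN).aestronglyMeasurable
  measN := (measurable_from_nat (f := fun k : ℕ => k - 1)).comp h.measN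
  measS := h.measS
  nonneg := h.nonneg
  integrable r σ hr hσ := by
    obtain ⟨δ, hδ, hlt⟩ := exists_between_siegel hσ
    have hN : Measurable fun y => ((N y : ℂ)) :=
      (measurable_from_nat (f := fun k : ℕ => (k : ℂ))).comp h.measN
    have hN' : Measurable fun y => N y - 1 :=
      (measurable_from_nat (f := fun k : ℕ => k - 1)).comp h.measN
    refine ((h.integrable (r + δ) σ (by positivity) (by linarith)).const_mul δ⁻¹).mono' ?_ ?_
    · refine ((h.aesm.mul hN.aestronglyMeasurable).norm.mul
        (measurable_const.pow hN').aestronglyMeasurable).mul ?_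
      exact ((measurable_const.mul h.measS).mul_const _).neg.exp.aestronglyMeasurable
    · refine Eventually.of_forall fun y => ?_
      have h1 := nat_mul_pow_mul_le hr hδ.le (N y)
      rw [Real.norm_of_nonneg (by positivity), norm_mul, Complex.norm_natCast]
      have h2 : (N y : ℝ) * r ^ (N y - 1) ≤ δ⁻¹ * (r + δ) ^ N y := by
        rw [inv_mul_eq_div, le_div_iff₀ hδ]
        exact h1
      calc _ = ‖c y‖ * ((N y : ℝ) * r ^ (N y - 1)) * Real.exp (-(2 * Real.pi * s y * σ)) := by ring
        _ ≤ ‖c y‖ * (δ⁻¹ * (r + δ) ^ N y) * Real.exp (-(2 * Real.pi * s y * σ)) := by gcongr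
        _ = _ := by ring

/-- The new factor `2πs` is absorbed by lowering `σ` to `σ - δ`, using `x ≤ e^x`. -/
theorem IsSynthesis.deriv_snd (h : IsSynthesis μ c N s) :
    IsSynthesis μ (fun y => c y * (2 * Real.pi * Complex.I * s y)) N s where
  aesm := h.aesm.mul
    (measurable_const.mul (Complex.measurable_ofReal.comp h.measS)).aestronglyMeasurable
  measN := h.measN
  measS := h.measS
  nonneg := h.nonneg
  integrable r σ hr hσ := by
    obtain ⟨δ, hδ, hlt⟩ := exists_between_siegel hσ
    have hS : Measurable fun y => (2 * Real.pi * Complex.I * s y) :=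
      measurable_const.mul (Complex.measurable_ofReal.comp h.measS)
    refine ((h.integrable r (σ - δ) hr (by nlinarith)).const_mul δ⁻¹).mono' ?_ ?_
    · refine ((h.aesm.mul hS.aestronglyMeasurable).norm.mul
        (measurable_const.pow h.measN).aestronglyMeasurable).mul ?_
      exact ((measurable_const.mul h.measS).mul_const _).neg.exp.aestronglyMeasurable
    · filter_upwards [h.nonneg] with y hy
      have hn : ‖(2 * Real.pi * Complex.I * s y : ℂ)‖ = 2 * Real.pi * s y := by
        simp [abs_of_nonneg hy, abs_of_pos Real.pi_pos]
      rw [Real.norm_of_nonneg (by positivity), norm_mul, hn]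
      have h2 : 2 * Real.pi * s y * Real.exp (-(2 * Real.pi * s y * σ)) ≤
          δ⁻¹ * Real.exp (-(2 * Real.pi * s y * (σ - δ))) := by
        rw [inv_mul_eq_div, le_div_iff₀ hδ]
        have h3 := Real.add_one_le_exp (2 * Real.pi * s y * δ)
        have h4 : Real.exp (-(2 * Real.pi * s y * (σ - δ))) =
            Real.exp (2 * Real.pi * s y * δ) * Real.exp (-(2 * Real.pi * s y * σ)) := by
          rw [← Real.exp_add]
          congr 1
          ring
        rw [h4]
        have h5 := Real.exp_pos (-(2 * Real.pi * s y * σ))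
        nlinarith
      calc _ = ‖c y‖ * r ^ N y * (2 * Real.pi * s y * Real.exp (-(2 * Real.pi * s y * σ))) := by
            ring
        _ ≤ ‖c y‖ * r ^ N y * (δ⁻¹ * Real.exp (-(2 * Real.pi * s y * (σ - δ)))) := by gcongr
        _ = _ := by ring

theorem hasFDerivAt_synthesis_integrand (a : ℂ) (k : ℕ) (t : ℝ) (ζ : ℂ × ℂ) :
    HasFDerivAt
      (fun ζ : ℂ × ℂ => a * ζ.1 ^ k * Complex.exp (2 * Real.pi * Complex.I * t * ζ.2))
      ((a * k * ζ.1 ^ (k - 1) * Complex.exp (2 * Real.pi * Complex.I * t * ζ.2)) •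
        ContinuousLinearMap.fst ℂ ℂ ℂ +
      (a * (2 * Real.pi * Complex.I * t) * ζ.1 ^ k *
        Complex.exp (2 * Real.pi * Complex.I * t * ζ.2)) • ContinuousLinearMap.snd ℂ ℂ ℂ) ζ := by
  have h1 : HasFDerivAt (fun ζ : ℂ × ℂ => ζ.1) (ContinuousLinearMap.fst ℂ ℂ ℂ) ζ :=
    hasFDerivAt_fst
  have h2 : HasFDerivAt (fun ζ : ℂ × ℂ => ζ.2) (ContinuousLinearMap.snd ℂ ℂ ℂ) ζ :=
    hasFDerivAt_snd
  have h4 : HasFDerivAt (fun ζ : ℂ × ℂ => a * ζ.1 ^ k) _ ζ := (h1.pow k).const_mul a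
  have h5 : HasFDerivAt (fun ζ : ℂ × ℂ => Complex.exp (2 * Real.pi * Complex.I * t * ζ.2)) _ ζ :=
    (h2.const_mul (2 * Real.pi * Complex.I * t)).cexp
  have h3 := h4.mul h5
  refine h3.congr_fderiv (ContinuousLinearMap.ext fun x => ?_)
  simp
  ring

theorem IsSynthesis.hasFDerivAt (h : IsSynthesis μ c N s) {ζ : ℂ × ℂ} (hζ : ζ ∈ siegel) :
    HasFDerivAt (synthesis μ c N s)
      (synthesis μ (fun y => c y * N y) (fun y => N y - 1) s ζ • ContinuousLinearMap.fst ℂ ℂ ℂ +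
      synthesis μ (fun y => c y * (2 * Real.pi * Complex.I * s y)) N s ζ •
        ContinuousLinearMap.snd ℂ ℂ ℂ) ζ := by
  obtain ⟨δ, hδ, hlt⟩ := exists_between_siegel (mem_siegel.1 hζ)
  let A : Y → ℂ × ℂ → ℂ := fun y ζ => c y * N y * ζ.1 ^ (N y - 1) *
    Complex.exp (2 * Real.pi * Complex.I * s y * ζ.2)
  let B : Y → ℂ × ℂ → ℂ := fun y ζ => c y * (2 * Real.pi * Complex.I * s y) * ζ.1 ^ N y *
    Complex.exp (2 * Real.pi * Complex.I * s y * ζ.2)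
  have hA : Integrable (fun y => A y ζ) μ := h.deriv_fst.integrable_integrand hζ
  have hB : Integrable (fun y => B y ζ) μ := h.deriv_snd.integrable_integrand hζ
  have hA' : Integrable (fun y => A y ζ • ContinuousLinearMap.fst ℂ ℂ ℂ) μ := hA.smul_const _
  have hB' : Integrable (fun y => B y ζ • ContinuousLinearMap.snd ℂ ℂ ℂ) μ := hB.smul_const _
  have hint : ∫ y, (A y ζ • ContinuousLinearMap.fst ℂ ℂ ℂ + B y ζ • ContinuousLinearMap.snd ℂ ℂ ℂ) ∂μ
      = synthesis μ (fun y => c y * N y) (fun y => N y - 1) s ζ • ContinuousLinearMap.fst ℂ ℂ ℂ +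
      synthesis μ (fun y => c y * (2 * Real.pi * Complex.I * s y)) N s ζ •
        ContinuousLinearMap.snd ℂ ℂ ℂ := by
    rw [integral_add hA' hB', integral_smul_const,
      integral_smul_const]
    rfl
  rw [← hint]
  -- On this ball `|η₁| ≤ |ζ₁| + δ` and `Im η₂ ≥ Im ζ₂ - δ`; the same two bounds dominate the
  -- derivative of the integrand below.
  have hsub : Metric.ball ζ δ ⊆ siegel := by
    intro η hη
    rw [Metric.mem_ball, Prod.dist_eq, max_lt_iff, dist_eq_norm, dist_eq_norm] at hη
    have h1 : ‖η.1‖ ≤ ‖ζ.1‖ + δ := by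
      have := norm_le_norm_add_norm_sub' η.1 ζ.1
      linarith [hη.1]
    have h2 : ζ.2.im - δ ≤ η.2.im := by
      have := (Complex.abs_im_le_norm (η.2 - ζ.2)).trans hη.2.le
      rw [Complex.sub_im] at this
      linarith [(abs_le.1 this).1]
    rw [mem_siegel]
    calc ‖η.1‖ ^ 2 ≤ (‖ζ.1‖ + δ) ^ 2 := by gcongr
      _ < _ := by linarith
  refine hasFDerivAt_integral_of_dominated_of_fderiv_le (Metric.ball_mem_nhds ζ hδ)
    (F := fun ζ y => c y * ζ.1 ^ N y * Complex.exp (2 * Real.pi * Complex.I * s y * ζ.2))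
    (F' := fun ζ y => A y ζ • ContinuousLinearMap.fst ℂ ℂ ℂ + B y ζ • ContinuousLinearMap.snd ℂ ℂ ℂ)
    (bound := fun y =>
      ‖c y * N y‖ * (‖ζ.1‖ + δ) ^ (N y - 1) * Real.exp (-(2 * Real.pi * s y * (ζ.2.im - δ))) +
      ‖c y * (2 * Real.pi * Complex.I * s y)‖ * (‖ζ.1‖ + δ) ^ N y *
        Real.exp (-(2 * Real.pi * s y * (ζ.2.im - δ))))
    (Eventually.of_forall fun η => h.aesm_integrand η) (h.integrable_integrand hζ)
    (hA'.aestronglyMeasurable.add hB'.aestronglyMeasurable) ?_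
    ((h.deriv_fst.integrable _ _ (by positivity) hlt).add
      (h.deriv_snd.integrable _ _ (by positivity) hlt))
    (Eventually.of_forall fun y η _ => hasFDerivAt_synthesis_integrand _ _ _ _)
  filter_upwards [h.nonneg] with y hy η hη
  rw [Metric.mem_ball, Prod.dist_eq, max_lt_iff, dist_eq_norm, dist_eq_norm] at hη
  have h1 : ‖η.1‖ ≤ ‖ζ.1‖ + δ := by
    have := norm_le_norm_add_norm_sub' η.1 ζ.1
    linarith [hη.1]
  have h2 : ζ.2.im - δ ≤ η.2.im := by
    have := (Complex.abs_im_le_norm (η.2 - ζ.2)).trans hη.2.le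
    rw [Complex.sub_im] at this
    linarith [(abs_le.1 this).1]
  have h3 : Real.exp (-(2 * Real.pi * s y * η.2.im)) ≤
      Real.exp (-(2 * Real.pi * s y * (ζ.2.im - δ))) := by
    gcongr
  have key : ∀ (a : ℂ) (k : ℕ) (L : ℂ × ℂ →L[ℂ] ℂ), ‖L‖ ≤ 1 →
      ‖(a * η.1 ^ k * Complex.exp (2 * Real.pi * Complex.I * s y * η.2)) • L‖ ≤
      ‖a‖ * (‖ζ.1‖ + δ) ^ k * Real.exp (-(2 * Real.pi * s y * (ζ.2.im - δ))) := by
    intro a k L hL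
    rw [norm_smul, norm_synthesis_integrand]
    calc _ ≤ ‖a‖ * ‖η.1‖ ^ k * Real.exp (-(2 * Real.pi * s y * η.2.im)) * 1 := by gcongr
      _ ≤ _ := by rw [mul_one]; gcongr
  exact (norm_add_le _ _).trans (add_le_add (key _ _ _ (ContinuousLinearMap.norm_fst_le _ _ _))
    (key _ _ _ (ContinuousLinearMap.norm_snd_le _ _ _)))

/-- Induction on the order: both partial derivatives are again syntheses, with other coefficients
and exponents. -/
theorem IsSynthesis.contDiffOn (h : IsSynthesis μ c N s) :
    ContDiffOn ℂ ∞ (synthesis μ c N s) siegel := by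
  rw [contDiffOn_infty]
  intro m
  induction m generalizing c N with
  | zero =>
    exact contDiffOn_zero.2 fun ζ hζ => (h.hasFDerivAt hζ).continuousAt.continuousWithinAt
  | succ m ih =>
    push_cast
    rw [contDiffOn_succ_iff_hasFDerivWithinAt_of_uniqueDiffOn isOpen_siegel.uniqueDiffOn]
    refine ⟨fun h => absurd h (by exact_mod_cast WithTop.coe_ne_top), _, ?_, fun ζ hζ => (h.hasFDerivAt hζ).hasFDerivWithinAt⟩
    exact ((ih h.deriv_fst).smul contDiffOn_const).add ((ih h.deriv_snd).smul contDiffOn_const)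

theorem IsSynthesis.isHolo (h : IsSynthesis μ c N s) : IsHolo (synthesis μ c N s) :=
  isHolo_of_contDiffOn h.contDiffOn

end Synthesis

/-! ### Coordinates that flatten the Siegel domain. -/

section Coordinates

/-- The coordinates `((z, v), u) ↦ (z, u + i (v + |z|²))` on `ℂ²`, in which the Siegel domain
is the set `v > 0`. -/
def siegelCoord : (ℂ × ℝ) × ℝ ≃ₜ ℂ × ℂ where
  toFun x := (x.1.1, x.2 + (x.1.2 + ‖x.1.1‖ ^ 2 : ℝ) * Complex.I)
  invFun ζ := ((ζ.1, ζ.2.im - ‖ζ.1‖ ^ 2), ζ.2.re)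
  left_inv x := by
    ext <;> simp [-Complex.ofReal_pow]
  right_inv ζ := by
    refine Prod.ext rfl ?_
    simp only [sub_add_cancel]
    exact Complex.re_add_im _
  continuous_toFun := by fun_prop
  continuous_invFun := by fun_prop

@[simp] theorem siegelCoord_fst (x : (ℂ × ℝ) × ℝ) : (siegelCoord x).1 = x.1.1 := rfl

theorem siegelCoord_snd (x : (ℂ × ℝ) × ℝ) :
    (siegelCoord x).2 = x.2 + (x.1.2 + ‖x.1.1‖ ^ 2 : ℝ) * Complex.I := rfl

@[simp] theorem siegelCoord_im (x : (ℂ × ℝ) × ℝ) :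
    (siegelCoord x).2.im = x.1.2 + ‖x.1.1‖ ^ 2 := by
  simp [siegelCoord_snd, -Complex.ofReal_pow]

@[simp] theorem height_siegelCoord (x : (ℂ × ℝ) × ℝ) : height (siegelCoord x) = x.1.2 := by
  simp [height]

theorem siegelCoord_mem {x : (ℂ × ℝ) × ℝ} : siegelCoord x ∈ siegel ↔ 0 < x.1.2 := by
  simp [siegel]

/-- The measure `dz dv` on `ℂ × (0, ∞)`. -/
def baseMeasure : Measure (ℂ × ℝ) := (volume : Measure ℂ).prod (volume.restrict (Ioi (0 : ℝ)))

instance : SFinite baseMeasure := by unfold baseMeasure; infer_instance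

theorem ae_baseMeasure : ∀ᵐ q ∂baseMeasure, 0 < q.2 := by
  have : ∀ᵐ v ∂volume.restrict (Ioi (0 : ℝ)), 0 < v := ae_restrict_mem measurableSet_Ioi
  exact Measure.quasiMeasurePreserving_snd.ae this

/-- For fixed `z` the map is a translation of `v` by `|z|²` followed by a swap, so the whole is a
measure-preserving skew product. -/
theorem measurePreserving_siegelCoord_volume :
    MeasurePreserving siegelCoord (((volume : Measure ℂ).prod (volume : Measure ℝ)).prod volume)
      (volume : Measure (ℂ × ℂ)) := by
  have h1 := measurePreserving_prodAssoc (volume : Measure ℂ) (volume : Measure ℝ)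
    (volume : Measure ℝ)
  let g : ℂ → ℝ × ℝ → ℂ := fun z y => y.2 + (y.1 + ‖z‖ ^ 2 : ℝ) * Complex.I
  have h2 : MeasurePreserving (fun p : ℂ × ℝ × ℝ => (p.1, g p.1 p.2))
      ((volume : Measure ℂ).prod ((volume : Measure ℝ).prod volume))
      ((volume : Measure ℂ).prod volume) := by
    refine (MeasurePreserving.id volume).skew_product (g := g) ?_ (Eventually.of_forall fun z => ?_)
    · exact Continuous.measurable (by fun_prop)
    · have h3 : MeasurePreserving (Prod.map (fun v : ℝ => v + ‖z‖ ^ 2) (id : ℝ → ℝ))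
          ((volume : Measure ℝ).prod volume) ((volume : Measure ℝ).prod volume) :=
        (measurePreserving_add_right volume _).prod (MeasurePreserving.id _)
      have h4 := (Complex.volume_preserving_equiv_real_prod.symm).comp
        (Measure.measurePreserving_swap.comp h3)
      have h5 : g z = Complex.measurableEquivRealProd.symm ∘ Prod.swap ∘
          Prod.map (fun v : ℝ => v + ‖z‖ ^ 2) (id : ℝ → ℝ) := by
        funext y
        simp only [g, Function.comp_apply, Prod.map, id, Prod.swap,
          Complex.measurableEquivRealProd_symm_apply]
        exact (Complex.mk_eq_add_mul_I _ _).symm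
      rw [h5]
      exact h4.map_eq
  exact h2.comp h1

theorem measurePreserving_siegelCoord :
    MeasurePreserving siegelCoord (baseMeasure.prod volume) siegelMeasure := by
  have h := measurePreserving_siegelCoord_volume.restrict_preimage isOpen_siegel.measurableSet
  have h1 : siegelCoord ⁻¹' siegel = (univ ×ˢ Ioi 0) ×ˢ univ := by
    ext x
    rw [mem_preimage, siegelCoord_mem]
    simp
  rw [h1, ← Measure.prod_restrict, ← Measure.prod_restrict, Measure.restrict_univ,
    Measure.restrict_univ] at h
  exact h

theorem measurableEmbedding_siegelCoord : MeasurableEmbedding siegelCoord :=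
  siegelCoord.measurableEmbedding

end Coordinates

/-! ### Plancherel's theorem in one variable with parameters. -/

section FiberwiseFourier

open FourierTransform

variable {Q : Type*} [MeasurableSpace Q] {ν : Measure Q}

theorem fourierInv_eq_integral_exp (f : ℝ → ℂ) (x : ℝ) :
    𝓕⁻ f x = ∫ t, f t * Complex.exp (2 * Real.pi * Complex.I * t * x) := by
  rw [Real.fourierInv_eq']
  refine integral_congr_ae (Eventually.of_forall fun t => ?_)
  simp only [smul_eq_mul]
  rw [mul_comm]
  congr 2
  simp
  ring

theorem stronglyMeasurable_fiberwise_fourierInv {A : Q → ℝ → ℂ}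
    (hA : StronglyMeasurable (Function.uncurry A)) :
    StronglyMeasurable fun x : Q × ℝ => 𝓕⁻ (A x.1) x.2 := by
  simp_rw [fourierInv_eq_integral_exp]
  refine StronglyMeasurable.integral_prod_right'
    (f := fun y : (Q × ℝ) × ℝ => A y.1.1 y.2 *
      Complex.exp (2 * Real.pi * Complex.I * y.2 * y.1.2)) ?_
  refine (hA.comp_measurable (by fun_prop : Measurable fun y : (Q × ℝ) × ℝ => (y.1.1, y.2))).mul ?_
  exact Measurable.stronglyMeasurable (by fun_prop)

theorem lintegral_fiberwise_fourierInv {A : Q → ℝ → ℂ}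
    (hA : StronglyMeasurable (Function.uncurry A))
    (h : ∀ᵐ q ∂ν, Integrable (A q) ∧ MemLp (A q) 2) :
    ∫⁻ x : Q × ℝ, ‖𝓕⁻ (A x.1) x.2‖ₑ ^ 2 ∂(ν.prod volume) =
      ∫⁻ q, (∫⁻ t, ‖A q t‖ₑ ^ 2) ∂ν := by
  rw [lintegral_prod _ ((stronglyMeasurable_fiberwise_fourierInv hA).enorm.pow_const _).aemeasurable]
  refine lintegral_congr_ae ?_
  filter_upwards [h] with q hq
  have h1 := eLpNorm_fourierInv hq.1 hq.2
  have h2 : ∀ f : ℝ → ℂ, ∫⁻ t, ‖f t‖ₑ ^ 2 = eLpNorm f 2 volume ^ 2 := by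
    intro f
    rw [eLpNorm_eq_lintegral_rpow_enorm_toReal two_ne_zero (by simp)]
    simp only [ENNReal.toReal_ofNat]
    rw [← ENNReal.rpow_natCast, ← ENNReal.rpow_mul]
    norm_num
  simp only [h2, h1]

theorem integral_fiberwise_fourierInv [SFinite ν] {A B : Q → ℝ → ℂ} {β : Q → ℂ} {C : ℝ}
    (hβ : AEStronglyMeasurable β ν) (hC : ∀ᵐ q ∂ν, ‖β q‖ ≤ C)
    (hA1 : ∀ᵐ q ∂ν, Integrable (A q) ∧ MemLp (A q) 2)
    (hB1 : ∀ᵐ q ∂ν, Integrable (B q) ∧ MemLp (B q) 2)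
    (hA2 : MemLp (fun x : Q × ℝ => 𝓕⁻ (A x.1) x.2) 2 (ν.prod volume))
    (hB2 : MemLp (fun x : Q × ℝ => 𝓕⁻ (B x.1) x.2) 2 (ν.prod volume)) :
    ∫ x : Q × ℝ, β x.1 * (𝓕⁻ (A x.1) x.2 * (starRingEnd ℂ) (𝓕⁻ (B x.1) x.2)) ∂(ν.prod volume) =
      ∫ q, β q * (∫ t, A q t * (starRingEnd ℂ) (B q t)) ∂ν := by
  have hβ' : AEStronglyMeasurable (fun x : Q × ℝ => β x.1) (ν.prod volume) :=
    hβ.comp_quasiMeasurePreserving Measure.quasiMeasurePreserving_fst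
  have hC' : ∀ᵐ x : Q × ℝ ∂(ν.prod volume), ‖β x.1‖ ≤ C :=
    Measure.quasiMeasurePreserving_fst.ae hC
  have hi : Integrable (fun x : Q × ℝ => β x.1 *
      (𝓕⁻ (A x.1) x.2 * (starRingEnd ℂ) (𝓕⁻ (B x.1) x.2))) (ν.prod volume) :=
    (hA2.integrable_mul hB2.star).bdd_mul hβ' hC'
  rw [integral_prod _ hi]
  refine integral_congr_ae ?_
  filter_upwards [hA1, hB1] with q hq hq'
  rw [integral_const_mul, integral_fourierInv_mul_conj hq.1 hq.2 hq'.1 hq'.2]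

end FiberwiseFourier

theorem IsPolyAnalytic.congr {l₁ l₂ : ℕ} {f g : ℂ × ℂ → ℂ} (hf : IsPolyAnalytic l₁ l₂ f)
    (h : EqOn g f siegel) : IsPolyAnalytic l₁ l₂ g :=
  ⟨hf.1.congr h,
    fun ζ hζ => ((isLinOp_dbarTan.iterate l₁).congr _ _ h hζ).trans (hf.2.1 ζ hζ),
    fun ζ hζ => ((isLinOp_dbar₂.iterate l₂).congr _ _ h hζ).trans (hf.2.2 ζ hζ)⟩

/-! ### Superpositions with square-integrable coefficients. -/

section Wave

variable {Y : Type*} [MeasurableSpace Y] {μ : Measure Y} {κ : Y → ℝ} {N : Y → ℕ} {s : Y → ℝ}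
  {n : ℕ}

/-- Normalising factors `κ` for which superpositions with square-integrable coefficients
converge. -/
structure IsWaveKernel (μ : Measure Y) (κ : Y → ℝ) (N : Y → ℕ) (s : Y → ℝ) : Prop where
  measκ : Measurable κ
  measN : Measurable N
  measS : Measurable s
  nonneg : ∀ᵐ y ∂μ, 0 ≤ s y
  memLp : ∀ (k : ℕ) (r σ : ℝ), 0 ≤ r → r ^ 2 < σ →
    MemLp (fun y => κ y * (4 * Real.pi * s y) ^ k * r ^ N y *
      Real.exp (-(2 * Real.pi * s y * σ))) 2 μ

/-- The Laguerre factor `∑ⱼ aⱼ (-1)ʲ Lⱼ(y)`. -/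
def laguerreSum (a : EuclideanSpace ℂ (Fin n)) (y : ℝ) : ℂ :=
  ∑ j : Fin n, a j * (lagC j).eval (y : ℂ)

/-- The poly-analytic function with frequency coefficients `Ψ`. -/
def wave (μ : Measure Y) (κ : Y → ℝ) (N : Y → ℕ) (s : Y → ℝ) (Ψ : Y → EuclideanSpace ℂ (Fin n))
    (ζ : ℂ × ℂ) : ℂ :=
  ∫ y, κ y * laguerreSum (Ψ y) (4 * Real.pi * s y * height ζ) * ζ.1 ^ N y *
    Complex.exp (2 * Real.pi * Complex.I * s y * ζ.2) ∂μ

theorem natDegree_lagC_le (j : ℕ) : (lagC j).natDegree ≤ j := by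
  unfold lagC
  refine (Polynomial.natDegree_C_mul_le _ _).trans ?_
  exact (Polynomial.natDegree_map_le).trans (natDegree_lagP_le j)

/-- The coefficient of `y ^ k` in the Laguerre factor. -/
def laguerreCoeff (a : EuclideanSpace ℂ (Fin n)) (k : ℕ) : ℂ :=
  ∑ j : Fin n, a j * (lagC j).coeff k

theorem laguerreSum_eq (a : EuclideanSpace ℂ (Fin n)) (y : ℝ) :
    laguerreSum a y = ∑ k : Fin n, laguerreCoeff a k * (y : ℂ) ^ (k : ℕ) := by
  simp only [laguerreSum, laguerreCoeff, Finset.sum_mul]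
  rw [Finset.sum_comm]
  refine Finset.sum_congr rfl fun j _ => ?_
  rw [Polynomial.eval_eq_sum_range' (lt_of_le_of_lt (natDegree_lagC_le j) j.2), Finset.mul_sum,
    Finset.sum_range]
  exact Finset.sum_congr rfl fun k _ => by ring

theorem memLp_laguerreCoeff {Ψ : Y → EuclideanSpace ℂ (Fin n)} (hΨ : MemLp Ψ 2 μ) (k : ℕ) :
    MemLp (fun y => laguerreCoeff (Ψ y) k) 2 μ := by
  unfold laguerreCoeff
  refine memLp_finsetSum _ fun j _ => MemLp.mul_const ?_ _
  exact (EuclideanSpace.proj (𝕜 := ℂ) j).comp_memLp' hΨ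

/-- Cauchy–Schwarz between the square-integrable kernel and the square-integrable coefficient. The
powers of `4πs` come from expanding the Laguerre factor in powers of the height. -/
theorem IsWaveKernel.isSynthesis (h : IsWaveKernel μ κ N s) {Ψ : Y → EuclideanSpace ℂ (Fin n)}
    (hΨ : MemLp Ψ 2 μ) (k : ℕ) :
    IsSynthesis μ (fun y => κ y * laguerreCoeff (Ψ y) k * (4 * Real.pi * s y : ℝ) ^ k) N s where
  aesm := ((Complex.measurable_ofReal.comp h.measκ).aestronglyMeasurable.mul
    (memLp_laguerreCoeff hΨ k).1).mul
    ((Complex.measurable_ofReal.comp (measurable_const.mul h.measS)).pow_const k).aestronglyMeasurable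
  measN := h.measN
  measS := h.measS
  nonneg := h.nonneg
  integrable r σ hr hσ := by
    have h1 := (h.memLp k r σ hr hσ).norm.integrable_mul (memLp_laguerreCoeff hΨ k).norm
    refine h1.congr (Eventually.of_forall fun y => ?_)
    simp only [Pi.mul_apply, norm_mul, norm_pow, Complex.norm_real, Real.norm_eq_abs,
      abs_of_nonneg hr, abs_of_pos (Real.exp_pos _)]
    ring

theorem IsWaveKernel.wave_eqOn (h : IsWaveKernel μ κ N s) {Ψ : Y → EuclideanSpace ℂ (Fin n)}
    (hΨ : MemLp Ψ 2 μ) : EqOn (wave μ κ N s Ψ) (∑ k : Fin n, heightC ^ (k : ℕ) *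
      synthesis μ (fun y => κ y * laguerreCoeff (Ψ y) k * (4 * Real.pi * s y : ℝ) ^ (k : ℕ)) N s)
      siegel := by
  intro ζ hζ
  simp only [Finset.sum_apply, Pi.mul_apply, Pi.pow_apply, wave, synthesis]
  simp_rw [← integral_const_mul]
  have hi := integral_finsetSum (Finset.univ : Finset (Fin n)) fun (k : Fin n) _ =>
    ((h.isSynthesis hΨ (k : ℕ)).integrable_integrand hζ).const_mul (heightC ζ ^ (k : ℕ))
  rw [← hi]
  refine integral_congr_ae (Eventually.of_forall fun y => ?_)
  simp only [laguerreSum_eq, heightC, Finset.mul_sum, Finset.sum_mul]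
  refine Finset.sum_congr rfl fun k _ => ?_
  push_cast
  ring

/-- The parameter space `Y` is general because the result is used twice: with `Y = ℝ` for one degree
in `ζ₁`, and with `Y = ℕ × ℝ` for infinite sums over all degrees. -/
theorem IsWaveKernel.isPolyAnalytic (h : IsWaveKernel μ κ N s)
    {Ψ : Y → EuclideanSpace ℂ (Fin n)} (hΨ : MemLp Ψ 2 μ) :
    IsPolyAnalytic 1 n (wave μ κ N s Ψ) :=
  (isPolyAnalytic_sum fun k : Fin n => (h.isSynthesis hΨ k).isHolo).congr (h.wave_eqOn hΨ)

theorem IsWaveKernel.integrable (h : IsWaveKernel μ κ N s) {Ψ : Y → EuclideanSpace ℂ (Fin n)}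
    (hΨ : MemLp Ψ 2 μ) {ζ : ℂ × ℂ} (hζ : ζ ∈ siegel) :
    Integrable (fun y => κ y * laguerreSum (Ψ y) (4 * Real.pi * s y * height ζ) * ζ.1 ^ N y *
      Complex.exp (2 * Real.pi * Complex.I * s y * ζ.2)) μ := by
  have h1 := integrable_finsetSum (Finset.univ : Finset (Fin n)) fun k _ =>
    ((h.isSynthesis hΨ k).integrable_integrand hζ).const_mul (heightC ζ ^ (k : ℕ))
  refine h1.congr (Eventually.of_forall fun y => ?_)
  simp only [laguerreSum_eq, heightC, Finset.mul_sum, Finset.sum_mul]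
  refine Finset.sum_congr rfl fun k _ => ?_
  push_cast
  ring

end Wave

/-! ### The normalising factors and their square-integrability. -/

section Normalisation

/-- The normalising factor of `ζ₁ ^ p`. -/
def monoNorm (p : ℕ) (t : ℝ) : ℝ := √((4 * Real.pi * t) ^ (p + 2) / (Real.pi * p.factorial))

theorem continuous_monoNorm (p : ℕ) : Continuous (monoNorm p) := by
  unfold monoNorm; fun_prop

theorem monoNorm_pos (p : ℕ) {t : ℝ} (ht : 0 < t) : 0 < monoNorm p t := by
  unfold monoNorm; positivity

theorem monoNorm_sq (p : ℕ) {t : ℝ} (ht : 0 ≤ t) :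
    monoNorm p t ^ 2 = (4 * Real.pi * t) ^ (p + 2) / (Real.pi * p.factorial) :=
  Real.sq_sqrt (by positivity)

/-- The measure on the set of pairs `(p, t)` of a degree and a frequency. -/
def freqMeasure : Measure (ℕ × ℝ) := (Measure.count : Measure ℕ).prod (volume.restrict (Ioi (0 : ℝ)))

theorem integrableOn_pow_mul_exp_neg (m : ℕ) {b : ℝ} (hb : 0 < b) :
    IntegrableOn (fun t : ℝ => t ^ m * Real.exp (-(b * t))) (Ioi 0) := by
  have h := integrableOn_rpow_mul_exp_neg_mul_rpow (p := 1) (s := m) (b := b)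
    (by have : (0 : ℝ) ≤ m := m.cast_nonneg
        linarith) one_pos hb
  refine h.congr_fun (fun t _ => ?_) measurableSet_Ioi
  simp

theorem hasSum_pow_div_factorial (x : ℝ) :
    HasSum (fun p : ℕ => x ^ p / (p.factorial : ℝ)) (Real.exp x) := by
  rw [Real.exp_eq_exp_ℝ]
  exact NormedSpace.expSeries_div_hasSum_exp (𝔸 := ℝ) x

/-- This is the exponential series. The growth `exp (4πt r²)` is beaten by `exp (-4πtσ)` when `r² <
σ`, which is the condition defining the domain. -/
theorem hasSum_monoNorm_sq {t : ℝ} (ht : 0 ≤ t) (r : ℝ) :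
    HasSum (fun p : ℕ => (monoNorm p t * r ^ p) ^ 2)
      ((4 * Real.pi * t) ^ 2 / Real.pi * Real.exp (4 * Real.pi * t * r ^ 2)) := by
  have h := (hasSum_pow_div_factorial (4 * Real.pi * t * r ^ 2)).mul_left
    ((4 * Real.pi * t) ^ 2 / Real.pi)
  have e : (fun p : ℕ => (monoNorm p t * r ^ p) ^ 2) = fun p : ℕ =>
      (4 * Real.pi * t) ^ 2 / Real.pi * ((4 * Real.pi * t * r ^ 2) ^ p / p.factorial) := by
    funext p
    rw [mul_pow, monoNorm_sq p ht, mul_pow _ _ p, div_mul_div_comm, ← pow_mul, ← pow_mul,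
      div_mul_eq_mul_div, pow_add, mul_comm 2 p]
    ring
  rwa [e]

theorem isWaveKernel_freq : IsWaveKernel freqMeasure (fun y => monoNorm y.1 y.2) Prod.fst Prod.snd where
  measκ := measurable_from_prod_countable_right fun p => (continuous_monoNorm p).measurable
  measN := measurable_fst
  measS := measurable_snd
  nonneg := by
    have : ∀ᵐ v ∂volume.restrict (Ioi (0 : ℝ)), 0 ≤ v :=
      (ae_restrict_mem measurableSet_Ioi).mono fun v hv => le_of_lt hv
    exact Measure.quasiMeasurePreserving_snd.ae this
  memLp k r σ hr hσ := by
    have hm : Measurable fun y : ℕ × ℝ => monoNorm y.1 y.2 * (4 * Real.pi * y.2) ^ k * r ^ y.1 *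
        Real.exp (-(2 * Real.pi * y.2 * σ)) := by
      refine measurable_from_prod_countable_right fun p => Continuous.measurable ?_
      have := continuous_monoNorm p
      simp only
      fun_prop
    rw [memLp_two_iff_integrable_sq hm.aestronglyMeasurable, freqMeasure,
      integrable_prod_iff' (hm.pow_const 2).aestronglyMeasurable]
    have hs : ∀ t : ℝ, 0 < t → HasSum (fun p : ℕ => (monoNorm p t * (4 * Real.pi * t) ^ k * r ^ p *
        Real.exp (-(2 * Real.pi * t * σ))) ^ 2) ((4 * Real.pi * t) ^ (2 * k + 2) / Real.pi *
          Real.exp (-(4 * Real.pi * (σ - r ^ 2) * t))) := by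
      intro t ht
      have h1 := (hasSum_monoNorm_sq ht.le r).mul_left
        ((4 * Real.pi * t) ^ (2 * k) * Real.exp (-(2 * Real.pi * t * σ)) ^ 2)
      convert! h1 using 1
      · funext p; ring
      · rw [← Real.exp_nat_mul]
        have : Real.exp (-(4 * Real.pi * (σ - r ^ 2) * t)) =
            Real.exp ((2 : ℕ) * -(2 * Real.pi * t * σ)) * Real.exp (4 * Real.pi * t * r ^ 2) := by
          rw [← Real.exp_add]; congr 1; push_cast; ring
        rw [this]
        ring
    constructor
    · filter_upwards [ae_restrict_mem measurableSet_Ioi] with t ht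
      exact integrable_count_iff.2 (hs t ht).summable.norm
    · have hi := (integrableOn_pow_mul_exp_neg (2 * k + 2) (b := 4 * Real.pi * (σ - r ^ 2))
        (by have := Real.pi_pos
            have : 0 < σ - r ^ 2 := by linarith
            positivity)).const_mul ((4 * Real.pi) ^ (2 * k + 2) / Real.pi)
      refine Integrable.congr hi ?_
      filter_upwards [ae_restrict_mem measurableSet_Ioi] with t ht
      have h2 : ∫ p : ℕ, ‖(monoNorm p t * (4 * Real.pi * t) ^ k * r ^ p *
          Real.exp (-(2 * Real.pi * t * σ))) ^ 2‖ ∂Measure.count =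
          (4 * Real.pi * t) ^ (2 * k + 2) / Real.pi *
          Real.exp (-(4 * Real.pi * (σ - r ^ 2) * t)) := by
        rw [integral_countable (integrable_count_iff.2 (hs t ht).summable.norm).norm]
        simp only [Measure.real, Measure.count_singleton, ENNReal.toReal_one, one_smul, norm_pow,
          Real.norm_eq_abs, sq_abs]
        exact (hs t ht).tsum_eq
      rw [h2]
      ring

/-- A slice of the kernel over all degrees: for the counting measure, almost every degree means
every degree. -/
theorem isWaveKernel_mono (p : ℕ) :
    IsWaveKernel (volume.restrict (Ioi (0 : ℝ))) (monoNorm p) (fun _ => p) (fun t => t) where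
  measκ := (continuous_monoNorm p).measurable
  measN := measurable_const
  measS := measurable_id
  nonneg := (ae_restrict_mem measurableSet_Ioi).mono fun v hv => le_of_lt hv
  memLp k r σ hr hσ := by
    have h := isWaveKernel_freq.memLp k r σ hr hσ
    have hc := continuous_monoNorm p
    rw [memLp_two_iff_integrable_sq h.1] at h
    rw [memLp_two_iff_integrable_sq (Continuous.aestronglyMeasurable (by fun_prop))]
    exact Measure.ae_count_iff.1 h.prod_right_ae p

end Normalisation

/-! ### Partial Fourier transforms of waves and their inner products. -/

section Amplitude

open FourierTransform

variable {n : ℕ}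

/-- The probability density of `ζ₁` attached to the degree `p` and the frequency `t`. -/
def monoDensity (p : ℕ) (t : ℝ) (z : ℂ) : ℝ :=
  monoNorm p t ^ 2 / (4 * Real.pi * t) * (‖z‖ ^ (2 * p) * Real.exp (-(4 * Real.pi * t * ‖z‖ ^ 2)))

/-- With `b = 4πt` the Gaussian moment is `π p! / b^{p+1}`, while `monoNorm²` carries `b^{p+2}`. The
spare factor `4πt = 2x`, `x = 2πt`, is the one in front of `density`. -/
theorem integral_monoDensity (p : ℕ) {t : ℝ} (ht : 0 < t) : ∫ z : ℂ, monoDensity p t z = 1 := by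
  have hb : 0 < 4 * Real.pi * t := by positivity
  have h := Complex.integral_rpow_mul_exp_neg_mul_rpow (p := 2) (q := (2 * p : ℕ))
    (b := 4 * Real.pi * t) one_le_two (by
      have : (0 : ℝ) ≤ (2 * p : ℕ) := Nat.cast_nonneg _
      linarith) hb
  have e1 : (((2 * p : ℕ) : ℝ) + 2) / 2 = ((p + 1 : ℕ) : ℝ) := by push_cast; ring
  rw [neg_div, e1, Real.rpow_neg hb.le, Real.rpow_natCast, Nat.cast_succ,
    Real.Gamma_nat_eq_factorial] at h
  unfold monoDensity
  rw [integral_const_mul, monoNorm_sq p ht.le]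
  have h2 : ∫ z : ℂ, ‖z‖ ^ (2 * p) * Real.exp (-(4 * Real.pi * t * ‖z‖ ^ 2)) =
      2 * Real.pi / 2 * ((4 * Real.pi * t) ^ (p + 1))⁻¹ * p.factorial := by
    rw [← h]
    refine integral_congr_ae (Eventually.of_forall fun z => ?_)
    simp only [Real.rpow_natCast, Real.rpow_two, neg_mul]
  rw [h2]
  have := Real.pi_pos
  have := p.factorial_ne_zero
  field_simp
  ring

/-- A non-integrable function would have integral `0` by convention, and this integral is `1`. -/
theorem integrable_monoDensity (p : ℕ) {t : ℝ} (ht : 0 < t) : Integrable (monoDensity p t) :=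
  not_imp_comm.1 integral_undef (by rw [integral_monoDensity p ht]; exact one_ne_zero)

theorem integral_density (j k : ℕ) {x : ℝ} (hx : 0 < x) :
    ∫ v in Ioi (0 : ℝ), density j k x v = if j = k then 1 else 0 := by
  have h := integral_comp_mul_left_Ioi (fun y => laguerreFun j y * laguerreFun k y) 0
    (mul_pos two_pos hx)
  rw [mul_zero, integral_laguerreFun_mul] at h
  simp only [density]
  rw [integral_const_mul, h, smul_eq_mul, ← mul_assoc, mul_inv_cancel₀ (by positivity), one_mul]

/-- The value at `((z, v), t)` of the partial Fourier transform of a wave with coefficient `a` at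
the frequency `t`. -/
def amplitude (p : ℕ) (a : EuclideanSpace ℂ (Fin n)) (q : ℂ × ℝ) (t : ℝ) : ℂ :=
  monoNorm p t * laguerreSum a (4 * Real.pi * t * q.2) * q.1 ^ p *
    (Real.exp (-(2 * Real.pi * t * (q.2 + ‖q.1‖ ^ 2))) : ℝ)

theorem continuous_laguerreSum :
    Continuous fun x : EuclideanSpace ℂ (Fin n) × ℝ => laguerreSum x.1 x.2 := by
  unfold laguerreSum
  refine continuous_finsetSum _ fun j _ => Continuous.mul (by fun_prop) ?_
  exact (Polynomial.continuous _).comp (Complex.continuous_ofReal.comp continuous_snd)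

theorem continuous_amplitude (p : ℕ) :
    Continuous fun x : EuclideanSpace ℂ (Fin n) × (ℂ × ℝ) × ℝ => amplitude p x.1 x.2.1 x.2.2 := by
  have h1 := continuous_monoNorm p
  have h2 : Continuous fun x : EuclideanSpace ℂ (Fin n) × (ℂ × ℝ) × ℝ =>
      laguerreSum x.1 (4 * Real.pi * x.2.2 * x.2.1.2) :=
    continuous_laguerreSum.comp (f := fun x : EuclideanSpace ℂ (Fin n) × (ℂ × ℝ) × ℝ =>
      (x.1, 4 * Real.pi * x.2.2 * x.2.1.2)) (by fun_prop)
  unfold amplitude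
  fun_prop

/-- The exponential of `v + |z|²` splits, so each term is a function of `z` times a function of `v`:
a probability density in `z` and the spectral density at `x = 2πt`. This is where `γ^b(2πt)`
originates, independently of `p`. -/
theorem amplitude_mul_conj (p : ℕ) (a b : EuclideanSpace ℂ (Fin n)) (q : ℂ × ℝ) {t : ℝ}
    (ht : 0 < t) : amplitude p a q t * (starRingEnd ℂ) (amplitude p b q t) =
      ∑ j, ∑ k, a j * (starRingEnd ℂ) (b k) *
        ((monoDensity p t q.1 : ℂ) * (density j k (2 * Real.pi * t) q.2 : ℂ)) := by
  have hb : (4 * Real.pi * t : ℝ) ≠ 0 := by positivity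
  have h1 : ∀ j k : Fin n, ((monoDensity p t q.1 : ℂ) * (density j k (2 * Real.pi * t) q.2 : ℂ)) =
      (lagC j).eval ((4 * Real.pi * t * q.2 : ℝ) : ℂ) *
      (starRingEnd ℂ) ((lagC k).eval ((4 * Real.pi * t * q.2 : ℝ) : ℂ)) *
      ((monoNorm p t : ℂ) ^ 2 * (q.1 ^ p * (starRingEnd ℂ) (q.1 ^ p)) *
        ((Real.exp (-(2 * Real.pi * t * (q.2 + ‖q.1‖ ^ 2))) : ℝ) : ℂ) ^ 2) := by
    intro j k
    have e1 : 2 * (2 * Real.pi * t) * q.2 = 4 * Real.pi * t * q.2 := by ring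
    have e2 : (starRingEnd ℂ) ((lagC k).eval ((4 * Real.pi * t * q.2 : ℝ) : ℂ)) =
        (lagC k).eval ((4 * Real.pi * t * q.2 : ℝ) : ℂ) := by
      rw [eval_lagC, Complex.conj_ofReal]
    have e3 : q.1 ^ p * (starRingEnd ℂ) (q.1 ^ p) = ((‖q.1‖ ^ (2 * p) : ℝ) : ℂ) := by
      rw [Complex.mul_conj, Complex.normSq_eq_norm_sq, norm_pow, ← pow_mul, mul_comm p 2]
    have e4 : Real.exp (-(2 * Real.pi * t * (q.2 + ‖q.1‖ ^ 2))) ^ 2 =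
        Real.exp (-(4 * Real.pi * t * ‖q.1‖ ^ 2)) *
          (Real.exp (-(4 * Real.pi * t * q.2) / 2) * Real.exp (-(4 * Real.pi * t * q.2) / 2)) := by
      rw [← Real.exp_nat_mul, ← Real.exp_add, ← Real.exp_add]
      congr 1
      push_cast
      ring
    rw [e2, e3, ← Complex.ofReal_pow (Real.exp _), e4, density, e1, Complex.ofReal_mul (2 * _),
      Complex.ofReal_mul (laguerreFun _ _), laguerreFun_eq_lagC, laguerreFun_eq_lagC, monoDensity]
    have hpi := Real.pi_ne_zero
    push_cast
    have : (Real.pi : ℂ) ≠ 0 := by exact_mod_cast hpi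
    have : (t : ℂ) ≠ 0 := by exact_mod_cast ht.ne'
    field_simp
    ring
  simp only [h1, amplitude, laguerreSum, map_mul, map_sum, Complex.conj_ofReal, map_pow,
    Finset.mul_sum, Finset.sum_mul]
  rw [Finset.sum_comm]
  refine Finset.sum_congr rfl fun j _ => Finset.sum_congr rfl fun k _ => ?_
  ring

theorem integrable_amplitude_term (p : ℕ) {t : ℝ} (ht : 0 < t) (j k : ℕ) {β : ℝ → ℂ}
    (hβ : IntegrableOn (fun v => β v * (density j k (2 * Real.pi * t) v : ℂ)) (Ioi 0)) :
    Integrable (fun q : ℂ × ℝ => (monoDensity p t q.1 : ℂ) *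
      (β q.2 * (density j k (2 * Real.pi * t) q.2 : ℂ))) baseMeasure :=
  (integrable_monoDensity p ht).ofReal.mul_prod hβ

theorem integral_amplitude_term (p : ℕ) {t : ℝ} (ht : 0 < t) (j k : ℕ) (β : ℝ → ℂ) :
    ∫ q : ℂ × ℝ, (monoDensity p t q.1 : ℂ) *
      (β q.2 * (density j k (2 * Real.pi * t) q.2 : ℂ)) ∂baseMeasure =
      ∫ v in Ioi (0 : ℝ), β v * (density j k (2 * Real.pi * t) v : ℂ) := by
  rw [baseMeasure, integral_prod_mul (fun z => (monoDensity p t z : ℂ))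
    (fun v => β v * (density j k (2 * Real.pi * t) v : ℂ)), integral_complex_ofReal,
    integral_monoDensity p ht, Complex.ofReal_one, one_mul]

theorem integral_amplitude_mul_conj (p : ℕ) (a b : EuclideanSpace ℂ (Fin n)) {t : ℝ}
    (ht : 0 < t) {β : ℝ → ℂ} (hβ : ∀ j k : ℕ,
      IntegrableOn (fun v => β v * (density j k (2 * Real.pi * t) v : ℂ)) (Ioi 0)) :
    Integrable (fun q : ℂ × ℝ => β q.2 *
      (amplitude p a q t * (starRingEnd ℂ) (amplitude p b q t))) baseMeasure ∧
    ∫ q : ℂ × ℝ, β q.2 * (amplitude p a q t * (starRingEnd ℂ) (amplitude p b q t)) ∂baseMeasure =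
      ∑ j, ∑ k, a j * (starRingEnd ℂ) (b k) *
        ∫ v in Ioi (0 : ℝ), β v * (density j k (2 * Real.pi * t) v : ℂ) := by
  have e : ∀ q : ℂ × ℝ, β q.2 * (amplitude p a q t * (starRingEnd ℂ) (amplitude p b q t)) =
      ∑ j, ∑ k, a j * (starRingEnd ℂ) (b k) * ((monoDensity p t q.1 : ℂ) *
        (β q.2 * (density j k (2 * Real.pi * t) q.2 : ℂ))) := by
    intro q
    rw [amplitude_mul_conj p a b q ht]
    simp only [Finset.mul_sum]
    exact Finset.sum_congr rfl fun j _ => Finset.sum_congr rfl fun k _ => by ring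
  have hi : ∀ j k : Fin n, Integrable (fun q : ℂ × ℝ => a j * (starRingEnd ℂ) (b k) *
      ((monoDensity p t q.1 : ℂ) * (β q.2 * (density j k (2 * Real.pi * t) q.2 : ℂ))))
      baseMeasure := fun j k => (integrable_amplitude_term p ht j k (hβ j k)).const_mul _
  simp only [e]
  refine ⟨integrable_finsetSum _ fun j _ => integrable_finsetSum _ fun k _ => hi j k, ?_⟩
  rw [integral_finsetSum _ fun j _ => integrable_finsetSum _ fun k _ => hi j k]
  refine Finset.sum_congr rfl fun j _ => ?_
  rw [integral_finsetSum _ fun k _ => hi j k]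
  refine Finset.sum_congr rfl fun k _ => ?_
  rw [integral_const_mul, integral_amplitude_term p ht]

/-- The case `β = 1` of the previous computation, together with orthonormality of the Laguerre
functions. -/
theorem lintegral_amplitude (p : ℕ) (a : EuclideanSpace ℂ (Fin n)) {t : ℝ} (ht : 0 < t) :
    ∫⁻ q, ‖amplitude p a q t‖ₑ ^ 2 ∂baseMeasure = ‖a‖ₑ ^ 2 := by
  have hx : 0 < 2 * Real.pi * t := by positivity
  obtain ⟨h1, h2⟩ := integral_amplitude_mul_conj p a a ht (β := fun _ => 1) fun j k => by
    simpa [IntegrableOn] using (Integrable.ofReal (𝕜 := ℂ) (integrableOn_density j k hx))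
  have e : ∀ w : ℂ, w * (starRingEnd ℂ) w = ((‖w‖ ^ 2 : ℝ) : ℂ) := fun w => by
    rw [Complex.mul_conj, Complex.normSq_eq_norm_sq]
  simp only [one_mul, e] at h1 h2
  rw [integral_complex_ofReal] at h2
  have h3 : ∫ q, ‖amplitude p a q t‖ ^ 2 ∂baseMeasure = ‖a‖ ^ 2 := by
    have : ((∫ q, ‖amplitude p a q t‖ ^ 2 ∂baseMeasure : ℝ) : ℂ) = ((‖a‖ ^ 2 : ℝ) : ℂ) := by
      rw [h2, EuclideanSpace.norm_sq_eq]
      push_cast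
      refine Finset.sum_congr rfl fun j _ => ?_
      have h4 : ∀ k : Fin n, ∫ v in Ioi (0 : ℝ), ((density j k (2 * Real.pi * t) v : ℝ) : ℂ) =
          if j = k then 1 else 0 := by
        intro k
        rw [integral_complex_ofReal, integral_density _ _ hx]
        simp only [Fin.val_inj]
        split_ifs <;> simp
      simp only [h4, mul_ite, mul_one, mul_zero, Finset.sum_ite_eq, Finset.mem_univ, if_true, e]
      push_cast
      rfl
    exact_mod_cast this
  have h5 : Integrable (fun q => ‖amplitude p a q t‖ ^ 2) baseMeasure := by
    exact h1.re.congr (Eventually.of_forall fun q => Complex.ofReal_re _)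
  have h6 := ofReal_integral_eq_lintegral_ofReal h5 (Eventually.of_forall fun q => sq_nonneg _)
  rw [h3] at h6
  simpa only [ENNReal.ofReal_pow (norm_nonneg _), ofReal_norm] using h6.symm

/-- The partial Fourier transform of the wave of degree `p` with coefficients `ψ`. -/
def waveAmp (p : ℕ) (ψ : ℝ → EuclideanSpace ℂ (Fin n)) (q : ℂ × ℝ) : ℝ → ℂ :=
  (Ioi 0).indicator fun t => amplitude p (ψ t) q t

/-- The poly-analytic function of degree `p` in `ζ₁` with coefficients `ψ`. -/
def monoWave (p : ℕ) (ψ : ℝ → EuclideanSpace ℂ (Fin n)) : ℂ × ℂ → ℂ :=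
  wave (volume.restrict (Ioi (0 : ℝ))) (monoNorm p) (fun _ => p) (fun t => t) ψ

theorem stronglyMeasurable_waveAmp (p : ℕ) {ψ : ℝ → EuclideanSpace ℂ (Fin n)}
    (hψ : StronglyMeasurable ψ) : StronglyMeasurable (Function.uncurry (waveAmp p ψ)) := by
  have h1 : StronglyMeasurable fun x : (ℂ × ℝ) × ℝ => amplitude p (ψ x.2) x.1 x.2 := by
    refine (continuous_amplitude p).comp_stronglyMeasurable
      (g := fun y : EuclideanSpace ℂ (Fin n) × (ℂ × ℝ) × ℝ => amplitude p y.1 y.2.1 y.2.2)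
      (f := fun x : (ℂ × ℝ) × ℝ => (ψ x.2, x)) ?_
    exact (hψ.comp_measurable measurable_snd).prodMk stronglyMeasurable_id
  exact h1.indicator (measurable_snd measurableSet_Ioi)

theorem lintegral_waveAmp (p : ℕ) {ψ : ℝ → EuclideanSpace ℂ (Fin n)} (hψ : StronglyMeasurable ψ) :
    ∫⁻ q, (∫⁻ t, ‖waveAmp p ψ q t‖ₑ ^ 2) ∂baseMeasure = ∫⁻ t in Ioi 0, ‖ψ t‖ₑ ^ 2 := by
  rw [lintegral_lintegral_swap
    ((stronglyMeasurable_waveAmp p hψ).enorm.pow_const 2).aemeasurable,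
    ← lintegral_indicator measurableSet_Ioi]
  refine lintegral_congr fun t => ?_
  by_cases ht : 0 < t
  · simp only [waveAmp, indicator_of_mem (mem_Ioi.2 ht), lintegral_amplitude p (ψ t) ht]
  · simp [waveAmp, indicator_of_notMem (notMem_Ioi.2 (not_lt.1 ht))]

theorem lintegral_enorm_sq_lt_top {Y E : Type*} [MeasurableSpace Y] [NormedAddCommGroup E]
    {μ : Measure Y} {f : Y → E} (hf : MemLp f 2 μ) : ∫⁻ y, ‖f y‖ₑ ^ 2 ∂μ < ⊤ := by
  have := lintegral_rpow_enorm_lt_top_of_eLpNorm_lt_top two_ne_zero (by simp) hf.2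
  simpa using this

theorem memLp_two_of_lintegral {Y E : Type*} [MeasurableSpace Y] [NormedAddCommGroup E]
    {μ : Measure Y} {f : Y → E} (hf : AEStronglyMeasurable f μ)
    (h : ∫⁻ y, ‖f y‖ₑ ^ 2 ∂μ < ⊤) : MemLp f 2 μ := by
  refine ⟨hf, ?_⟩
  rw [eLpNorm_lt_top_iff_lintegral_rpow_enorm_lt_top two_ne_zero (by simp)]
  simpa using h

theorem eLpNorm_two_sq {Y E : Type*} [MeasurableSpace Y] [NormedAddCommGroup E]
    (μ : Measure Y) (f : Y → E) : eLpNorm f 2 μ ^ 2 = ∫⁻ y, ‖f y‖ₑ ^ 2 ∂μ := by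
  rw [eLpNorm_eq_lintegral_rpow_enorm_toReal two_ne_zero (by simp)]
  simp only [ENNReal.toReal_ofNat]
  rw [← ENNReal.rpow_natCast, ← ENNReal.rpow_mul]
  norm_num

/-- On the slice `(z, v)` one has `e^{2πitζ₂} = e^{-2πt(v + |z|²)} e^{2πitu}`, so the wave is an
inverse Fourier transform in `u`. -/
theorem monoWave_siegelCoord (p : ℕ) (ψ : ℝ → EuclideanSpace ℂ (Fin n)) (x : (ℂ × ℝ) × ℝ) :
    monoWave p ψ (siegelCoord x) = 𝓕⁻ (waveAmp p ψ x.1) x.2 := by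
  rw [fourierInv_eq_integral_exp, monoWave, wave, ← integral_indicator measurableSet_Ioi]
  refine integral_congr_ae (Eventually.of_forall fun t => ?_)
  by_cases ht : t ∈ Ioi (0 : ℝ)
  · simp only [waveAmp, indicator_of_mem ht, amplitude, siegelCoord_fst, height_siegelCoord,
      siegelCoord_snd]
    have : Complex.exp (2 * Real.pi * Complex.I * t *
        (x.2 + (x.1.2 + ‖x.1.1‖ ^ 2 : ℝ) * Complex.I)) =
        (Real.exp (-(2 * Real.pi * t * (x.1.2 + ‖x.1.1‖ ^ 2))) : ℝ) *
          Complex.exp (2 * Real.pi * Complex.I * t * x.2) := by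
      rw [Complex.ofReal_exp, ← Complex.exp_add]
      congr 1
      push_cast
      linear_combination (2 * Real.pi * t * (x.1.2 + ‖x.1.1‖ ^ 2) : ℂ) * Complex.I_mul_I
    rw [this]
    ring
  · simp only [waveAmp, indicator_of_notMem ht, zero_mul]

theorem integrable_waveAmp (p : ℕ) {ψ : ℝ → EuclideanSpace ℂ (Fin n)}
    (hψ : MemLp ψ 2 (volume.restrict (Ioi 0))) {q : ℂ × ℝ} (hq : 0 < q.2) :
    Integrable (waveAmp p ψ q) := by
  -- At `u = 0` the oscillating factor is `1` and the integrand is the amplitude.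
  have h := (isWaveKernel_mono p).integrable hψ (ζ := siegelCoord (q, 0)) (siegelCoord_mem.2 hq)
  rw [waveAmp, integrable_indicator_iff measurableSet_Ioi]
  refine h.congr (Eventually.of_forall fun t => ?_)
  simp only [amplitude, height_siegelCoord, siegelCoord_fst]
  congr 1
  rw [siegelCoord_snd, Complex.ofReal_exp]
  congr 1
  push_cast
  linear_combination (2 * Real.pi * t * (q.2 + ‖q.1‖ ^ 2) : ℂ) * Complex.I_mul_I

/-- Integrability holds on every slice with `v > 0`. Square-integrability holds only on almost every
slice, since it comes from Tonelli and a finite total integral. -/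
theorem ae_waveAmp (p : ℕ) {ψ : ℝ → EuclideanSpace ℂ (Fin n)} (hm : StronglyMeasurable ψ)
    (hψ : MemLp ψ 2 (volume.restrict (Ioi 0))) :
    ∀ᵐ q ∂baseMeasure, Integrable (waveAmp p ψ q) ∧ MemLp (waveAmp p ψ q) 2 := by
  have h1 : ∫⁻ q, (∫⁻ t, ‖waveAmp p ψ q t‖ₑ ^ 2) ∂baseMeasure < ⊤ := by
    rw [lintegral_waveAmp p hm]
    exact lintegral_enorm_sq_lt_top hψ
  have h2 : Measurable fun q => ∫⁻ t, ‖waveAmp p ψ q t‖ₑ ^ 2 :=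
    ((stronglyMeasurable_waveAmp p hm).enorm.pow_const 2).lintegral_prod_right'
  filter_upwards [ae_lt_top h2 h1.ne, ae_baseMeasure] with q hq hq'
  have h3 := integrable_waveAmp p hψ hq'
  exact ⟨h3, memLp_two_of_lintegral h3.1 hq⟩

theorem aestronglyMeasurable_of_isPolyAnalytic {f : ℂ × ℂ → ℂ} (hf : IsPolyAnalytic 1 n f) :
    AEStronglyMeasurable f siegelMeasure :=
  hf.1.continuousOn.aestronglyMeasurable isOpen_siegel.measurableSet

/-- Plancherel on each slice reduces the norm to that of the amplitudes; integrating those over `(z,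
v)` first leaves `|ψ(t)|²`. -/
theorem lintegral_monoWave (p : ℕ) {ψ : ℝ → EuclideanSpace ℂ (Fin n)} (hm : StronglyMeasurable ψ)
    (hψ : MemLp ψ 2 (volume.restrict (Ioi 0))) :
    ∫⁻ ζ, ‖monoWave p ψ ζ‖ₑ ^ 2 ∂siegelMeasure = ∫⁻ t in Ioi 0, ‖ψ t‖ₑ ^ 2 := by
  rw [← measurePreserving_siegelCoord.lintegral_comp_emb measurableEmbedding_siegelCoord]
  simp only [monoWave_siegelCoord]
  rw [lintegral_fiberwise_fourierInv (stronglyMeasurable_waveAmp p hm) (ae_waveAmp p hm hψ),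
    lintegral_waveAmp p hm]

theorem isPolyAnalytic_monoWave (p : ℕ) {ψ : ℝ → EuclideanSpace ℂ (Fin n)}
    (hψ : MemLp ψ 2 (volume.restrict (Ioi 0))) : IsPolyAnalytic 1 n (monoWave p ψ) :=
  (isWaveKernel_mono p).isPolyAnalytic hψ

theorem memLp_monoWave (p : ℕ) {ψ : ℝ → EuclideanSpace ℂ (Fin n)} (hm : StronglyMeasurable ψ)
    (hψ : MemLp ψ 2 (volume.restrict (Ioi 0))) : MemLp (monoWave p ψ) 2 siegelMeasure := by
  refine memLp_two_of_lintegral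
    (aestronglyMeasurable_of_isPolyAnalytic (isPolyAnalytic_monoWave p hψ)) ?_
  rw [lintegral_monoWave p hm hψ]
  exact lintegral_enorm_sq_lt_top hψ

theorem memLp_waveAmp (p : ℕ) {ψ : ℝ → EuclideanSpace ℂ (Fin n)} (hm : StronglyMeasurable ψ)
    (hψ : MemLp ψ 2 (volume.restrict (Ioi 0))) :
    MemLp (Function.uncurry (waveAmp p ψ)) 2 (baseMeasure.prod volume) := by
  refine memLp_two_of_lintegral (stronglyMeasurable_waveAmp p hm).aestronglyMeasurable ?_
  rw [lintegral_prod _ ((stronglyMeasurable_waveAmp p hm).enorm.pow_const 2).aemeasurable]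
  exact (lintegral_waveAmp p hm).trans_lt (lintegral_enorm_sq_lt_top hψ)

theorem memLp_fourierInv_waveAmp (p : ℕ) {ψ : ℝ → EuclideanSpace ℂ (Fin n)}
    (hm : StronglyMeasurable ψ) (hψ : MemLp ψ 2 (volume.restrict (Ioi 0))) :
    MemLp (fun x : (ℂ × ℝ) × ℝ => 𝓕⁻ (waveAmp p ψ x.1) x.2) 2 (baseMeasure.prod volume) := by
  have h := (memLp_monoWave p hm hψ).comp_measurePreserving measurePreserving_siegelCoord
  exact h.congr_norm (stronglyMeasurable_fiberwise_fourierInv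
    (stronglyMeasurable_waveAmp p hm)).aestronglyMeasurable
    (Eventually.of_forall fun x => by simp only [Function.comp_apply, monoWave_siegelCoord])

/-- The matrix coefficients of the multiplication by a function of the height between waves of the
same degree. -/
theorem integral_lift_mul_monoWave (p : ℕ) (b : BSymbol) {ψ φ : ℝ → EuclideanSpace ℂ (Fin n)}
    (hm : StronglyMeasurable ψ) (hψ : MemLp ψ 2 (volume.restrict (Ioi 0)))
    (hm' : StronglyMeasurable φ) (hφ : MemLp φ 2 (volume.restrict (Ioi 0))) :
    ∫ ζ, b.lift ζ * (monoWave p ψ ζ * (starRingEnd ℂ) (monoWave p φ ζ)) ∂siegelMeasure =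
      ∫ t in Ioi 0, ∑ j, ∑ k, ψ t j * (starRingEnd ℂ) (φ t k) *
        spectralMatrix n b (2 * Real.pi * t) j k := by
  obtain ⟨C, -, hC⟩ := b.exists_bound
  have hβ : AEStronglyMeasurable (fun q : ℂ × ℝ => b.toFun q.2) baseMeasure :=
    b.memLp.1.comp_quasiMeasurePreserving Measure.quasiMeasurePreserving_snd
  have hC' : ∀ᵐ q : ℂ × ℝ ∂baseMeasure, ‖b.toFun q.2‖ ≤ C :=
    Measure.quasiMeasurePreserving_snd.ae hC
  rw [← measurePreserving_siegelCoord.integral_comp measurableEmbedding_siegelCoord]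
  simp only [monoWave_siegelCoord, BSymbol.lift, height_siegelCoord]
  rw [integral_fiberwise_fourierInv (β := fun q : ℂ × ℝ => b.toFun q.2) hβ hC'
    (ae_waveAmp p hm hψ) (ae_waveAmp p hm' hφ)
    (memLp_fourierInv_waveAmp p hm hψ) (memLp_fourierInv_waveAmp p hm' hφ)]
  simp only [← integral_const_mul]
  have hi : Integrable (fun x : (ℂ × ℝ) × ℝ => b.toFun x.1.2 * (waveAmp p ψ x.1 x.2 *
      (starRingEnd ℂ) (waveAmp p φ x.1 x.2))) (baseMeasure.prod volume) :=
    ((memLp_waveAmp p hm hψ).integrable_mul (memLp_waveAmp p hm' hφ).star).bdd_mul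
      (hβ.comp_quasiMeasurePreserving Measure.quasiMeasurePreserving_fst)
      (Measure.quasiMeasurePreserving_fst.ae hC')
  rw [integral_integral_swap hi, ← integral_indicator measurableSet_Ioi]
  refine integral_congr_ae (Eventually.of_forall fun t => ?_)
  by_cases ht : 0 < t
  · simp only [waveAmp, indicator_of_mem (mem_Ioi.2 ht)]
    have hx : 0 < 2 * Real.pi * t := by positivity
    rw [(integral_amplitude_mul_conj p (ψ t) (φ t) ht fun j k =>
      integrableOn_mul_density b j k hx).2]
    simp only [spectralMatrix_eq_density b hx]
  · simp [waveAmp, indicator_of_notMem (notMem_Ioi.2 (not_lt.1 ht))]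

end Amplitude

/-! ### The isometries and the matrix coefficients of multiplication. -/

section WaveOperators

open scoped InnerProductSpace

variable {n : ℕ}

theorem laguerreSum_add (a b : EuclideanSpace ℂ (Fin n)) (y : ℝ) :
    laguerreSum (a + b) y = laguerreSum a y + laguerreSum b y := by
  simp [laguerreSum, add_mul, Finset.sum_add_distrib]

theorem laguerreSum_smul (c : ℂ) (a : EuclideanSpace ℂ (Fin n)) (y : ℝ) :
    laguerreSum (c • a) y = c * laguerreSum a y := by
  simp [laguerreSum, Finset.mul_sum, mul_assoc]

theorem wave_congr_ae {Y : Type*} [MeasurableSpace Y] {μ : Measure Y} (κ : Y → ℝ) (N : Y → ℕ)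
    (s : Y → ℝ) {Ψ Φ : Y → EuclideanSpace ℂ (Fin n)} (h : Ψ =ᵐ[μ] Φ) (ζ : ℂ × ℂ) :
    wave μ κ N s Ψ ζ = wave μ κ N s Φ ζ := by
  refine integral_congr_ae ?_
  filter_upwards [h] with y hy
  rw [hy]

theorem IsWaveKernel.wave_add {Y : Type*} [MeasurableSpace Y] {μ : Measure Y} {κ : Y → ℝ}
    {N : Y → ℕ} {s : Y → ℝ} (h : IsWaveKernel μ κ N s) {Ψ Φ : Y → EuclideanSpace ℂ (Fin n)}
    (hΨ : MemLp Ψ 2 μ) (hΦ : MemLp Φ 2 μ) {ζ : ℂ × ℂ} (hζ : ζ ∈ siegel) :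
    wave μ κ N s (Ψ + Φ) ζ = wave μ κ N s Ψ ζ + wave μ κ N s Φ ζ := by
  unfold wave
  rw [← integral_add (h.integrable hΨ hζ) (h.integrable hΦ hζ)]
  refine integral_congr_ae (Eventually.of_forall fun y => ?_)
  simp only [Pi.add_apply, laguerreSum_add]
  ring

theorem wave_smul {Y : Type*} [MeasurableSpace Y] (μ : Measure Y) (κ : Y → ℝ)
    (N : Y → ℕ) (s : Y → ℝ) (c : ℂ) (Ψ : Y → EuclideanSpace ℂ (Fin n)) (ζ : ℂ × ℂ) :
    wave μ κ N s (c • Ψ) ζ = c * wave μ κ N s Ψ ζ := by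
  unfold wave
  rw [← integral_const_mul]
  refine integral_congr_ae (Eventually.of_forall fun y => ?_)
  simp only [Pi.smul_apply, laguerreSum_smul]
  ring

theorem ae_mem_siegel : ∀ᵐ ζ ∂siegelMeasure, ζ ∈ siegel :=
  ae_restrict_mem isOpen_siegel.measurableSet

/-- The isometric operator `ψ ↦ monoWave p ψ` from `L²(ℝ₊; ℂⁿ)` to `L²(D₂)`. -/
def waveOp (n p : ℕ) : L2Freq n →ₗᵢ[ℂ] L2Siegel where
  toFun ψ := (memLp_monoWave p (Lp.stronglyMeasurable ψ) (Lp.memLp ψ)).toLp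
  map_add' ψ φ := by
    rw [← MemLp.toLp_add]
    refine MemLp.toLp_congr _ _ ?_
    filter_upwards [ae_mem_siegel] with ζ hζ
    rw [monoWave, wave_congr_ae _ _ _ (Lp.coeFn_add ψ φ),
      (isWaveKernel_mono p).wave_add (Lp.memLp ψ) (Lp.memLp φ) hζ]
    rfl
  map_smul' c ψ := by
    rw [RingHom.id_apply, ← MemLp.toLp_const_smul]
    refine MemLp.toLp_congr _ _ (Eventually.of_forall fun ζ => ?_)
    rw [monoWave, wave_congr_ae _ _ _ (Lp.coeFn_smul c ψ), wave_smul]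
    rfl
  norm_map' ψ := by
    change ‖(memLp_monoWave p (Lp.stronglyMeasurable ψ) (Lp.memLp ψ)).toLp‖ = ‖ψ‖
    rw [Lp.norm_toLp, Lp.norm_def]
    congr 1
    have h := lintegral_monoWave p (Lp.stronglyMeasurable ψ) (Lp.memLp ψ)
    rw [← eLpNorm_two_sq, ← eLpNorm_two_sq] at h
    exact (ENNReal.pow_right_strictMono two_ne_zero).injective h

theorem coeFn_waveOp (p : ℕ) (ψ : L2Freq n) : waveOp n p ψ =ᵐ[siegelMeasure] monoWave p ψ :=
  (memLp_monoWave p (Lp.stronglyMeasurable ψ) (Lp.memLp ψ)).coeFn_toLp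

theorem coeFn_mulOp (b : BSymbol) (f : L2Siegel) :
    mulOp b f =ᵐ[siegelMeasure] fun ζ => b.lift ζ * f ζ := by
  refine (ContinuousLinearMap.coeFn_holder _ _ _).trans ?_
  filter_upwards [b.memLp_lift.coeFn_toLp] with ζ hζ
  rw [hζ]
  rfl

theorem inner_waveOp_mulOp (b : BSymbol) (p q : ℕ) (φ ψ : L2Freq n) :
    ⟪waveOp n p φ, mulOp b (waveOp n q ψ)⟫_ℂ =
      ∫ ζ, b.lift ζ * (monoWave q ψ ζ * (starRingEnd ℂ) (monoWave p φ ζ)) ∂siegelMeasure := by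
  rw [L2.inner_def]
  refine integral_congr_ae ?_
  filter_upwards [coeFn_waveOp p φ, coeFn_mulOp b (waveOp n q ψ), coeFn_waveOp q ψ] with ζ h1 h2 h3
  rw [h1, h2, h3, RCLike.inner_apply]
  ring

theorem spectralMatrix_symm (b : BSymbol) (x : ℝ) (j k : Fin n) :
    spectralMatrix n b x j k = spectralMatrix n b x k j := by
  simp only [spectralMatrix, Matrix.of_apply, mul_comm (laguerreFun j _)]

theorem inner_waveOp_mulOp_self {b : BSymbol} {M : MatFun n} (hM : IsSpectralFun n b M) (p : ℕ)
    (φ ψ : L2Freq n) :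
    ⟪waveOp n p φ, mulOp b (waveOp n p ψ)⟫_ℂ = ⟪φ, freqRep n M ψ⟫_ℂ := by
  rw [inner_waveOp_mulOp, integral_lift_mul_monoWave p b (Lp.stronglyMeasurable ψ) (Lp.memLp ψ)
    (Lp.stronglyMeasurable φ) (Lp.memLp φ), L2.inner_def]
  refine integral_congr_ae ?_
  filter_upwards [coeFn_freqMul M ψ, ae_restrict_mem measurableSet_Ioi] with t h1 (ht : 0 < t)
  rw [freqRep_apply, h1, freqSymbol, hM _ (by positivity), PiLp.inner_apply, Finset.sum_comm]
  refine Finset.sum_congr rfl fun k _ => ?_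
  rw [RCLike.inner_apply, Matrix.ofLp_toEuclideanCLM, Matrix.mulVec, dotProduct, Finset.sum_mul]
  refine Finset.sum_congr rfl fun j _ => ?_
  -- The two computations produce `γ^b` with exchanged indices; `γ^b` is symmetric.
  rw [spectralMatrix_symm b _ j k]
  ring

/-- The rotation of the first coordinate. -/
def rotateFst (c : Circle) : ℂ × ℂ ≃ₜ ℂ × ℂ :=
  (rotation c).toHomeomorph.prodCongr (Homeomorph.refl ℂ)

theorem rotateFst_apply (c : Circle) (ζ : ℂ × ℂ) : rotateFst c ζ = (c * ζ.1, ζ.2) := rfl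

theorem height_rotateFst (c : Circle) (ζ : ℂ × ℂ) : height (rotateFst c ζ) = height ζ := by
  simp only [height, rotateFst_apply, norm_mul, Circle.norm_coe, one_mul]

theorem measurePreserving_rotateFst (c : Circle) :
    MeasurePreserving (rotateFst c) siegelMeasure siegelMeasure := by
  have h : MeasurePreserving (rotateFst c) (volume : Measure (ℂ × ℂ)) volume :=
    ((rotation c).measurePreserving).prod (MeasurePreserving.id (volume : Measure ℂ))
  have h1 := h.restrict_preimage isOpen_siegel.measurableSet
  have h2 : rotateFst c ⁻¹' siegel = siegel := by
    ext ζ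
    change 0 < height (rotateFst c ζ) ↔ 0 < height ζ
    rw [height_rotateFst]
  rwa [h2] at h1

theorem monoWave_rotateFst (p : ℕ) (ψ : ℝ → EuclideanSpace ℂ (Fin n)) (c : Circle) (ζ : ℂ × ℂ) :
    monoWave p ψ (rotateFst c ζ) = (c : ℂ) ^ p * monoWave p ψ ζ := by
  unfold monoWave wave
  rw [← integral_const_mul]
  refine integral_congr_ae (Eventually.of_forall fun t => ?_)
  rw [height_rotateFst]
  simp only [rotateFst_apply, mul_pow]
  ring

theorem exists_circle_pow {p q : ℕ} (h : p ≠ q) :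
    ∃ c : Circle, (c : ℂ) ^ q * (starRingEnd ℂ) ((c : ℂ) ^ p) = -1 := by
  have h0 : (q : ℂ) - p ≠ 0 := sub_ne_zero.2 (by exact_mod_cast h.symm)
  refine ⟨Circle.exp (Real.pi / (q - p)), ?_⟩
  rw [← Complex.exp_pi_mul_I, Circle.coe_exp, ← Complex.exp_nat_mul, ← Complex.exp_nat_mul,
    ← Complex.exp_conj, ← Complex.exp_add]
  congr 1
  simp only [map_mul, map_natCast, Complex.conj_ofReal, Complex.conj_I]
  push_cast
  field_simp
  ring

/-- Measure and height are invariant under rotation of `ζ₁`, while the integrand acquires the factor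
`c^q · conj (c^p)`. For a suitable `c` this is `-1`, so the integral equals its own negative. -/
theorem inner_waveOp_mulOp_of_ne (b : BSymbol) {p q : ℕ} (h : p ≠ q) (φ ψ : L2Freq n) :
    ⟪waveOp n p φ, mulOp b (waveOp n q ψ)⟫_ℂ = 0 := by
  obtain ⟨c, hc⟩ := exists_circle_pow h
  rw [inner_waveOp_mulOp]
  set I := ∫ ζ, b.lift ζ * (monoWave q ψ ζ * (starRingEnd ℂ) (monoWave p φ ζ)) ∂siegelMeasure
    with hI
  have h1 : I = -I := by
    conv_lhs => rw [hI, ← (measurePreserving_rotateFst c).integral_comp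
      (rotateFst c).measurableEmbedding]
    rw [hI, ← integral_neg]
    refine integral_congr_ae (Eventually.of_forall fun ζ => ?_)
    simp only [monoWave_rotateFst, BSymbol.lift, height_rotateFst, map_mul]
    linear_combination (b.toFun (height ζ) * monoWave q ψ ζ * (starRingEnd ℂ) (monoWave p φ ζ)) * hc
  exact self_eq_neg.1 h1

/-- The constant symbol `1`. -/
def oneSymbol : BSymbol where
  toFun _ := 1
  memLp := memLp_top_const 1
  lim_zero := ⟨1, tendsto_const_nhds⟩
  lim_top := ⟨1, tendsto_const_nhds⟩

theorem mulOp_oneSymbol (f : L2Siegel) : mulOp oneSymbol f = f := by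
  refine Lp.ext ?_
  filter_upwards [coeFn_mulOp oneSymbol f] with ζ hζ
  rw [hζ]
  exact one_mul _

theorem orthogonalFamily_waveOp (n : ℕ) :
    OrthogonalFamily ℂ (fun _ : ℕ => L2Freq n) (waveOp n) := by
  intro p q h φ ψ
  have := inner_waveOp_mulOp_of_ne oneSymbol h φ ψ
  rwa [mulOp_oneSymbol] at this

theorem waveOp_mem_polyBergman (p : ℕ) (ψ : L2Freq n) : waveOp n p ψ ∈ polyBergman 1 n :=
  ⟨monoWave p ψ, isPolyAnalytic_monoWave p (Lp.memLp ψ), coeFn_waveOp p ψ⟩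

end WaveOperators

/-! ### The Hilbert sum of the wave ranges consists of poly-analytic functions. -/

section WaveSpace

variable {n : ℕ}

/-- The Hilbert sum of the ranges of the operators `waveOp n p`. -/
def waveSpace (n : ℕ) : Submodule ℂ L2Siegel :=
  LinearMap.range (orthogonalFamily_waveOp n).linearIsometry.toLinearMap

theorem isClosed_waveSpace (n : ℕ) : IsClosed (waveSpace n : Set L2Siegel) := by
  have h : (waveSpace n : Set L2Siegel) = range (orthogonalFamily_waveOp n).linearIsometry := by
    ext f
    simp [waveSpace]
  rw [h]
  exact (orthogonalFamily_waveOp n).linearIsometry.isometry.isClosedEmbedding.isClosed_range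

theorem waveOp_mem_waveSpace (p : ℕ) (ψ : L2Freq n) : waveOp n p ψ ∈ waveSpace n :=
  ⟨lp.single 2 p ψ, (orthogonalFamily_waveOp n).linearIsometry_apply_single ψ⟩

theorem memLp_uncurry_lp (ψ : lp (fun _ : ℕ => L2Freq n) 2) :
    MemLp (fun y : ℕ × ℝ => ψ y.1 y.2) 2 freqMeasure := by
  have hm : Measurable fun y : ℕ × ℝ => ψ y.1 y.2 :=
    measurable_from_prod_countable_right fun p => (Lp.stronglyMeasurable (ψ p)).measurable
  refine memLp_two_of_lintegral hm.aestronglyMeasurable ?_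
  rw [freqMeasure, lintegral_prod _ (hm.enorm.pow_const 2).aemeasurable, lintegral_count]
  have h1 : ∀ p, ∫⁻ t in Ioi 0, ‖ψ p t‖ₑ ^ 2 = ENNReal.ofReal (‖ψ p‖ ^ 2) := by
    intro p
    rw [← eLpNorm_two_sq, ENNReal.ofReal_pow (norm_nonneg _), ofReal_norm, Lp.enorm_def]
  simp only [h1]
  have h2 : Summable fun p => ‖ψ p‖ ^ 2 := by
    have := (lp.memℓp ψ).summable (by simp)
    simpa using this
  exact h2.tsum_ofReal_lt_top

/-- Fubini for the counting measure times Lebesgue measure: the sum over degrees converges pointwise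
to a single wave over `ℕ × ℝ`. -/
theorem hasSum_monoWave (ψ : lp (fun _ : ℕ => L2Freq n) 2) {ζ : ℂ × ℂ} (hζ : ζ ∈ siegel) :
    HasSum (fun p => monoWave p (ψ p) ζ) (wave freqMeasure (fun y => monoNorm y.1 y.2)
      Prod.fst Prod.snd (fun y : ℕ × ℝ => ψ y.1 y.2) ζ) := by
  have hi := isWaveKernel_freq.integrable (memLp_uncurry_lp ψ) hζ
  have h1 : Integrable (fun p => monoWave p (ψ p) ζ) Measure.count := hi.integral_prod_left
  have h2 : wave freqMeasure (fun y => monoNorm y.1 y.2) Prod.fst Prod.snd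
      (fun y : ℕ × ℝ => ψ y.1 y.2) ζ = ∑' p, monoWave p (ψ p) ζ := by
    have h3 : ∫ p, monoWave p (ψ p) ζ ∂Measure.count = ∑' p, monoWave p (ψ p) ζ := by
      rw [integral_countable h1]
      simp [Measure.real]
    rw [← h3]
    exact integral_prod _ hi
  rw [h2]
  exact (integrable_count_iff.1 h1).of_norm.hasSum

/-- An `L²` limit must be identified with a smooth representative. A subsequence of the partial sums
converges almost everywhere, and the pointwise limit is the wave over `ℕ × ℝ`, which is
poly-analytic. -/
theorem waveSpace_le_polyBergman : waveSpace n ≤ polyBergman 1 n := by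
  rintro f ⟨ψ, rfl⟩
  refine ⟨_, isWaveKernel_freq.isPolyAnalytic (memLp_uncurry_lp ψ), ?_⟩
  have h1 := ((orthogonalFamily_waveOp n).hasSum_linearIsometry ψ).tendsto_sum_nat
  obtain ⟨ns, hns, h2⟩ := (tendstoInMeasure_of_tendsto_Lp h1).exists_seq_tendsto_ae
  have h3 : ∀ᵐ ζ ∂siegelMeasure, ∀ N : ℕ, (∑ p ∈ Finset.range N, waveOp n p (ψ p) : L2Siegel) ζ =
      ∑ p ∈ Finset.range N, monoWave p (ψ p) ζ := by
    rw [ae_all_iff]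
    intro N
    have h4 : ∀ᵐ ζ ∂siegelMeasure, ∀ p, waveOp n p (ψ p) ζ = monoWave p (ψ p) ζ :=
      ae_all_iff.2 fun p => coeFn_waveOp p (ψ p)
    filter_upwards [Lp.coeFn_finsetSum (Finset.range N) fun p => waveOp n p (ψ p), h4]
      with ζ h5 h6
    rw [h5]
    simp [h6]
  filter_upwards [h2, h3, ae_mem_siegel] with ζ h5 h6 hζ
  simp only [h6] at h5
  exact tendsto_nhds_unique h5 ((hasSum_monoWave ψ hζ).tendsto_sum_nat.comp hns.tendsto_atTop)

end WaveSpace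

/-! ### Contour shift in a strip for square-integrable holomorphic functions. -/

section ContourShift

theorem sq_lintegral_le {Y : Type*} [MeasurableSpace Y] (μ : Measure Y) {f : Y → ℝ≥0∞}
    (hf : AEMeasurable f μ) : (∫⁻ y, f y ∂μ) ^ 2 ≤ μ univ * ∫⁻ y, f y ^ 2 ∂μ := by
  have h := ENNReal.lintegral_mul_le_Lp_mul_Lq μ Real.HolderConjugate.two_two hf
    (aemeasurable_const (b := (1 : ℝ≥0∞)))
  simp only [Pi.mul_apply, mul_one, lintegral_const, ENNReal.rpow_two, one_pow, one_mul] at h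
  calc (∫⁻ y, f y ∂μ) ^ 2 ≤ ((∫⁻ y, f y ^ 2 ∂μ) ^ (1 / 2 : ℝ) * μ univ ^ (1 / 2 : ℝ)) ^ 2 := by
        gcongr
    _ = _ := by
      rw [mul_pow, ← ENNReal.rpow_natCast, ← ENNReal.rpow_natCast, ← ENNReal.rpow_mul,
        ← ENNReal.rpow_mul]
      norm_num
      rw [mul_comm]

theorem frequently_lt_of_lintegral_lt_top {T : ℝ → ℝ≥0∞} (hT : ∫⁻ x, T x < ⊤) {ε : ℝ≥0∞}
    (hε : 0 < ε) : ∃ᶠ x in atTop, T x < ε := by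
  rw [Filter.Frequently]
  intro h
  obtain ⟨N, hN⟩ := eventually_atTop.1 h
  have h1 : ∫⁻ _ in Ici N, ε ≤ ∫⁻ x, T x :=
    (setLIntegral_mono' measurableSet_Ici fun x hx => not_lt.1 (hN x hx)).trans
      (setLIntegral_le_lintegral _ _)
  rw [setLIntegral_const, Real.volume_Ici, ENNReal.mul_top hε.ne'] at h1
  exact absurd hT (not_lt.2 h1)

/-- The upper half-plane. -/
def upperHalf : Set ℂ := {w | 0 < w.im}

theorem isOpen_upperHalf : IsOpen upperHalf := isOpen_lt continuous_const Complex.continuous_im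

variable {a E : ℂ → ℂ} {τ τ' C : ℝ}

theorem measurable_line {a : ℂ → ℂ} (ham : Measurable a) :
    Measurable fun y : ℝ × ℝ => a (y.1 + y.2 * Complex.I) :=
  ham.comp (by fun_prop)

theorem enorm_side_sq_le (ham : Measurable a) (hτ : τ ≤ τ')
    (hE : ∀ w : ℂ, τ ≤ w.im → w.im ≤ τ' → ‖E w‖ ≤ C) (x : ℝ) :
    ‖∫ y in τ..τ', a (x + y * Complex.I) * E (x + y * Complex.I)‖ₑ ^ 2 ≤
      ENNReal.ofReal (τ' - τ) * ENNReal.ofReal C ^ 2 *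
        ∫⁻ y in Ioc τ τ', ‖a (x + y * Complex.I)‖ₑ ^ 2 := by
  have hm : Measurable fun y : ℝ => ‖a (x + y * Complex.I)‖ₑ :=
    (ham.comp (by fun_prop : Measurable fun y : ℝ => (x + y * Complex.I : ℂ))).enorm
  have h1 : ‖∫ y in τ..τ', a (x + y * Complex.I) * E (x + y * Complex.I)‖ₑ ≤
      ENNReal.ofReal C * ∫⁻ y in Ioc τ τ', ‖a (x + y * Complex.I)‖ₑ := by
    rw [intervalIntegral.integral_of_le hτ, ← lintegral_const_mul _ hm]
    refine (enorm_integral_le_lintegral_enorm _).trans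
      (setLIntegral_mono' measurableSet_Ioc fun y hy => ?_)
    rw [enorm_mul, mul_comm]
    gcongr
    rw [← ofReal_norm]
    exact ENNReal.ofReal_le_ofReal (hE _ (by simpa using hy.1.le) (by simpa using hy.2))
  calc _ ≤ (ENNReal.ofReal C * ∫⁻ y in Ioc τ τ', ‖a (x + y * Complex.I)‖ₑ) ^ 2 := by gcongr
    _ = ENNReal.ofReal C ^ 2 * (∫⁻ y in Ioc τ τ', ‖a (x + y * Complex.I)‖ₑ) ^ 2 := mul_pow _ _ _
    _ ≤ ENNReal.ofReal C ^ 2 * ((volume.restrict (Ioc τ τ')) univ *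
        ∫⁻ y in Ioc τ τ', ‖a (x + y * Complex.I)‖ₑ ^ 2) := by
      gcongr
      exact sq_lintegral_le _ hm.aemeasurable
    _ = _ := by
      rw [Measure.restrict_apply_univ, Real.volume_Ioc]
      ring

/-- Shifting a contour in a horizontal strip for the product of a function which is
square-integrable in the strip with a bounded function. -/
theorem integral_line_eq (ham : Measurable a) (ha : DifferentiableOn ℂ a upperHalf)
    (hEd : Differentiable ℂ E) (hτ0 : 0 < τ) (hτ : τ ≤ τ')
    (hstrip : ∫⁻ y in Ioc τ τ', (∫⁻ x : ℝ, ‖a (x + y * Complex.I)‖ₑ ^ 2) < ⊤)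
    (hE : ∀ w : ℂ, τ ≤ w.im → w.im ≤ τ' → ‖E w‖ ≤ C)
    (hi : Integrable fun x : ℝ => a (x + τ * Complex.I) * E (x + τ * Complex.I))
    (hi' : Integrable fun x : ℝ => a (x + τ' * Complex.I) * E (x + τ' * Complex.I)) :
    ∫ x : ℝ, a (x + τ * Complex.I) * E (x + τ * Complex.I) =
      ∫ x : ℝ, a (x + τ' * Complex.I) * E (x + τ' * Complex.I) := by
  have hC : 0 ≤ C := (norm_nonneg _).trans (hE (τ * Complex.I) (by simp) (by simpa using hτ))
  set f : ℂ → ℂ := fun w => a w * E w with hf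
  let S : ℝ → ℂ := fun x => ∫ y in τ..τ', f (x + y * Complex.I)
  let s : ℝ → ℝ≥0∞ := fun x => ∫⁻ y in Ioc τ τ', ‖a (x + y * Complex.I)‖ₑ ^ 2
  let K : ℝ≥0∞ := ENNReal.ofReal (τ' - τ) * ENNReal.ofReal C ^ 2
  have hK : K ≠ ⊤ := ENNReal.mul_ne_top ENNReal.ofReal_ne_top (by simp)
  have hS : ∀ x, ‖S x‖ₑ ^ 2 ≤ K * s x := fun x => enorm_side_sq_le ham hτ hE x
  have hsm : Measurable s := ((measurable_line ham).enorm.pow_const 2).lintegral_prod_right'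
  have hs : ∫⁻ x, s x < ⊤ := by
    have h1 : ∫⁻ x, s x = ∫⁻ y in Ioc τ τ', (∫⁻ x : ℝ, ‖a (x + y * Complex.I)‖ₑ ^ 2) :=
      lintegral_lintegral_swap ((measurable_line ham).enorm.pow_const 2).aemeasurable
    rwa [h1]
  -- Adding the reflected function makes the vertical sides at `R` and `-R` small for the same
  -- values of `R`.
  have hs' : ∫⁻ x, K * (s x + s (-x)) < ⊤ := by
    have hsm' : Measurable fun x => s (-x) := hsm.comp measurable_neg
    have hadd : Measurable fun x => s x + s (-x) := hsm.add hsm'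
    rw [lintegral_const_mul _ hadd, lintegral_add_left hsm, lintegral_neg_eq_self]
    exact ENNReal.mul_lt_top hK.lt_top (ENNReal.add_lt_top.2 ⟨hs, hs⟩)
  have hlim : Tendsto (fun R : ℝ => ‖(∫ x in (-R)..R, f (x + τ * Complex.I)) -
      ∫ x in (-R)..R, f (x + τ' * Complex.I)‖) atTop
      (𝓝 ‖(∫ x : ℝ, f (x + τ * Complex.I)) - ∫ x : ℝ, f (x + τ' * Complex.I)‖) :=
    ((intervalIntegral_tendsto_integral hi tendsto_neg_atTop_atBot tendsto_id).sub
      (intervalIntegral_tendsto_integral hi' tendsto_neg_atTop_atBot tendsto_id)).norm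
  have hrect : ∀ R : ℝ, (∫ x in (-R)..R, f (x + τ * Complex.I)) -
      (∫ x in (-R)..R, f (x + τ' * Complex.I)) = Complex.I * S (-R) - Complex.I * S R := by
    intro R
    have h := Complex.integral_boundary_rect_eq_zero_of_differentiableOn f
      (-R + τ * Complex.I) (R + τ' * Complex.I) (by
        refine (ha.mul hEd.differentiableOn).mono fun w hw => ?_
        have h1 := (Complex.mem_reProdIm.1 hw).2
        simp only [Complex.add_im, Complex.neg_im, Complex.ofReal_im, Complex.mul_im,
          Complex.ofReal_re, Complex.I_im, Complex.I_re, mul_one, mul_zero, add_zero, neg_zero,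
          zero_add, uIcc_of_le hτ] at h1
        exact hτ0.trans_le h1.1)
    simp only [Complex.add_im, Complex.neg_im, Complex.ofReal_im, Complex.mul_im,
      Complex.ofReal_re, Complex.I_im, Complex.I_re, mul_one, mul_zero, add_zero, neg_zero,
      zero_add, Complex.add_re, Complex.neg_re, Complex.mul_re, sub_zero, smul_eq_mul,
      Complex.ofReal_neg] at h
    simp only [S, Complex.ofReal_neg]
    linear_combination h
  have hsmall : ∀ ε : ℝ, 0 < ε →
      ‖(∫ x : ℝ, f (x + τ * Complex.I)) - ∫ x : ℝ, f (x + τ' * Complex.I)‖ ≤ 2 * ε := by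
    intro ε hε
    -- The limit in `R` exists by integrability on both lines, so it suffices that the sides are
    -- small for arbitrarily large `R`.
    refine le_of_tendsto_of_frequently hlim ?_
    refine (frequently_lt_of_lintegral_lt_top hs' (ε := ENNReal.ofReal ε ^ 2)
      (by positivity)).mono fun R hR => ?_
    have key : ∀ x, K * s x < ENNReal.ofReal ε ^ 2 → ‖S x‖ ≤ ε := by
      intro x hx
      have h1 : ‖S x‖ₑ ≤ ENNReal.ofReal ε :=
        (ENNReal.pow_le_pow_left_iff two_ne_zero).1 ((hS x).trans hx.le)
      rw [← ofReal_norm] at h1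
      exact (ENNReal.ofReal_le_ofReal_iff hε.le).1 h1
    have h1 := key R (lt_of_le_of_lt (by gcongr; exact le_self_add) hR)
    have h2 := key (-R) (lt_of_le_of_lt (by gcongr; exact le_add_self) hR)
    rw [hrect R]
    calc _ ≤ ‖Complex.I * S (-R)‖ + ‖Complex.I * S R‖ := norm_sub_le _ _
      _ ≤ 2 * ε := by
        rw [norm_mul, norm_mul, Complex.norm_I, one_mul, one_mul]
        linarith
  have h0 : ‖(∫ x : ℝ, f (x + τ * Complex.I)) - ∫ x : ℝ, f (x + τ' * Complex.I)‖ ≤ 0 := by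
    refine le_of_forall_pos_le_add fun ε hε => ?_
    have := hsmall (ε / 2) (by positivity)
    linarith
  exact sub_eq_zero.1 (norm_le_zero_iff.1 h0)

end ContourShift

/-! ### Paley–Wiener theorem for weighted Bergman spaces of the half-plane. -/

section PaleyWiener

open FourierTransform SchwartzMap

/-- The Fourier–Laplace transform. -/
def fourierLaplace (φ : ℝ → ℂ) (w : ℂ) : ℂ :=
  ∫ t, φ t * Complex.exp (-(2 * Real.pi * Complex.I * t * w))

theorem norm_exp_neg_two_pi (t : ℝ) (w : ℂ) :
    ‖Complex.exp (-(2 * Real.pi * Complex.I * t * w))‖ = Real.exp (2 * Real.pi * t * w.im) := by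
  rw [Complex.norm_exp]
  simp

variable {φ : ℝ → ℂ}

theorem norm_fourierLaplace_le (hφ : Continuous φ) (hc : HasCompactSupport φ) {w : ℂ} {σ : ℝ}
    (h1 : |w.im| ≤ σ) :
    ‖fourierLaplace φ w‖ ≤ ∫ t, ‖φ t‖ * Real.exp (2 * Real.pi * |t| * σ) := by
  refine norm_integral_le_of_norm_le (Continuous.integrable_of_hasCompactSupport (by fun_prop)
    hc.norm.mul_right) (Eventually.of_forall fun t => ?_)
  rw [norm_mul, norm_exp_neg_two_pi]
  gcongr ?_ * Real.exp ?_
  have h2 := mul_le_mul (le_refl |t|) h1 (abs_nonneg _) (abs_nonneg _)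
  rw [← abs_mul] at h2
  have h3 := (le_abs_self _).trans h2
  have := Real.pi_pos
  nlinarith

theorem differentiable_fourierLaplace (hφ : Continuous φ) (hc : HasCompactSupport φ) :
    Differentiable ℂ (fourierLaplace φ) := by
  intro w₀
  refine (hasDerivAt_integral_of_dominated_loc_of_deriv_le (Metric.ball_mem_nhds w₀ one_pos)
    (F := fun w t => φ t * Complex.exp (-(2 * Real.pi * Complex.I * t * w)))
    (F' := fun w t => φ t * (Complex.exp (-(2 * Real.pi * Complex.I * t * w)) *
      (-(2 * Real.pi * Complex.I * t))))
    (bound := fun t => ‖φ t‖ * (Real.exp (2 * Real.pi * |t| * (|w₀.im| + 1)) *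
      (2 * Real.pi * |t|)))
    (Eventually.of_forall fun w => Continuous.aestronglyMeasurable (by fun_prop))
    (Continuous.integrable_of_hasCompactSupport (by fun_prop) hc.mul_right)
    (Continuous.aestronglyMeasurable (by fun_prop))
    (Eventually.of_forall fun t w hw => ?_)
    (Continuous.integrable_of_hasCompactSupport (by fun_prop) hc.norm.mul_right)
    (Eventually.of_forall fun t w hw => ?_)).2.differentiableAt
  · rw [norm_mul, norm_mul, norm_exp_neg_two_pi]
    have h1 : |w.im| ≤ |w₀.im| + 1 := by
      rw [Metric.mem_ball, dist_eq_norm] at hw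
      have h2 := (Complex.abs_im_le_norm (w - w₀)).trans hw.le
      rw [Complex.sub_im] at h2
      have h3 := abs_sub_abs_le_abs_sub w.im w₀.im
      linarith
    have h2 := mul_le_mul (le_refl |t|) h1 (abs_nonneg _) (abs_nonneg _)
    rw [← abs_mul] at h2
    have h3 := (le_abs_self _).trans h2
    have hp := Real.pi_pos
    have h4 : ‖(-(2 * Real.pi * Complex.I * t) : ℂ)‖ = 2 * Real.pi * |t| := by
      simp [abs_of_pos hp]
    rw [h4]
    gcongr ?_ * (Real.exp ?_ * ?_)
    nlinarith
  · have h1 : HasDerivAt (fun w : ℂ => -(2 * Real.pi * Complex.I * t * w))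
        (-(2 * Real.pi * Complex.I * t)) w := by
      have h2 := ((hasDerivAt_id w).const_mul (2 * Real.pi * Complex.I * t)).fun_neg
      rwa [mul_one] at h2
    exact h1.cexp.const_mul _

theorem fourierLaplace_line (φ : ℝ → ℂ) (x y : ℝ) :
    fourierLaplace φ (x + y * Complex.I) =
      𝓕 (fun t => φ t * (Real.exp (2 * Real.pi * t * y) : ℂ)) x := by
  rw [Real.fourier_eq', fourierLaplace]
  refine integral_congr_ae (Eventually.of_forall fun t => ?_)
  simp only [smul_eq_mul, Complex.ofReal_exp]
  rw [mul_comm, mul_comm (φ t), ← mul_assoc, ← Complex.exp_add]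
  congr 2
  simp
  linear_combination (-2 * Real.pi * t * y : ℂ) * Complex.I_mul_I

theorem integral_mul_fourier_toLp {f : ℝ → ℂ} (hf : MemLp f 2) (G : 𝓢(ℝ, ℂ)) :
    ∫ t, G t * (𝓕 hf.toLp : Lp ℂ 2 (volume : Measure ℝ)) t = ∫ x, 𝓕 (G : ℝ → ℂ) x * f x := by
  have h3 := congrArg (fun T => T G) (Lp.fourier_toTemperedDistribution_eq hf.toLp)
  simp only [TemperedDistribution.fourier_apply, Lp.toTemperedDistribution_apply,
    smul_eq_mul] at h3
  rw [← h3]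
  refine integral_congr_ae ?_
  filter_upwards [hf.coeFn_toLp] with x hx
  rw [hx, fourier_coe]

variable {a : ℂ → ℂ}

theorem exists_schwartz_mul_exp {g : ℝ → ℝ} (hg : ContDiff ℝ ∞ g) (hgc : HasCompactSupport g)
    (y : ℝ) : ∃ G : 𝓢(ℝ, ℂ), ∀ t, G t = (g t : ℂ) * (Real.exp (2 * Real.pi * t * y) : ℂ) := by
  have h1 : HasCompactSupport fun t => (g t : ℂ) * (Real.exp (2 * Real.pi * t * y) : ℂ) :=
    (hgc.comp_left Complex.ofReal_zero).mul_right
  have h2 : ContDiff ℝ ∞ fun t => (g t : ℂ) * (Real.exp (2 * Real.pi * t * y) : ℂ) := by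
    refine (Complex.ofRealCLM.contDiff.comp hg).mul (Complex.ofRealCLM.contDiff.comp ?_)
    exact Real.contDiff_exp.comp (by fun_prop)
  exact ⟨h1.toSchwartzMap h2, fun t => rfl⟩

/-- The Fourier transforms of the restrictions to horizontal lines of a holomorphic function which
is square-integrable on horizontal strips differ by exponential factors. -/
theorem fourier_line_eq (ham : Measurable a) (ha : DifferentiableOn ℂ a upperHalf) {y y' : ℝ}
    (hy : 0 < y) (hyy : y ≤ y')
    (hstrip : ∫⁻ y in Ioc y y', (∫⁻ x : ℝ, ‖a (x + y * Complex.I)‖ₑ ^ 2) < ⊤)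
    (hm : MemLp (fun x : ℝ => a (x + y * Complex.I)) 2)
    (hm' : MemLp (fun x : ℝ => a (x + y' * Complex.I)) 2) :
    (fun t => (Real.exp (2 * Real.pi * t * y) : ℂ) *
      (𝓕 hm.toLp : Lp ℂ 2 (volume : Measure ℝ)) t) =ᵐ[volume]
    fun t => (Real.exp (2 * Real.pi * t * y') : ℂ) *
      (𝓕 hm'.toLp : Lp ℂ 2 (volume : Measure ℝ)) t := by
  have hloc : ∀ (c : ℝ) (u : Lp ℂ 2 (volume : Measure ℝ)), LocallyIntegrable
      fun t => (Real.exp (2 * Real.pi * t * c) : ℂ) * u t := by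
    intro c u
    have h1 := ((Lp.memLp u).locallyIntegrable one_le_two).locallyIntegrableOn univ
    rw [← locallyIntegrableOn_univ]
    exact h1.continuousOn_mul (by fun_prop) isOpen_univ.isLocallyClosed
  refine ae_eq_of_integral_contDiff_smul_eq (hloc _ _) (hloc _ _) fun g hg hgc => ?_
  have hφ : Continuous fun t => (g t : ℂ) := Complex.continuous_ofReal.comp hg.continuous
  have hφc : HasCompactSupport fun t => (g t : ℂ) := hgc.comp_left Complex.ofReal_zero
  -- Testing against `g` moves the Fourier transform onto `g(t) e^{2πtc}`, whose transform is the
  -- entire function `fourierLaplace g` on the line of height `c`. The pairing becomes a line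
  -- integral of a holomorphic function, to which the contour shift applies.
  have key : ∀ (c : ℝ) (hc : MemLp (fun x : ℝ => a (x + c * Complex.I)) 2),
      Integrable (fun x : ℝ => a (x + c * Complex.I) *
        fourierLaplace (fun t => (g t : ℂ)) (x + c * Complex.I)) ∧
      ∫ t, g t • ((Real.exp (2 * Real.pi * t * c) : ℂ) *
        (𝓕 hc.toLp : Lp ℂ 2 (volume : Measure ℝ)) t) =
      ∫ x : ℝ, a (x + c * Complex.I) *
        fourierLaplace (fun t => (g t : ℂ)) (x + c * Complex.I) := by
    intro c hc
    obtain ⟨G, hG⟩ := exists_schwartz_mul_exp hg hgc c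
    have hG' : (G : ℝ → ℂ) = fun t => (g t : ℂ) * (Real.exp (2 * Real.pi * t * c) : ℂ) :=
      funext hG
    have e1 : ∀ x : ℝ, fourierLaplace (fun t => (g t : ℂ)) (x + c * Complex.I) =
        𝓕 (G : ℝ → ℂ) x := fun x => by rw [fourierLaplace_line, hG']
    constructor
    · simp only [e1]
      have h2 : MemLp (𝓕 (G : ℝ → ℂ)) 2 := by
        rw [← fourier_coe]
        exact (𝓕 G).memLp 2
      exact hc.integrable_mul h2
    · have h3 := integral_mul_fourier_toLp hc G
      simp only [hG] at h3
      simp only [e1, Complex.real_smul, ← mul_assoc]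
      rw [h3]
      exact integral_congr_ae (Eventually.of_forall fun x => mul_comm _ _)
  rw [(key y hm).2, (key y' hm').2]
  refine integral_line_eq ham ha (differentiable_fourierLaplace hφ hφc) hy hyy hstrip
    (C := ∫ t, ‖(g t : ℂ)‖ * Real.exp (2 * Real.pi * |t| * y')) (fun w h1 h2 => ?_)
    (key y hm).1 (key y' hm').1
  exact norm_fourierLaplace_le hφ hφc (abs_le.2 ⟨by linarith, h2⟩)

theorem ae_memLp_line (ham : Measurable a) {m : ℕ}
    (hint : ∫⁻ y in Ioi (0 : ℝ), ENNReal.ofReal (y ^ m) *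
      (∫⁻ x : ℝ, ‖a (x + y * Complex.I)‖ₑ ^ 2) < ⊤) :
    ∀ᵐ y : ℝ ∂volume.restrict (Ioi (0 : ℝ)), MemLp (fun x : ℝ => a (x + y * Complex.I)) 2 := by
  have hmeas : Measurable fun y : ℝ => ENNReal.ofReal (y ^ m) *
      (∫⁻ x : ℝ, ‖a (x + y * Complex.I)‖ₑ ^ 2) :=
    (by fun_prop : Measurable fun y : ℝ => ENNReal.ofReal (y ^ m)).mul
      ((measurable_line ham).enorm.pow_const 2).lintegral_prod_left'
  filter_upwards [ae_lt_top hmeas hint.ne, ae_restrict_mem measurableSet_Ioi] with y h1 (h2 : 0 < y)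
  refine memLp_two_of_lintegral
    (ham.comp (by fun_prop : Measurable fun x : ℝ => (x + y * Complex.I : ℂ))).aestronglyMeasurable ?_
  by_contra h3
  rw [not_lt_top_iff.1 h3, ENNReal.mul_top (by positivity)] at h1
  exact lt_irrefl _ h1

/-- On a strip away from the real axis the weight is bounded below by `y ^ m > 0`. -/
theorem lintegral_strip_lt_top {m : ℕ} {F : ℝ → ℝ≥0∞} (hF : Measurable F)
    (hint : ∫⁻ y in Ioi (0 : ℝ), ENNReal.ofReal (y ^ m) * F y < ⊤) {y y' : ℝ} (hy : 0 < y) :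
    ∫⁻ y in Ioc y y', F y < ⊤ := by
  have h1 : ENNReal.ofReal (y ^ m) * ∫⁻ y in Ioc y y', F y ≤
      ∫⁻ y in Ioi (0 : ℝ), ENNReal.ofReal (y ^ m) * F y := by
    rw [← lintegral_const_mul _ hF]
    refine (setLIntegral_mono' measurableSet_Ioc fun u hu => ?_).trans
      (lintegral_mono_set fun u (hu : u ∈ Ioc y y') => hy.trans hu.1)
    gcongr
    exact hu.1.le
  by_contra h2
  rw [not_lt_top_iff.1 h2, ENNReal.mul_top (by positivity), top_le_iff] at h1
  exact absurd hint (by simp [h1])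

theorem enorm_fourier_toLp {f : ℝ → ℂ} (hf : MemLp f 2) :
    ∫⁻ t, ‖(𝓕 hf.toLp : Lp ℂ 2 (volume : Measure ℝ)) t‖ₑ ^ 2 = ∫⁻ x, ‖f x‖ₑ ^ 2 := by
  have h := (Lp.fourierTransformₗᵢ ℝ ℂ).norm_map hf.toLp
  rw [← eLpNorm_two_sq, ← eLpNorm_two_sq, ← Lp.enorm_def, ← Lp.enorm_toLp (hf := hf)]
  congr 1
  rw [← ofReal_norm, ← ofReal_norm]
  exact congrArg _ h

theorem setLIntegral_pow_mul_exp_eq_top (m : ℕ) {t : ℝ} (ht : t ≤ 0) :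
    ∫⁻ y in Ioi (0 : ℝ), ENNReal.ofReal (y ^ m) * ENNReal.ofReal (Real.exp (-(2 * Real.pi * t * y))) ^ 2
      = ⊤ := by
  rw [← top_le_iff]
  have h1 : ∫⁻ _ in Ioi (1 : ℝ), (1 : ℝ≥0∞) = ⊤ := by simp
  rw [← h1]
  refine (setLIntegral_mono' measurableSet_Ioi fun y (hy : 1 < y) => ?_).trans
    (lintegral_mono_set fun y (hy : 1 < y) => (zero_lt_one.trans hy : (0 : ℝ) < y))
  have h2 : 1 ≤ y ^ m := one_le_pow₀ hy.le
  have h3 : 1 ≤ Real.exp (-(2 * Real.pi * t * y)) := by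
    refine Real.one_le_exp ?_
    have := Real.pi_pos
    have : 0 ≤ Real.pi * y * (-t) := by
      have : 0 ≤ -t := by linarith
      positivity
    linarith
  calc (1 : ℝ≥0∞) = 1 * 1 ^ 2 := by simp
    _ ≤ _ := by
      gcongr
      · rwa [ENNReal.one_le_ofReal]
      · rwa [ENNReal.one_le_ofReal]

/-- A Paley–Wiener theorem for weighted Bergman spaces of the upper half-plane. -/
theorem exists_fourier_line (ham : Measurable a) (ha : DifferentiableOn ℂ a upperHalf) {m : ℕ}
    (hint : ∫⁻ y in Ioi (0 : ℝ), ENNReal.ofReal (y ^ m) *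
      (∫⁻ x : ℝ, ‖a (x + y * Complex.I)‖ₑ ^ 2) < ⊤) :
    ∃ h : ℝ → ℂ, StronglyMeasurable h ∧ (∀ t ≤ 0, h t = 0) ∧
      ∀ᵐ y : ℝ ∂volume.restrict (Ioi (0 : ℝ)), ∃ hm : MemLp (fun x : ℝ => a (x + y * Complex.I)) 2,
        (𝓕 hm.toLp : Lp ℂ 2 (volume : Measure ℝ)) =ᵐ[volume]
          fun t => h t * (Real.exp (-(2 * Real.pi * t * y)) : ℂ) := by
  have hF : Measurable fun y : ℝ => ∫⁻ x : ℝ, ‖a (x + y * Complex.I)‖ₑ ^ 2 :=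
    ((measurable_line ham).enorm.pow_const 2).lintegral_prod_left'
  have hgood := ae_memLp_line ham hint
  have : NeBot (ae (volume.restrict (Ioi (0 : ℝ)))) := by
    rw [ae_neBot, Ne, Measure.restrict_eq_zero]
    simp
  -- One good line serves as reference; `h₀` is its Fourier transform with the exponential factor
  -- removed, and all other good lines give the same function.
  obtain ⟨y₀, hm₀, hy₀⟩ := (hgood.and (ae_restrict_mem measurableSet_Ioi)).exists
  let h₀ : ℝ → ℂ := fun t => (Real.exp (2 * Real.pi * t * y₀) : ℂ) *
    (𝓕 hm₀.toLp : Lp ℂ 2 (volume : Measure ℝ)) t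
  have hh₀ : StronglyMeasurable h₀ :=
    (Continuous.stronglyMeasurable (by fun_prop)).mul (Lp.stronglyMeasurable _)
  have h1 : ∀ᵐ y : ℝ ∂volume.restrict (Ioi (0 : ℝ)),
      ∃ hm : MemLp (fun x : ℝ => a (x + y * Complex.I)) 2,
        (𝓕 hm.toLp : Lp ℂ 2 (volume : Measure ℝ)) =ᵐ[volume]
          fun t => h₀ t * (Real.exp (-(2 * Real.pi * t * y)) : ℂ) := by
    filter_upwards [hgood, ae_restrict_mem measurableSet_Ioi] with y hm (hy : 0 < y)
    refine ⟨hm, ?_⟩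
    have h2 : (fun t => (Real.exp (2 * Real.pi * t * y) : ℂ) *
        (𝓕 hm.toLp : Lp ℂ 2 (volume : Measure ℝ)) t) =ᵐ[volume] h₀ := by
      rcases le_total y y₀ with hle | hle
      · exact fourier_line_eq ham ha hy hle (lintegral_strip_lt_top hF hint hy) hm hm₀
      · exact (fourier_line_eq ham ha hy₀ hle (lintegral_strip_lt_top hF hint hy₀) hm₀ hm).symm
    filter_upwards [h2] with t ht
    rw [← ht, mul_right_comm, ← Complex.ofReal_mul, ← Real.exp_add, add_neg_cancel, Real.exp_zero,
      Complex.ofReal_one, one_mul]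
  have hmw : Measurable fun z : ℝ × ℝ => ENNReal.ofReal (z.1 ^ m) *
      (‖h₀ z.2‖ₑ ^ 2 * ENNReal.ofReal (Real.exp (-(2 * Real.pi * z.2 * z.1))) ^ 2) := by
    have := hh₀.measurable.enorm
    fun_prop
  have h2 : ∫⁻ t, (∫⁻ y in Ioi (0 : ℝ), ENNReal.ofReal (y ^ m) *
      (‖h₀ t‖ₑ ^ 2 * ENNReal.ofReal (Real.exp (-(2 * Real.pi * t * y))) ^ 2)) < ⊤ := by
    rw [← lintegral_lintegral_swap
      (f := fun y t => ENNReal.ofReal (y ^ m) *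
        (‖h₀ t‖ₑ ^ 2 * ENNReal.ofReal (Real.exp (-(2 * Real.pi * t * y))) ^ 2)) hmw.aemeasurable]
    refine lt_of_le_of_lt (le_of_eq (lintegral_congr_ae ?_)) hint
    filter_upwards [h1] with y ⟨hm, hy⟩
    rw [← enorm_fourier_toLp hm, ← lintegral_const_mul _
      ((Lp.stronglyMeasurable _).enorm.pow_const 2)]
    refine lintegral_congr_ae ?_
    filter_upwards [hy] with t ht
    have e : ‖((Real.exp (-(2 * Real.pi * t * y)) : ℝ) : ℂ)‖ₑ =
        ENNReal.ofReal (Real.exp (-(2 * Real.pi * t * y))) := by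
      rw [← ofReal_norm, Complex.norm_real, Real.norm_of_nonneg (Real.exp_pos _).le]
    rw [ht, enorm_mul (h₀ t), mul_pow, e]
  -- By Tonelli the `y`-integral is finite for almost every `t`. For `t ≤ 0` the weight `y^m
  -- e^{-4πty}` is not integrable at infinity, so `h₀ t` must vanish.
  have h3 : ∀ᵐ t, t ≤ 0 → h₀ t = 0 := by
    have hmt := hmw.lintegral_prod_left' (μ := volume.restrict (Ioi (0 : ℝ)))
    filter_upwards [ae_lt_top hmt h2.ne] with t ht hneg
    by_contra hne
    have h4 : ∫⁻ y in Ioi (0 : ℝ), ENNReal.ofReal (y ^ m) *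
        (‖h₀ t‖ₑ ^ 2 * ENNReal.ofReal (Real.exp (-(2 * Real.pi * t * y))) ^ 2) = ⊤ := by
      have h5 : ∀ y : ℝ, ENNReal.ofReal (y ^ m) *
          (‖h₀ t‖ₑ ^ 2 * ENNReal.ofReal (Real.exp (-(2 * Real.pi * t * y))) ^ 2) = ‖h₀ t‖ₑ ^ 2 *
          (ENNReal.ofReal (y ^ m) * ENNReal.ofReal (Real.exp (-(2 * Real.pi * t * y))) ^ 2) :=
        fun y => by ring
      simp only [h5]
      rw [lintegral_const_mul _ (by fun_prop), setLIntegral_pow_mul_exp_eq_top m hneg,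
        ENNReal.mul_top (by simpa using hne)]
    simp only [h4] at ht
    exact lt_irrefl _ ht
  refine ⟨(Ioi 0).indicator h₀, hh₀.indicator measurableSet_Ioi,
    fun t ht => indicator_of_notMem (by simpa using ht) _, ?_⟩
  filter_upwards [h1] with y ⟨hm, hy⟩
  refine ⟨hm, ?_⟩
  filter_upwards [hy, h3] with t ht ht'
  rw [ht]
  by_cases hpos : 0 < t
  · rw [indicator_of_mem (mem_Ioi.2 hpos)]
  · rw [indicator_of_notMem (by simpa using hpos), ht' (not_lt.1 hpos)]

end PaleyWiener

/-! ### Weighted bounds for the coefficients of a homogeneous function. -/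

section WeightedBounds

variable {n : ℕ}

/-- The functions `ζ ^ p (1 - |ζ|²) ^ k`. -/
def discFun (p k : ℕ) (ζ : ℂ) : ℂ := ζ ^ p * ((1 - ‖ζ‖ ^ 2 : ℝ) : ℂ) ^ k

theorem continuous_discFun (p k : ℕ) : Continuous (discFun p k) := by
  unfold discFun
  fun_prop

theorem memLp_discFun (p k : ℕ) : MemLp (discFun p k) 2 (volume.restrict (Metric.ball 0 1)) := by
  have : IsFiniteMeasure ((volume : Measure ℂ).restrict (Metric.ball 0 1)) :=
    ⟨by simp⟩
  refine MemLp.of_bound (continuous_discFun p k).aestronglyMeasurable 1 ?_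
  filter_upwards [ae_restrict_mem Metric.isOpen_ball.measurableSet] with ζ hζ
  rw [mem_ball_zero_iff] at hζ
  have h1 : ‖ζ‖ ^ 2 ≤ 1 := pow_le_one₀ (norm_nonneg _) hζ.le
  rw [discFun, norm_mul, norm_pow, norm_pow, Complex.norm_real, Real.norm_of_nonneg (by linarith)]
  exact mul_le_one₀ (pow_le_one₀ (norm_nonneg _) hζ.le) (by positivity)
    (pow_le_one₀ (by linarith) (by linarith [sq_nonneg ‖ζ‖]))

/-- At `ζ = √(1 - s)` the sum is a nonzero factor times a polynomial in `s`, which has the whole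
interval `(0, 1)` as roots. -/
theorem eq_zero_of_sum_discFun (p : ℕ) {B : Fin n → ℂ}
    (h : ∀ ζ ∈ Metric.ball (0 : ℂ) 1, ∑ k : Fin n, B k * discFun p k ζ = 0) : B = 0 := by
  let P : Polynomial ℂ := ∑ k : Fin n, Polynomial.C (B k) * Polynomial.X ^ (k : ℕ)
  have hP : ∀ s : ℝ, s ∈ Ioo (0 : ℝ) 1 → P.eval (s : ℂ) = 0 := by
    intro s hs
    have hpos : 0 < √(1 - s) := Real.sqrt_pos.2 (by linarith [hs.2])
    have hsq : √(1 - s) ^ 2 = 1 - s := Real.sq_sqrt (by linarith [hs.2])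
    have h1 := h (√(1 - s) : ℝ) (by
      rw [mem_ball_zero_iff, Complex.norm_real, Real.norm_of_nonneg hpos.le]
      nlinarith [hs.1])
    simp only [discFun, Complex.norm_real, Real.norm_of_nonneg hpos.le, hsq, sub_sub_cancel] at h1
    have h2 : ((√(1 - s) : ℝ) : ℂ) ^ p * P.eval (s : ℂ) = 0 := by
      rw [← h1, Polynomial.eval_finsetSum, Finset.mul_sum]
      refine Finset.sum_congr rfl fun k _ => ?_
      simp only [Polynomial.eval_mul, Polynomial.eval_C, Polynomial.eval_pow, Polynomial.eval_X]
      ring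
    exact (mul_eq_zero.1 h2).resolve_left (pow_ne_zero _ (by exact_mod_cast hpos.ne'))
  have h0 : P = 0 := by
    refine Polynomial.eq_zero_of_infinite_isRoot P (Set.Infinite.mono (s := (fun s : ℝ => (s : ℂ)) '' Ioo 0 1) ?_ ?_)
    · rintro _ ⟨s, hs, rfl⟩
      exact hP s hs
    · exact (Ioo_infinite one_pos).image Complex.ofReal_injective.injOn
  funext k
  have h3 := congrArg (fun Q => Polynomial.coeff Q (k : ℕ)) h0
  simpa [P, Polynomial.finsetSum_coeff, Polynomial.coeff_C_mul, Polynomial.coeff_X_pow,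
    Fin.val_inj] using h3

/-- An injective linear map from a finite-dimensional space into `L²` of the disc is bounded below.
Hence the terms with different `k` cannot cancel each other. -/
theorem exists_discFun_bound (n p : ℕ) : ∃ c : ℝ≥0∞, c ≠ 0 ∧ ∀ (B : Fin n → ℂ) (k : Fin n),
    c * ‖B k‖ₑ ^ 2 ≤ ∫⁻ ζ in Metric.ball (0 : ℂ) 1, ‖∑ k : Fin n, B k * discFun p k ζ‖ₑ ^ 2 := by
  let e : Fin n → Lp ℂ 2 ((volume : Measure ℂ).restrict (Metric.ball 0 1)) := fun k =>
    (memLp_discFun p k).toLp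
  let L := Fintype.linearCombination ℂ e
  have hL : ∀ B, L B =ᵐ[volume.restrict (Metric.ball (0 : ℂ) 1)]
      fun ζ => ∑ k : Fin n, B k * discFun p k ζ := by
    intro B
    have h1 : ∀ᵐ ζ ∂(volume : Measure ℂ).restrict (Metric.ball 0 1), ∀ k : Fin n,
        (B k • e k : Lp ℂ 2 _) ζ = B k * discFun p k ζ := by
      refine ae_all_iff.2 fun k => ?_
      filter_upwards [Lp.coeFn_smul (B k) (e k), (memLp_discFun p k).coeFn_toLp] with ζ h1 h2
      rw [h1, Pi.smul_apply, h2, smul_eq_mul]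
    have h2 : L B = ∑ k, B k • e k := Fintype.linearCombination_apply ℂ e B
    rw [h2]
    filter_upwards [Lp.coeFn_finsetSum Finset.univ fun k => B k • e k, h1] with ζ h3 h4
    rw [h3, Finset.sum_apply]
    exact Finset.sum_congr rfl fun k _ => h4 k
  have hker : LinearMap.ker L = ⊥ := by
    refine LinearMap.ker_eq_bot'.2 fun B hB => eq_zero_of_sum_discFun p ?_
    have h1 := hL B
    rw [hB] at h1
    refine Measure.eqOn_open_of_ae_eq (μ := volume)
      (f := fun ζ => ∑ k : Fin n, B k * discFun p k ζ) (g := fun _ => 0) ?_ Metric.isOpen_ball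
      (Continuous.continuousOn (continuous_finsetSum _ fun k _ =>
        continuous_const.mul (continuous_discFun p k))) continuousOn_const
    filter_upwards [h1, Lp.coeFn_zero ℂ 2 ((volume : Measure ℂ).restrict (Metric.ball 0 1))]
      with ζ h2 h3
    rw [← h2, h3]
    rfl
  obtain ⟨K, hK, hanti⟩ := L.exists_antilipschitzWith hker
  refine ⟨((K : ℝ≥0∞) ^ 2)⁻¹, by simp, fun B k => ?_⟩
  rw [ENNReal.inv_mul_le_iff (by positivity) (by simp)]
  have h1 : ‖B k‖ₑ ≤ K * ‖L B‖ₑ := by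
    have h2 := hanti B 0
    rw [map_zero, edist_zero_right, edist_zero_right] at h2
    refine le_trans ?_ h2
    rw [← ofReal_norm, ← ofReal_norm]
    exact ENNReal.ofReal_le_ofReal (norm_le_pi_norm B k)
  calc ‖B k‖ₑ ^ 2 ≤ (K * ‖L B‖ₑ) ^ 2 := by gcongr
    _ = K ^ 2 * ∫⁻ ζ in Metric.ball (0 : ℂ) 1, ‖L B ζ‖ₑ ^ 2 := by
      rw [mul_pow, Lp.enorm_def, eLpNorm_two_sq]
    _ = _ := by
      congr 1
      refine lintegral_congr_ae ?_
      filter_upwards [hL B] with ζ hζ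
      rw [hζ]

theorem lintegral_comp_smul_complex (f : ℂ → ℝ≥0∞) {r : ℝ} (hr : 0 < r) :
    ∫⁻ z, f z = ENNReal.ofReal (r ^ 2) * ∫⁻ z : ℂ, f (r • z) := by
  have h1 : ∫⁻ z : ℂ, f (r • z) = ∫⁻ z, f z ∂(Measure.map (fun z : ℂ => r • z) volume) :=
    ((Homeomorph.smulOfNeZero r hr.ne').toMeasurableEquiv.measurableEmbedding.lintegral_map f).symm
  rw [h1, Measure.map_addHaar_smul volume hr.ne', lintegral_smul_measure, Complex.finrank_real_complex,
    smul_eq_mul, ← mul_assoc, ← ENNReal.ofReal_mul (by positivity), abs_of_pos (by positivity),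
    mul_inv_cancel₀ (by positivity), ENNReal.ofReal_one, one_mul]

/-- Scaling `z` by `√τ` reduces to the unit disc. The exponent collects `τ` from the Jacobian, `τ^p`
from `|z^p|²` and `τ^{2k}` from the `k`-th power of the height. -/
theorem lintegral_disc_ge {p : ℕ} {c : ℝ≥0∞} (hc : ∀ (B : Fin n → ℂ) (k : Fin n), c * ‖B k‖ₑ ^ 2 ≤
      ∫⁻ ζ in Metric.ball (0 : ℂ) 1, ‖∑ k : Fin n, B k * discFun p k ζ‖ₑ ^ 2)
    {τ : ℝ} (hτ : 0 < τ) (A : Fin n → ℂ) (k : Fin n) :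
    c * (ENNReal.ofReal (τ ^ (p + 1 + 2 * k)) * ‖A k‖ₑ ^ 2) ≤
      ∫⁻ z in {z : ℂ | ‖z‖ ^ 2 < τ},
        ‖z ^ p * ∑ k : Fin n, ((τ - ‖z‖ ^ 2 : ℝ) : ℂ) ^ (k : ℕ) * A k‖ₑ ^ 2 := by
  have hr : 0 < √τ := Real.sqrt_pos.2 hτ
  have hr2 : √τ ^ 2 = τ := Real.sq_sqrt hτ.le
  have hset : MeasurableSet {z : ℂ | ‖z‖ ^ 2 < τ} := measurableSet_lt (by fun_prop) (by fun_prop)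
  rw [← lintegral_indicator hset, lintegral_comp_smul_complex _ hr, hr2]
  have h1 : ∀ z : ℂ, {z : ℂ | ‖z‖ ^ 2 < τ}.indicator (fun z : ℂ =>
      ‖z ^ p * ∑ k : Fin n, ((τ - ‖z‖ ^ 2 : ℝ) : ℂ) ^ (k : ℕ) * A k‖ₑ ^ 2) (√τ • z) =
      (Metric.ball (0 : ℂ) 1).indicator (fun z : ℂ => ENNReal.ofReal (τ ^ p) *
        ‖∑ k : Fin n, ((τ : ℂ) ^ (k : ℕ) * A k) * discFun p k z‖ₑ ^ 2) z := by
    intro z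
    have hn : ‖√τ • z‖ ^ 2 = τ * ‖z‖ ^ 2 := by
      rw [norm_smul, Real.norm_of_nonneg hr.le, mul_pow, hr2]
    have hmem : √τ • z ∈ {z : ℂ | ‖z‖ ^ 2 < τ} ↔ z ∈ Metric.ball (0 : ℂ) 1 := by
      rw [mem_ofPred_eq, hn, mem_ball_zero_iff, mul_lt_iff_lt_one_right hτ,
        sq_lt_one_iff₀ (norm_nonneg _)]
    by_cases hz : z ∈ Metric.ball (0 : ℂ) 1
    · rw [indicator_of_mem (hmem.2 hz), indicator_of_mem hz, hn]
      have e1 : ENNReal.ofReal (τ ^ p) = ‖((√τ : ℝ) : ℂ) ^ p‖ₑ ^ 2 := by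
        rw [← ofReal_norm, norm_pow, Complex.norm_real, Real.norm_of_nonneg hr.le,
          ← ENNReal.ofReal_pow (by positivity), ← pow_mul, mul_comm p 2, pow_mul, hr2]
      rw [e1, ← mul_pow, ← enorm_mul]
      congr 2
      rw [Complex.real_smul, mul_pow, mul_assoc]
      congr 1
      rw [Finset.mul_sum]
      refine Finset.sum_congr rfl fun k _ => ?_
      have e2 : ((τ - τ * ‖z‖ ^ 2 : ℝ) : ℂ) = (τ : ℂ) * ((1 - ‖z‖ ^ 2 : ℝ) : ℂ) := by
        push_cast; ring
      rw [e2, discFun, mul_pow]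
      ring
    · rw [indicator_of_notMem (fun h => hz (hmem.1 h)), indicator_of_notMem hz]
  simp only [h1]
  rw [lintegral_indicator Metric.isOpen_ball.measurableSet, lintegral_const_mul' _ _ (by simp)]
  have h2 := hc (fun k => (τ : ℂ) ^ (k : ℕ) * A k) k
  have h3 : ‖(τ : ℂ) ^ (k : ℕ) * A k‖ₑ ^ 2 = ENNReal.ofReal (τ ^ (2 * (k : ℕ))) * ‖A k‖ₑ ^ 2 := by
    rw [enorm_mul, mul_pow, ← ofReal_norm ((τ : ℂ) ^ (k : ℕ)), norm_pow, Complex.norm_real,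
      Real.norm_of_nonneg hτ.le, ← ENNReal.ofReal_pow (by positivity), ← pow_mul, mul_comm 2]
  rw [h3] at h2
  have h4 : ENNReal.ofReal (τ ^ (p + 1 + 2 * (k : ℕ))) = ENNReal.ofReal τ *
      (ENNReal.ofReal (τ ^ p) * ENNReal.ofReal (τ ^ (2 * (k : ℕ)))) := by
    rw [← ENNReal.ofReal_mul (by positivity), ← ENNReal.ofReal_mul (by positivity)]
    congr 1
    ring
  calc _ = ENNReal.ofReal τ * (ENNReal.ofReal (τ ^ p) *
        (c * (ENNReal.ofReal (τ ^ (2 * (k : ℕ))) * ‖A k‖ₑ ^ 2))) := by rw [h4]; ring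
    _ ≤ _ := by gcongr

/-- The poly-analytic functions which are homogeneous of degree `p` in `ζ₁`. -/
def monoPoly (p : ℕ) (a : Fin n → ℂ → ℂ) (ζ : ℂ × ℂ) : ℂ :=
  ζ.1 ^ p * ∑ k : Fin n, (height ζ : ℂ) ^ (k : ℕ) * a k ζ.2

theorem measurable_monoPoly (p : ℕ) {a : Fin n → ℂ → ℂ} (ha : ∀ k, Measurable (a k)) :
    Measurable (monoPoly p a) := by
  have h : Measurable height := by unfold height; fun_prop
  unfold monoPoly
  have h' : ∀ k, Measurable fun ζ : ℂ × ℂ => a k ζ.2 := fun k => (ha k).comp measurable_snd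
  refine (measurable_fst.pow_const p).mul (Finset.measurable_fun_sum _ fun k _ => ?_)
  exact ((Complex.measurable_ofReal.comp h).pow_const _).mul (h' k)

/-- For fixed `ζ₂ = w` the slice of the domain is the disc `|z|² < Im w`, on which the `a k w` are
constants. The disc estimate applies slice by slice and is then integrated over `w`. -/
theorem lintegral_weight_lt_top (p : ℕ) {a : Fin n → ℂ → ℂ} (ha : ∀ k, Measurable (a k))
    (h : ∫⁻ ζ, ‖monoPoly p a ζ‖ₑ ^ 2 ∂siegelMeasure < ⊤) (k : Fin n) :
    ∫⁻ y in Ioi (0 : ℝ), ENNReal.ofReal (y ^ (p + 1 + 2 * (k : ℕ))) *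
      (∫⁻ x : ℝ, ‖a k (x + y * Complex.I)‖ₑ ^ 2) < ⊤ := by
  obtain ⟨c, hc0, hc⟩ := exists_discFun_bound n p
  have hms := isOpen_siegel.measurableSet
  have h1 : ∫⁻ ζ, ‖monoPoly p a ζ‖ₑ ^ 2 ∂siegelMeasure =
      ∫⁻ w : ℂ, ∫⁻ z : ℂ, siegel.indicator (fun ζ => ‖monoPoly p a ζ‖ₑ ^ 2) (z, w) := by
    rw [siegelMeasure, ← lintegral_indicator hms]
    exact lintegral_prod_symm _
      (((measurable_monoPoly p ha).enorm.pow_const 2).indicator hms).aemeasurable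
  have h2 : ∀ w : ℂ, c * upperHalf.indicator (fun w : ℂ =>
      ENNReal.ofReal (w.im ^ (p + 1 + 2 * (k : ℕ))) * ‖a k w‖ₑ ^ 2) w ≤
      ∫⁻ z : ℂ, siegel.indicator (fun ζ => ‖monoPoly p a ζ‖ₑ ^ 2) (z, w) := by
    intro w
    by_cases hw : w ∈ upperHalf
    · rw [indicator_of_mem hw]
      refine (lintegral_disc_ge hc hw (fun k => a k w) k).trans (le_of_eq ?_)
      rw [← lintegral_indicator (measurableSet_lt (by fun_prop) (by fun_prop))]
      refine lintegral_congr fun z => ?_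
      by_cases hz : ‖z‖ ^ 2 < w.im
      · rw [indicator_of_mem (by exact hz), indicator_of_mem (mem_siegel.2 hz)]
        rfl
      · rw [indicator_of_notMem (by exact hz), indicator_of_notMem fun h => hz (mem_siegel.1 h)]
    · rw [indicator_of_notMem hw, mul_zero]
      exact zero_le
  have hmw : Measurable (upperHalf.indicator fun w : ℂ =>
      ENNReal.ofReal (w.im ^ (p + 1 + 2 * (k : ℕ))) * ‖a k w‖ₑ ^ 2) := by
    have := (ha k).enorm
    exact Measurable.indicator (by fun_prop) isOpen_upperHalf.measurableSet
  have h3 : ∫⁻ w, upperHalf.indicator (fun w : ℂ =>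
      ENNReal.ofReal (w.im ^ (p + 1 + 2 * (k : ℕ))) * ‖a k w‖ₑ ^ 2) w < ⊤ := by
    have h4 : c * ∫⁻ w, upperHalf.indicator (fun w : ℂ =>
        ENNReal.ofReal (w.im ^ (p + 1 + 2 * (k : ℕ))) * ‖a k w‖ₑ ^ 2) w < ⊤ := by
      rw [← lintegral_const_mul _ hmw]
      rw [h1] at h
      exact (lintegral_mono h2).trans_lt h
    by_contra h5
    rw [not_lt_top_iff.1 h5, ENNReal.mul_top hc0] at h4
    exact lt_irrefl _ h4
  refine lt_of_le_of_lt (le_of_eq ?_) h3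
  rw [← Complex.volume_preserving_equiv_real_prod.symm.lintegral_comp hmw,
    Measure.volume_eq_prod, lintegral_prod_symm (fun q => upperHalf.indicator (fun w : ℂ =>
      ENNReal.ofReal (w.im ^ (p + 1 + 2 * (k : ℕ))) * ‖a k w‖ₑ ^ 2)
        (Complex.measurableEquivRealProd.symm q)) (hmw.comp
      Complex.measurableEquivRealProd.symm.measurable).aemeasurable,
    ← lintegral_indicator measurableSet_Ioi]
  refine lintegral_congr fun y => ?_
  have hmk : Complex.measurableEquivRealProd.symm = fun q : ℝ × ℝ => (q.1 + q.2 * Complex.I : ℂ) := by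
    funext q
    rw [Complex.measurableEquivRealProd_symm_apply]
    exact Complex.mk_eq_add_mul_I _ _
  by_cases hy : 0 < y
  · rw [indicator_of_mem (mem_Ioi.2 hy), ← lintegral_const_mul' _ _ (by simp)]
    refine lintegral_congr fun x => ?_
    simp only [hmk]
    rw [indicator_of_mem (by simpa [upperHalf] using hy)]
    simp
  · rw [indicator_of_notMem (by simpa using hy)]
    refine (lintegral_eq_zero_of_ae_eq_zero (Eventually.of_forall fun x => ?_)).symm
    simp only [hmk]
    rw [indicator_of_notMem (by simpa [upperHalf] using hy)]
    rfl

end WeightedBounds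

/-! ### Homogeneous square-integrable poly-analytic functions are waves. -/

section Homogeneous

open FourierTransform

variable {n : ℕ}

theorem laguerreCoeff_injective {a : EuclideanSpace ℂ (Fin n)}
    (h : ∀ k : Fin n, laguerreCoeff a k = 0) : a = 0 := by
  have h1 : (fun j => a j) = 0 := by
    refine laguerreFun_linearIndependent _ fun y _ => ?_
    have h2 : ∑ j, a j * (laguerreFun j y : ℂ) = laguerreSum a y * (Real.exp (-y / 2) : ℂ) := by
      rw [laguerreSum, Finset.sum_mul]
      exact Finset.sum_congr rfl fun j _ => by rw [laguerreFun_eq_lagC, mul_assoc]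
    rw [h2, laguerreSum_eq]
    simp [h]
  ext j
  exact congrFun h1 j

/-- Every polynomial of degree less than `n` is a combination of the first `n` Laguerre
polynomials. -/
theorem exists_laguerreCoeff_inverse (n : ℕ) :
    ∃ S : (Fin n → ℂ) → EuclideanSpace ℂ (Fin n), Continuous S ∧
      ∀ c k, laguerreCoeff (S c) (k : Fin n) = c k := by
  let T : EuclideanSpace ℂ (Fin n) →ₗ[ℂ] (Fin n → ℂ) :=
    { toFun := fun a k => laguerreCoeff a k
      map_add' := fun a b => by
        funext k
        simp [laguerreCoeff, add_mul, Finset.sum_add_distrib]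
      map_smul' := fun c a => by
        funext k
        simp [laguerreCoeff, Finset.mul_sum, mul_assoc] }
  have hinj : Function.Injective T := by
    rw [injective_iff_map_eq_zero]
    exact fun a ha => laguerreCoeff_injective fun k => congrFun ha k
  let e := LinearEquiv.ofInjectiveOfFinrankEq T hinj (by simp)
  refine ⟨e.symm, LinearMap.continuous_of_finiteDimensional e.symm.toLinearMap, fun c k => ?_⟩
  exact congrFun (e.apply_symm_apply c) k

theorem quasiMeasurePreserving_baseMeasure :
    Measure.QuasiMeasurePreserving (fun q : ℂ × ℝ => q.2 + ‖q.1‖ ^ 2) baseMeasure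
      (volume.restrict (Ioi 0)) := by
  refine QuasiMeasurePreserving.prod_of_right (by fun_prop) (Eventually.of_forall fun z => ?_)
  have h : Measure.QuasiMeasurePreserving (fun v : ℝ => v + ‖z‖ ^ 2) volume volume :=
    (measurePreserving_add_right volume (‖z‖ ^ 2)).quasiMeasurePreserving
  exact h.restrict fun v (hv : 0 < v) => (by positivity : 0 < v + ‖z‖ ^ 2)

theorem waveAmp_eq (p : ℕ) {ψ : ℝ → EuclideanSpace ℂ (Fin n)} {h : Fin n → ℝ → ℂ}
    (h0 : ∀ k, ∀ t ≤ 0, h k t = 0)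
    (hψ : ∀ t, 0 < t → ∀ k : Fin n,
      monoNorm p t * laguerreCoeff (ψ t) k * (4 * Real.pi * t : ℝ) ^ (k : ℕ) = h k t)
    (q : ℂ × ℝ) (t : ℝ) : waveAmp p ψ q t = ∑ k : Fin n, (q.1 ^ p * (q.2 : ℂ) ^ (k : ℕ)) *
      (h k t * (Real.exp (-(2 * Real.pi * t * (q.2 + ‖q.1‖ ^ 2))) : ℂ)) := by
  by_cases ht : 0 < t
  · rw [waveAmp, indicator_of_mem (mem_Ioi.2 ht), amplitude, laguerreSum_eq]
    simp only [← hψ t ht, Finset.mul_sum, Finset.sum_mul]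
    refine Finset.sum_congr rfl fun k _ => ?_
    push_cast
    ring
  · rw [waveAmp, indicator_of_notMem (by simpa using ht)]
    simp [h0 _ t (not_lt.1 ht)]

theorem monoPoly_siegelCoord (p : ℕ) (a : Fin n → ℂ → ℂ) (q : ℂ × ℝ) (x : ℝ) :
    monoPoly p a (siegelCoord (q, x)) = ∑ k : Fin n, (q.1 ^ p * (q.2 : ℂ) ^ (k : ℕ)) *
      a k (x + (q.2 + ‖q.1‖ ^ 2 : ℝ) * Complex.I) := by
  rw [monoPoly, height_siegelCoord, siegelCoord_snd, siegelCoord_fst, Finset.mul_sum]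
  exact Finset.sum_congr rfl fun k _ => by ring

theorem exists_monoPoly_line {ι : Type*} [Fintype ι] (α : ι → ℂ) {f : ι → ℝ → ℂ} {g : ι → ℝ → ℂ}
    (h : ∀ k, ∃ hm : MemLp (f k) 2,
      (𝓕 hm.toLp : Lp ℂ 2 (volume : Measure ℝ)) =ᵐ[volume] g k) :
    ∃ hm : MemLp (fun x => ∑ k, α k * f k x) 2,
      (𝓕 hm.toLp : Lp ℂ 2 (volume : Measure ℝ)) =ᵐ[volume] fun t => ∑ k, α k * g k t := by
  choose hm hg using h
  have hM : MemLp (fun x => ∑ k, α k * f k x) 2 :=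
    memLp_finsetSum _ fun k _ => (hm k).const_mul (α k)
  refine ⟨hM, ?_⟩
  have h1 : hM.toLp = ∑ k, α k • (hm k).toLp := by
    refine Lp.ext ?_
    have h2 : ∀ᵐ x, ∀ k, (α k • (hm k).toLp : Lp ℂ 2 (volume : Measure ℝ)) x = α k * f k x :=
      ae_all_iff.2 fun k => by
        filter_upwards [Lp.coeFn_smul (α k) (hm k).toLp, (hm k).coeFn_toLp] with x h3 h4
        rw [h3, Pi.smul_apply, h4, smul_eq_mul]
    filter_upwards [hM.coeFn_toLp, Lp.coeFn_finsetSum Finset.univ fun k => α k • (hm k).toLp, h2]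
      with x h3 h4 h5
    rw [h3, h4, Finset.sum_apply]
    exact Finset.sum_congr rfl fun k _ => (h5 k).symm
  have h6 : (𝓕 hM.toLp : Lp ℂ 2 (volume : Measure ℝ)) = ∑ k, α k • 𝓕 (hm k).toLp := by
    rw [h1]
    have := map_sum (Lp.fourierTransformₗᵢ ℝ ℂ) (fun k => α k • (hm k).toLp) Finset.univ
    simp only [map_smul] at this
    exact this
  rw [h6]
  have h7 : ∀ᵐ x, ∀ k, (α k • 𝓕 (hm k).toLp : Lp ℂ 2 (volume : Measure ℝ)) x = α k * g k x :=
    ae_all_iff.2 fun k => by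
      filter_upwards [Lp.coeFn_smul (α k) (𝓕 (hm k).toLp), hg k] with x h3 h4
      rw [h3, Pi.smul_apply, h4, smul_eq_mul]
  filter_upwards [Lp.coeFn_finsetSum Finset.univ fun k => α k • 𝓕 (hm k).toLp, h7] with x h8 h9
  rw [h8, Finset.sum_apply]
  exact Finset.sum_congr rfl fun k _ => h9 k

/-- Square-integrable poly-analytic functions which are homogeneous in `ζ₁` are waves. -/
theorem exists_waveOp_eq_monoPoly (p : ℕ) {a : Fin n → ℂ → ℂ} (ha : ∀ k, Measurable (a k))
    (hd : ∀ k, DifferentiableOn ℂ (a k) upperHalf)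
    (hF : ∫⁻ ζ, ‖monoPoly p a ζ‖ₑ ^ 2 ∂siegelMeasure < ⊤) :
    ∃ ψ : L2Freq n, waveOp n p ψ =ᵐ[siegelMeasure] monoPoly p a := by
  choose h hsm h0 hline using fun k =>
    exists_fourier_line (ha k) (hd k) (lintegral_weight_lt_top p ha hF k)
  obtain ⟨S, hS, hSc⟩ := exists_laguerreCoeff_inverse n
  -- The vector whose Laguerre expansion has the prescribed coefficients of `v^k`, after division by
  -- the normalisation and by `(4πt)^k`.
  let ψ : ℝ → EuclideanSpace ℂ (Fin n) := fun t =>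
    S fun k => h k t * ((monoNorm p t * (4 * Real.pi * t) ^ (k : ℕ))⁻¹ : ℝ)
  have hψm : StronglyMeasurable ψ := by
    refine hS.comp_stronglyMeasurable (Measurable.stronglyMeasurable (measurable_pi_lambda _
      fun k => (hsm k).measurable.mul (Complex.measurable_ofReal.comp ?_)))
    have := (continuous_monoNorm p).measurable
    fun_prop
  have hψ : ∀ t, 0 < t → ∀ k : Fin n,
      monoNorm p t * laguerreCoeff (ψ t) k * (4 * Real.pi * t : ℝ) ^ (k : ℕ) = h k t := by
    intro t ht k
    have h1 : monoNorm p t * (4 * Real.pi * t) ^ (k : ℕ) ≠ 0 :=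
      mul_ne_zero (monoNorm_pos p ht).ne' (by positivity)
    have h2 : ((monoNorm p t * (4 * Real.pi * t) ^ (k : ℕ) : ℝ) : ℂ) ≠ 0 := by exact_mod_cast h1
    rw [hSc, mul_right_comm, ← Complex.ofReal_pow, ← Complex.ofReal_mul, Complex.ofReal_inv,
      mul_comm (h k t), mul_inv_cancel_left₀ h2]
  -- For almost every slice `(z, v)` the line at height `v + |z|²` is a good one for all `a k`
  -- simultaneously.
  have hq : ∀ᵐ q ∂baseMeasure, ∃ hm : MemLp (fun x => monoPoly p a (siegelCoord (q, x))) 2,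
      (𝓕 hm.toLp : Lp ℂ 2 (volume : Measure ℝ)) =ᵐ[volume] waveAmp p ψ q := by
    filter_upwards [quasiMeasurePreserving_baseMeasure.ae (ae_all_iff.2 hline)] with q hq
    obtain ⟨hm, hm'⟩ := exists_monoPoly_line (fun k : Fin n => q.1 ^ p * (q.2 : ℂ) ^ (k : ℕ)) hq
    have e1 : (fun x => monoPoly p a (siegelCoord (q, x))) = fun x : ℝ => ∑ k : Fin n,
        (q.1 ^ p * (q.2 : ℂ) ^ (k : ℕ)) * a k (x + (q.2 + ‖q.1‖ ^ 2 : ℝ) * Complex.I) :=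
      funext fun x => monoPoly_siegelCoord p a q x
    have e2 : waveAmp p ψ q = fun t => ∑ k : Fin n, (q.1 ^ p * (q.2 : ℂ) ^ (k : ℕ)) *
      (h k t * (Real.exp (-(2 * Real.pi * t * (q.2 + ‖q.1‖ ^ 2))) : ℂ)) :=
      funext fun t => waveAmp_eq p h0 hψ q t
    simp only [e1]
    rw [e2]
    exact ⟨hm, hm'⟩
  have hmeas : Measurable fun x : (ℂ × ℝ) × ℝ => monoPoly p a (siegelCoord x) :=
    (measurable_monoPoly p ha).comp siegelCoord.continuous.measurable
  -- Read backwards, the isometry gives square-integrability of `ψ`: its norm equals that of the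
  -- amplitudes, which by Plancherel is the given finite norm.
  have hψ2 : MemLp ψ 2 (volume.restrict (Ioi 0)) := by
    refine memLp_two_of_lintegral hψm.aestronglyMeasurable ?_
    rw [← lintegral_waveAmp p hψm]
    refine lt_of_le_of_lt (le_of_eq ?_) hF
    rw [← measurePreserving_siegelCoord.lintegral_comp_emb measurableEmbedding_siegelCoord,
      lintegral_prod _ (hmeas.enorm.pow_const 2).aemeasurable]
    refine lintegral_congr_ae ?_
    filter_upwards [hq] with q ⟨hm, hm'⟩
    rw [← enorm_fourier_toLp hm]
    refine lintegral_congr_ae ?_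
    filter_upwards [hm'] with t ht
    rw [ht]
  have hae : ∀ᵐ x ∂baseMeasure.prod volume,
      monoPoly p a (siegelCoord x) = 𝓕⁻ (waveAmp p ψ x.1) x.2 := by
    rw [Measure.ae_prod_iff_ae_ae (measurableSet_eq_fun hmeas
      (stronglyMeasurable_fiberwise_fourierInv (stronglyMeasurable_waveAmp p hψm)).measurable)]
    filter_upwards [hq, ae_waveAmp p hψm hψ2] with q ⟨hm, hm'⟩ ⟨h1, h2⟩
    have h3 : (𝓕 hm.toLp : Lp ℂ 2 (volume : Measure ℝ)) = h2.toLp :=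
      Lp.ext (hm'.trans h2.coeFn_toLp.symm)
    have h4 : hm.toLp = 𝓕⁻ h2.toLp := by
      rw [← h3]
      exact ((Lp.fourierTransformₗᵢ ℝ ℂ).symm_apply_apply hm.toLp).symm
    filter_upwards [hm.coeFn_toLp, coeFn_fourierInv_toLp h1 h2] with x h5 h6
    rw [← h5, h4, h6]
  refine ⟨hψ2.toLp, ?_⟩
  have h7 : ∀ᵐ ζ ∂siegelMeasure, monoWave p ψ ζ = monoPoly p a ζ := by
    rw [← measurePreserving_siegelCoord.map_eq, measurableEmbedding_siegelCoord.ae_map_iff]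
    filter_upwards [hae] with x hx
    rw [hx, monoWave_siegelCoord]
  filter_upwards [coeFn_waveOp p hψ2.toLp, h7] with ζ h8 h9
  rw [h8, monoWave, wave_congr_ae _ _ _ hψ2.coeFn_toLp]
  exact h9

end Homogeneous

/-! ### Taylor coefficients in the first variable. -/

section TaylorCoefficients

/-- The derivative in the first coordinate. -/
def derivFst (g : ℂ × ℂ → ℂ) (ζ : ℂ × ℂ) : ℂ := fderiv ℝ g ζ (1, 0)

theorem IsHolo.fderiv_I {g : ℂ × ℂ → ℂ} (hg : IsHolo g) {ζ : ℂ × ℂ} (hζ : ζ ∈ siegel) (v : ℂ × ℂ) :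
    fderiv ℝ g ζ (Complex.I • v) = Complex.I * fderiv ℝ g ζ v := by
  rw [((hg.hasFDerivAt hζ).restrictScalars ℝ).fderiv]
  simp only [ContinuousLinearMap.coe_restrictScalars', map_smul, smul_eq_mul]

theorem IsHolo.derivFst {g : ℂ × ℂ → ℂ} (hg : IsHolo g) : IsHolo (derivFst g) := by
  have hs := smooth_fderiv_apply hg.smooth (1, 0)
  have h : ∀ ζ ∈ siegel, ∀ v : ℂ × ℂ, fderiv ℝ (SiegelToeplitz.derivFst g) ζ (Complex.I • v) =
      Complex.I * fderiv ℝ (SiegelToeplitz.derivFst g) ζ v := by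
    intro ζ hζ v
    have h1 : EqOn (fun η => fderiv ℝ g η (Complex.I • v))
        (fun η => Complex.I • fderiv ℝ g η v) siegel := fun η hη => hg.fderiv_I hη v
    have h2 := differentiableAt_of_smooth (smooth_fderiv_apply hg.smooth v) hζ
    have h3 : fderiv ℝ (fun η => Complex.I • fderiv ℝ g η v) ζ =
        Complex.I • fderiv ℝ (fun η => fderiv ℝ g η v) ζ := fderiv_fun_const_smul h2 _
    unfold SiegelToeplitz.derivFst
    rw [fderiv_fderiv_apply hg.smooth hζ (1, 0) (Complex.I • v),
      fderiv_fderiv_apply hg.smooth hζ (1, 0) v, fderiv_congr_siegel h1 hζ, h3]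
    rfl
  refine ⟨hs, fun ζ hζ => ?_, fun ζ hζ => ?_⟩
  · have := h ζ hζ (1, 0)
    rw [Prod.smul_mk, smul_eq_mul, mul_one, smul_zero] at this
    rw [dbar₁, this, ← mul_assoc, Complex.I_mul_I]
    ring
  · have := h ζ hζ (0, 1)
    rw [Prod.smul_mk, smul_zero, smul_eq_mul, mul_one] at this
    rw [dbar₂, this, ← mul_assoc, Complex.I_mul_I]
    ring

theorem IsHolo.derivFst_iterate {g : ℂ × ℂ → ℂ} (hg : IsHolo g) (p : ℕ) :
    IsHolo (SiegelToeplitz.derivFst^[p] g) := by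
  induction p with
  | zero => exact hg
  | succ p ih =>
    rw [Function.iterate_succ_apply']
    exact ih.derivFst

theorem IsHolo.hasDerivAt_fst {g : ℂ × ℂ → ℂ} (hg : IsHolo g) {z w : ℂ} (h : (z, w) ∈ siegel) :
    HasDerivAt (fun x => g (x, w)) (SiegelToeplitz.derivFst g (z, w)) z := by
  have h1 : HasDerivAt (fun x : ℂ => (x, w)) (1, 0) z :=
    (hasDerivAt_id z).prodMk (hasDerivAt_const z w)
  have h2 : HasDerivAt (fun x => g (x, w)) _ z := (hg.hasFDerivAt h).comp_hasDerivAt z h1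
  simpa [SiegelToeplitz.derivFst] using h2

theorem IsHolo.differentiableAt_snd {g : ℂ × ℂ → ℂ} (hg : IsHolo g) {z w : ℂ}
    (h : (z, w) ∈ siegel) : DifferentiableAt ℂ (fun x => g (z, x)) w := by
  have h1 : HasDerivAt (fun x : ℂ => (z, x)) (0, 1) w :=
    (hasDerivAt_const w z).prodMk (hasDerivAt_id w)
  exact ((hg.hasFDerivAt h).comp_hasDerivAt w h1).differentiableAt

theorem IsHolo.iteratedDeriv_fst {g : ℂ × ℂ → ℂ} (hg : IsHolo g) (p : ℕ) {z w : ℂ}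
    (h : (z, w) ∈ siegel) :
    iteratedDeriv p (fun x => g (x, w)) z = (SiegelToeplitz.derivFst^[p] g) (z, w) := by
  induction p generalizing g with
  | zero => simp
  | succ p ih =>
    rw [iteratedDeriv_succ', Function.iterate_succ_apply, ← ih hg.derivFst]
    refine Filter.EventuallyEq.iteratedDeriv_eq p ?_
    have h1 : ∀ᶠ x in 𝓝 z, (x, w) ∈ siegel :=
      (by fun_prop : ContinuousAt (fun x : ℂ => (x, w)) z).eventually (isOpen_siegel.mem_nhds h)
    filter_upwards [h1] with x hx
    exact (hg.hasDerivAt_fst hx).deriv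

/-- The coefficient of `z ^ p` in the expansion of `g (z, w)`. -/
def taylorFst (p : ℕ) (g : ℂ × ℂ → ℂ) : ℂ → ℂ :=
  upperHalf.indicator fun w => (derivFst^[p] g) (0, w) / p.factorial

theorem zero_mem_siegel {w : ℂ} (hw : w ∈ upperHalf) : ((0 : ℂ), w) ∈ siegel :=
  mem_siegel.2 (by simpa [upperHalf] using hw)

theorem IsHolo.differentiableOn_taylorFst {g : ℂ × ℂ → ℂ} (hg : IsHolo g) (p : ℕ) :
    DifferentiableOn ℂ (taylorFst p g) upperHalf := by
  refine DifferentiableOn.congr (f := fun w => (SiegelToeplitz.derivFst^[p] g) (0, w) / p.factorial)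
    (fun w hw => ?_) fun w hw => indicator_of_mem hw _
  exact (((hg.derivFst_iterate p).differentiableAt_snd (zero_mem_siegel hw)).div_const
    _).differentiableWithinAt

theorem measurable_indicator_of_continuousOn {X : Type*} [TopologicalSpace X] [MeasurableSpace X]
    [OpensMeasurableSpace X] {s : Set X} (hs : IsOpen s) {f : X → ℂ} (hf : ContinuousOn f s) :
    Measurable (s.indicator f) := by
  classical
  rw [← piecewise_eq_indicator]
  exact hf.measurable_piecewise continuousOn_const hs.measurableSet

theorem IsHolo.measurable_taylorFst {g : ℂ × ℂ → ℂ} (hg : IsHolo g) (p : ℕ) :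
    Measurable (taylorFst p g) := by
  have h : taylorFst p g = upperHalf.indicator (taylorFst p g) := by
    rw [taylorFst, indicator_indicator, inter_self]
  rw [h]
  exact measurable_indicator_of_continuousOn isOpen_upperHalf
    (hg.differentiableOn_taylorFst p).continuousOn

/-- For fixed `w` the slice is the full disc `|z| < √(Im w)`, on which the Taylor series at `0`
converges to the function. -/
theorem IsHolo.eq_zero_of_taylorFst {g : ℂ × ℂ → ℂ} (hg : IsHolo g)
    (h : ∀ p, ∀ w ∈ upperHalf, taylorFst p g w = 0) {ζ : ℂ × ℂ} (hζ : ζ ∈ siegel) : g ζ = 0 := by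
  obtain ⟨z, w⟩ := ζ
  have hz : ‖z‖ ^ 2 < w.im := mem_siegel.1 hζ
  have hw : w ∈ upperHalf := (sq_nonneg _).trans_lt hz
  have hball : ∀ x ∈ Metric.ball (0 : ℂ) √w.im, (x, w) ∈ siegel := fun x hx =>
    mem_siegel.2 ((Real.lt_sqrt (norm_nonneg _)).1 (by simpa using hx))
  have h1 := Complex.hasSum_taylorSeries_on_ball (f := fun x => g (x, w)) (c := 0) (r := √w.im)
    (fun x hx => (hg.hasDerivAt_fst (hball x hx)).differentiableAt.differentiableWithinAt)
    (z := z) (by simpa using (Real.lt_sqrt (norm_nonneg _)).2 hz)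
  have h2 : ∀ p, (SiegelToeplitz.derivFst^[p] g) (0, w) = 0 := by
    intro p
    have := h p w hw
    rw [taylorFst, indicator_of_mem hw, div_eq_zero_iff] at this
    exact this.resolve_right (by exact_mod_cast p.factorial_ne_zero)
  simp only [hg.iteratedDeriv_fst _ (zero_mem_siegel hw), h2, smul_zero] at h1
  exact h1.unique hasSum_zero

/-- The normalised arc length on the unit circle, in the angular coordinate. -/
def angleMeasure : Measure ℝ :=
  (ENNReal.ofReal (2 * Real.pi))⁻¹ • volume.restrict (Ioc 0 (2 * Real.pi))

instance : IsProbabilityMeasure angleMeasure := by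
  refine ⟨?_⟩
  have h : ENNReal.ofReal (2 * Real.pi) ≠ 0 := by
    simpa using Real.pi_pos
  simp only [angleMeasure, Measure.smul_apply, Measure.restrict_apply_univ, Real.volume_Ioc,
    sub_zero, smul_eq_mul]
  exact ENNReal.inv_mul_cancel h ENNReal.ofReal_ne_top

/-- Cauchy's formula on the unit circle for `x ↦ g (x z, w)`. -/
theorem IsHolo.integral_angle {g : ℂ × ℂ → ℂ} (hg : IsHolo g) (p : ℕ) {ζ : ℂ × ℂ}
    (hζ : ζ ∈ siegel) :
    ∫ θ, (starRingEnd ℂ) ((Circle.exp θ : ℂ) ^ p) * g (rotateFst (Circle.exp θ) ζ) ∂angleMeasure =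
      ζ.1 ^ p * taylorFst p g ζ.2 := by
  obtain ⟨z, w⟩ := ζ
  have hz : ‖z‖ ^ 2 < w.im := mem_siegel.1 hζ
  have hw : w ∈ upperHalf := (sq_nonneg _).trans_lt hz
  rw [taylorFst, indicator_of_mem hw]
  -- A radius `R > 1` leaves the closed unit disc inside the region of holomorphy. For `z = 0` every
  -- radius works, and `2` is chosen.
  obtain ⟨R, hR1, hR⟩ : ∃ R : ℝ, 1 < R ∧ ∀ x ∈ Metric.ball (0 : ℂ) R, (x * z, w) ∈ siegel := by
    by_cases hz0 : z = 0
    · exact ⟨2, one_lt_two, fun x _ => by simpa [hz0] using zero_mem_siegel hw⟩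
    · have hz1 : 0 < ‖z‖ := norm_pos_iff.2 hz0
      refine ⟨√w.im / ‖z‖, (one_lt_div hz1).2 ((Real.lt_sqrt hz1.le).2 hz), fun x hx => ?_⟩
      refine mem_siegel.2 ((Real.lt_sqrt (norm_nonneg _)).1 ?_)
      rw [norm_mul]
      exact (lt_div_iff₀ hz1).1 (by simpa using hx)
  have hd1 : ∀ h : ℂ × ℂ → ℂ, IsHolo h → ∀ x ∈ Metric.ball (0 : ℂ) R,
      HasDerivAt (fun x => h (x * z, w)) (z * SiegelToeplitz.derivFst h (x * z, w)) x := by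
    intro h hh x hx
    have h1 : HasDerivAt (fun x : ℂ => x * z) z x := by simpa using (hasDerivAt_id x).mul_const z
    have h2 : HasDerivAt (fun x => h (x * z, w)) _ x :=
      HasDerivAt.comp (h₂ := fun x => h (x, w)) x (hh.hasDerivAt_fst (hR x hx)) h1
    rwa [mul_comm] at h2
  have hd2 : ∀ (q : ℕ) (h : ℂ × ℂ → ℂ), IsHolo h → ∀ x ∈ Metric.ball (0 : ℂ) R,
      iteratedDeriv q (fun x => h (x * z, w)) x =
        z ^ q * (SiegelToeplitz.derivFst^[q] h) (x * z, w) := by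
    intro q
    induction q with
    | zero => simp
    | succ q ih =>
      intro h hh x hx
      have h1 : deriv (fun x => h (x * z, w)) =ᶠ[𝓝 x]
          fun x => z * SiegelToeplitz.derivFst h (x * z, w) := by
        filter_upwards [Metric.isOpen_ball.mem_nhds hx] with y hy
        exact (hd1 h hh y hy).deriv
      rw [iteratedDeriv_succ', h1.iteratedDeriv_eq, iteratedDeriv_const_mul_field,
        ih _ hh.derivFst x hx, Function.iterate_succ_apply, pow_succ']
      ring
  have hd : DifferentiableOn ℂ (fun x => g (x * z, w)) (Metric.ball 0 R) := fun x hx =>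
    (hd1 g hg x hx).differentiableAt.differentiableWithinAt
  have h1 := (hd.mono (Metric.closedBall_subset_ball hR1)).circleIntegral_one_div_sub_center_pow_smul
    one_pos p
  rw [hd2 p g hg 0 (Metric.mem_ball_self (one_pos.trans hR1)), zero_mul, circleIntegral] at h1
  have h2 : ∀ θ : ℝ, deriv (circleMap 0 1) θ • (1 / (circleMap 0 1 θ - 0) ^ (p + 1)) •
      g (circleMap 0 1 θ * z, w) = Complex.I * ((starRingEnd ℂ) ((Circle.exp θ : ℂ) ^ p) *
        g (rotateFst (Circle.exp θ) (z, w))) := by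
    intro θ
    have e1 : circleMap 0 1 θ = Circle.exp θ := by simp [circleMap]
    have e2 : (starRingEnd ℂ) (Circle.exp θ : ℂ) = (Circle.exp θ : ℂ)⁻¹ := by
      rw [← Circle.coe_inv, Circle.coe_inv_eq_conj]
    rw [deriv_circleMap, e1, sub_zero, map_pow, e2, rotateFst_apply]
    simp only [smul_eq_mul, inv_pow]
    have := Circle.coe_ne_zero (Circle.exp θ)
    field_simp
    ring
  simp only [h2] at h1
  rw [intervalIntegral.integral_const_mul,
    intervalIntegral.integral_of_le (by positivity)] at h1
  rw [angleMeasure, integral_smul_measure,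
    ENNReal.toReal_inv, ENNReal.toReal_ofReal (by positivity)]
  have h3 : Complex.I ≠ 0 := Complex.I_ne_zero
  have h4 : (Real.pi : ℂ) ≠ 0 := by exact_mod_cast Real.pi_ne_zero
  rw [Complex.real_smul]
  simp only [smul_eq_mul] at h1
  have h5 := mul_left_cancel₀ h3 (h1.trans (by ring : _ = Complex.I * (2 * Real.pi / p.factorial *
    (z ^ p * (SiegelToeplitz.derivFst^[p] g) (0, w)))))
  rw [h5]
  push_cast
  field_simp

end TaylorCoefficients

/-! ### The waves span the whole space. -/

section Totality

open scoped InnerProductSpace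

variable {n : ℕ}

instance : SFinite siegelMeasure := inferInstanceAs (SFinite (volume.restrict siegel))

theorem continuous_rotateFst_exp :
    Continuous fun x : (ℂ × ℂ) × ℝ => rotateFst (Circle.exp x.2) x.1 := by
  simp only [rotateFst_apply]
  fun_prop

/-- The component of degree `p` of a function under the rotations of the first coordinate. -/
def rotationMode (p : ℕ) (F : ℂ × ℂ → ℂ) (ζ : ℂ × ℂ) : ℂ :=
  ∫ θ, (starRingEnd ℂ) ((Circle.exp θ : ℂ) ^ p) * F (rotateFst (Circle.exp θ) ζ) ∂angleMeasure

theorem measurable_rotate {p : ℕ} {F : ℂ × ℂ → ℂ} (hF : Measurable F) :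
    Measurable fun x : (ℂ × ℂ) × ℝ =>
      (starRingEnd ℂ) ((Circle.exp x.2 : ℂ) ^ p) * F (rotateFst (Circle.exp x.2) x.1) := by
  refine Measurable.mul ?_ (hF.comp continuous_rotateFst_exp.measurable)
  exact Continuous.measurable (by fun_prop)

theorem lintegral_rotate {F : ℂ × ℂ → ℂ} (hF : Measurable F) (p : ℕ) :
    ∫⁻ x, ‖(starRingEnd ℂ) ((Circle.exp x.2 : ℂ) ^ p) * F (rotateFst (Circle.exp x.2) x.1)‖ₑ ^ 2
      ∂(siegelMeasure.prod angleMeasure) = ∫⁻ ζ, ‖F ζ‖ₑ ^ 2 ∂siegelMeasure := by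
  rw [lintegral_prod_symm _ ((measurable_rotate hF).enorm.pow_const 2).aemeasurable]
  have h : ∀ θ : ℝ, ∫⁻ ζ, ‖(starRingEnd ℂ) ((Circle.exp θ : ℂ) ^ p) *
      F (rotateFst (Circle.exp θ) ζ)‖ₑ ^ 2 ∂siegelMeasure = ∫⁻ ζ, ‖F ζ‖ₑ ^ 2 ∂siegelMeasure := by
    intro θ
    conv_rhs => rw [← (measurePreserving_rotateFst (Circle.exp θ)).lintegral_comp_emb
      (rotateFst _).measurableEmbedding]
    refine lintegral_congr fun ζ => ?_
    have : ‖(starRingEnd ℂ) ((Circle.exp θ : ℂ) ^ p)‖ₑ = 1 := by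
      rw [← ofReal_norm, RCLike.norm_conj, norm_pow, Circle.norm_coe]
      simp
    rw [enorm_mul, this, one_mul]
  simp only [h, lintegral_const, measure_univ, mul_one]

/-- Cauchy–Schwarz for the probability measure on the circle, followed by rotation invariance of the
measure on the domain. -/
theorem lintegral_rotationMode_le {F : ℂ × ℂ → ℂ} (hF : Measurable F) (p : ℕ) :
    ∫⁻ ζ, ‖rotationMode p F ζ‖ₑ ^ 2 ∂siegelMeasure ≤ ∫⁻ ζ, ‖F ζ‖ₑ ^ 2 ∂siegelMeasure := by
  rw [← lintegral_rotate hF p,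
    lintegral_prod _ ((measurable_rotate hF).enorm.pow_const 2).aemeasurable]
  refine lintegral_mono fun ζ => ?_
  have h1 := sq_lintegral_le angleMeasure (f := fun θ => ‖(starRingEnd ℂ) ((Circle.exp θ : ℂ) ^ p) *
      F (rotateFst (Circle.exp θ) ζ)‖ₑ)
    ((measurable_rotate (p := p) hF).comp measurable_prodMk_left).enorm.aemeasurable
  rw [measure_univ, one_mul] at h1
  refine le_trans ?_ h1
  gcongr
  exact enorm_integral_le_lintegral_enorm _

/-- A wave of degree `p` is multiplied by `c^p` under rotation, so after a change of variables the
average over angles is over a constant: such a wave sees only the mode `p`. -/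
theorem integral_conj_monoWave_mul_rotationMode {F : ℂ × ℂ → ℂ} (hF : Measurable F)
    (hF2 : ∫⁻ ζ, ‖F ζ‖ₑ ^ 2 ∂siegelMeasure < ⊤) (p : ℕ) (ψ : L2Freq n) :
    ∫ ζ, rotationMode p F ζ * (starRingEnd ℂ) (monoWave p ψ ζ) ∂siegelMeasure =
      ∫ ζ, F ζ * (starRingEnd ℂ) (monoWave p ψ ζ) ∂siegelMeasure := by
  have hW := memLp_monoWave p (Lp.stronglyMeasurable ψ) (Lp.memLp ψ)
  have h1 : MemLp (fun x : (ℂ × ℂ) × ℝ => (starRingEnd ℂ) ((Circle.exp x.2 : ℂ) ^ p) *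
      F (rotateFst (Circle.exp x.2) x.1)) 2 (siegelMeasure.prod angleMeasure) :=
    memLp_two_of_lintegral (measurable_rotate hF).aestronglyMeasurable
      (by rwa [lintegral_rotate hF p])
  have h2 : MemLp (fun x : (ℂ × ℂ) × ℝ => (starRingEnd ℂ) (monoWave p ψ x.1)) 2
      (siegelMeasure.prod angleMeasure) := (hW.comp_fst angleMeasure).star
  have h3 : Integrable (fun x : (ℂ × ℂ) × ℝ => ((starRingEnd ℂ) ((Circle.exp x.2 : ℂ) ^ p) *
      F (rotateFst (Circle.exp x.2) x.1)) * (starRingEnd ℂ) (monoWave p ψ x.1))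
      (siegelMeasure.prod angleMeasure) := h1.integrable_mul h2
  have h4 : ∀ θ : ℝ, ∫ ζ, ((starRingEnd ℂ) ((Circle.exp θ : ℂ) ^ p) *
      F (rotateFst (Circle.exp θ) ζ)) * (starRingEnd ℂ) (monoWave p ψ ζ) ∂siegelMeasure =
      ∫ ζ, F ζ * (starRingEnd ℂ) (monoWave p ψ ζ) ∂siegelMeasure := by
    intro θ
    conv_rhs => rw [← (measurePreserving_rotateFst (Circle.exp θ)).integral_comp
      (rotateFst _).measurableEmbedding]
    refine integral_congr_ae (Eventually.of_forall fun ζ => ?_)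
    simp only [monoWave_rotateFst, map_mul]
    ring
  simp only [rotationMode, ← integral_mul_const]
  rw [integral_integral_swap h3]
  simp only [h4, integral_const, probReal_univ, one_smul]

theorem eq_zero_of_sum_pow_eq_zero {δ : ℝ} (hδ : 0 < δ) {B : Fin n → ℂ}
    (h : ∀ r ∈ Ioo 0 δ, ∑ k : Fin n, (r : ℂ) ^ (k : ℕ) * B k = 0) (k : Fin n) : B k = 0 := by
  let P : Polynomial ℂ := ∑ k : Fin n, Polynomial.C (B k) * Polynomial.X ^ (k : ℕ)
  have hP : P = 0 := by
    refine Polynomial.eq_zero_of_infinite_isRoot P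
      (((Ioo_infinite hδ).image Complex.ofReal_injective.injOn).mono ?_)
    rintro _ ⟨r, hr, rfl⟩
    change P.eval (r : ℂ) = 0
    simp only [P, Polynomial.eval_finsetSum, Polynomial.eval_mul, Polynomial.eval_C,
      Polynomial.eval_pow, Polynomial.eval_X]
    rw [← h r hr]
    exact Finset.sum_congr rfl fun k _ => mul_comm _ _
  have h1 : P.coeff k = B k := by
    simp only [P, Polynomial.finsetSum_coeff, Polynomial.coeff_C_mul_X_pow]
    rw [Finset.sum_eq_single k]
    · simp
    · intro j _ hj
      rw [if_neg fun h => hj (Fin.ext h.symm)]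
    · simp
  rw [← h1, hP, Polynomial.coeff_zero]

/-- By continuity the function vanishes everywhere on the domain. For fixed `w`, varying `|z|` lets
the height run through `(0, Im w)`, and a polynomial in the height vanishes there. -/
theorem eq_zero_of_monoPoly_ae_eq_zero {p : ℕ} {a : Fin n → ℂ → ℂ}
    (hd : ∀ k, ContinuousOn (a k) upperHalf) (h : monoPoly p a =ᵐ[siegelMeasure] 0) (k : Fin n)
    {w : ℂ} (hw : w ∈ upperHalf) : a k w = 0 := by
  have hcont : ContinuousOn (monoPoly p a) siegel := by
    have hh : Continuous height := by unfold height; fun_prop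
    refine (continuous_fst.pow p).continuousOn.mul (continuousOn_finsetSum _ fun k _ => ?_)
    refine ((Complex.continuous_ofReal.comp hh).pow _).continuousOn.mul
      ((hd k).comp continuous_snd.continuousOn fun ζ hζ => ?_)
    exact (sq_nonneg _).trans_lt (mem_siegel.1 hζ)
  have h0 : EqOn (monoPoly p a) 0 siegel :=
    Measure.eqOn_open_of_ae_eq h isOpen_siegel hcont continuousOn_const
  refine eq_zero_of_sum_pow_eq_zero (δ := w.im) hw (B := fun k => a k w) (fun r hr => ?_) k
  have h1 : 0 < w.im - r := sub_pos.2 hr.2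
  have h2 : ‖((√(w.im - r) : ℝ) : ℂ)‖ ^ 2 = w.im - r := by
    rw [Complex.norm_real, Real.norm_eq_abs, sq_abs, Real.sq_sqrt h1.le]
  have h3 := h0 (x := (((√(w.im - r) : ℝ) : ℂ), w)) (mem_siegel.2 (by
    change ‖((√(w.im - r) : ℝ) : ℂ)‖ ^ 2 < w.im
    rw [h2]
    linarith [hr.1]))
  have h4 : height (((√(w.im - r) : ℝ) : ℂ), w) = r := by
    simp only [height, h2]
    ring
  simp only [monoPoly, h4, Pi.zero_apply] at h3
  refine (mul_eq_zero.1 h3).resolve_left (pow_ne_zero _ ?_)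
  exact_mod_cast (Real.sqrt_pos.2 h1).ne'

theorem rotationMode_eq_monoPoly {g : Fin n → ℂ × ℂ → ℂ} (hg : ∀ k, IsHolo (g k)) (p : ℕ)
    {ζ : ℂ × ℂ} (hζ : ζ ∈ siegel) :
    rotationMode p (siegel.indicator (∑ k : Fin n, heightC ^ (k : ℕ) * g k)) ζ =
      monoPoly p (fun k => taylorFst p (g k)) ζ := by
  have hrot : ∀ θ : ℝ, rotateFst (Circle.exp θ) ζ ∈ siegel := fun θ => by
    change 0 < height _
    rw [height_rotateFst]
    exact hζ
  have h1 : ∀ θ : ℝ, (starRingEnd ℂ) ((Circle.exp θ : ℂ) ^ p) *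
      siegel.indicator (∑ k : Fin n, heightC ^ (k : ℕ) * g k) (rotateFst (Circle.exp θ) ζ) =
      ∑ k : Fin n, heightC ζ ^ (k : ℕ) * ((starRingEnd ℂ) ((Circle.exp θ : ℂ) ^ p) *
        g k (rotateFst (Circle.exp θ) ζ)) := by
    intro θ
    rw [indicator_of_mem (hrot θ), Finset.sum_apply, Finset.mul_sum]
    refine Finset.sum_congr rfl fun k _ => ?_
    simp only [Pi.mul_apply, Pi.pow_apply, heightC, height_rotateFst]
    ring
  have h2 : ∀ k : Fin n, Integrable (fun θ : ℝ => heightC ζ ^ (k : ℕ) *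
      ((starRingEnd ℂ) ((Circle.exp θ : ℂ) ^ p) * g k (rotateFst (Circle.exp θ) ζ)))
      angleMeasure := by
    intro k
    have hr : Continuous fun θ : ℝ => rotateFst (Circle.exp θ) ζ := by
      simp only [rotateFst_apply]
      fun_prop
    have h3 : Continuous fun θ : ℝ => g k (rotateFst (Circle.exp θ) ζ) :=
      ContinuousOn.comp_continuous (g := g k) (hg k).smooth.continuousOn hr hrot
    have h4 : Continuous fun θ : ℝ => (starRingEnd ℂ) ((Circle.exp θ : ℂ) ^ p) := by fun_prop
    have hc : Continuous fun θ : ℝ => heightC ζ ^ (k : ℕ) *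
        ((starRingEnd ℂ) ((Circle.exp θ : ℂ) ^ p) * g k (rotateFst (Circle.exp θ) ζ)) :=
      continuous_const.mul (h4.mul h3)
    refine Integrable.smul_measure ?_ (by simp [Real.pi_pos])
    exact (hc.integrableOn_Icc).mono_set Ioc_subset_Icc_self
  rw [rotationMode, monoPoly, Finset.mul_sum]
  simp only [h1]
  rw [integral_finsetSum _ fun k _ => h2 k]
  refine Finset.sum_congr rfl fun k _ => ?_
  rw [integral_const_mul, (hg k).integral_angle p hζ, heightC]
  ring

/-- Every rotation mode of `f` is a wave and has the same inner products with waves of its degree as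
`f`. Being orthogonal to itself, it vanishes. Its coefficients are the Taylor coefficients of the
holomorphic `g k`, so all `g k` vanish. -/
theorem eq_zero_of_orthogonal {f : L2Siegel} (hf : f ∈ polyBergman 1 n)
    (h : ∀ p (ψ : L2Freq n), ⟪waveOp n p ψ, f⟫_ℂ = 0) : f = 0 := by
  obtain ⟨f₀, hf₀, hff⟩ := hf
  obtain ⟨g, hg, hfg⟩ := hf₀.exists_holo
  have hcont : ContinuousOn (∑ k : Fin n, heightC ^ (k : ℕ) * g k) siegel :=
    (isPolyAnalytic_sum hg).1.continuousOn
  set F := siegel.indicator (∑ k : Fin n, heightC ^ (k : ℕ) * g k) with hFdef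
  have hFm : Measurable F := measurable_indicator_of_continuousOn isOpen_siegel hcont
  have hfF : f =ᵐ[siegelMeasure] F := by
    filter_upwards [hff, ae_mem_siegel] with ζ h1 hζ
    rw [h1, hFdef, indicator_of_mem hζ, hfg hζ]
  have hF2 : ∫⁻ ζ, ‖F ζ‖ₑ ^ 2 ∂siegelMeasure < ⊤ :=
    lintegral_enorm_sq_lt_top ((memLp_congr_ae hfF).1 (Lp.memLp f))
  have hmode : ∀ p, ∀ ζ ∈ siegel, rotationMode p F ζ = monoPoly p (fun k => taylorFst p (g k)) ζ :=
    fun p ζ hζ => rotationMode_eq_monoPoly hg p hζ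
  have hzero : ∀ p (k : Fin n), ∀ w ∈ upperHalf, taylorFst p (g k) w = 0 := by
    intro p
    have hmode' : rotationMode p F =ᵐ[siegelMeasure] monoPoly p (fun k => taylorFst p (g k)) := by
      filter_upwards [ae_mem_siegel] with ζ hζ using hmode p ζ hζ
    obtain ⟨ψ, hψ⟩ := exists_waveOp_eq_monoPoly p (fun k => (hg k).measurable_taylorFst p)
      (fun k => (hg k).differentiableOn_taylorFst p) (by
        refine lt_of_le_of_lt (le_of_eq ?_) ((lintegral_rotationMode_le hFm p).trans_lt hF2)
        refine lintegral_congr_ae ?_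
        filter_upwards [hmode'] with ζ hζ
        rw [hζ])
    have h1 : ⟪waveOp n p ψ, waveOp n p ψ⟫_ℂ = 0 := by
      rw [← h p ψ, L2.inner_def, L2.inner_def]
      have h2 := integral_conj_monoWave_mul_rotationMode hFm hF2 p ψ
      calc _ = ∫ ζ, rotationMode p F ζ * (starRingEnd ℂ) (monoWave p ψ ζ) ∂siegelMeasure := by
            refine integral_congr_ae ?_
            filter_upwards [hψ, hmode', coeFn_waveOp p ψ] with ζ h3 h4 h5
            rw [RCLike.inner_apply, h4, ← h3, h5]
        _ = _ := by
            rw [h2]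
            refine integral_congr_ae ?_
            filter_upwards [hfF, coeFn_waveOp p ψ] with ζ h3 h5
            rw [RCLike.inner_apply, h3, h5]
    have h2 : waveOp n p ψ = 0 := inner_self_eq_zero.1 h1
    have h3 : monoPoly p (fun k => taylorFst p (g k)) =ᵐ[siegelMeasure] 0 := by
      refine hψ.symm.trans ?_
      rw [h2]
      exact Lp.coeFn_zero _ _ _
    intro k w hw
    exact eq_zero_of_monoPoly_ae_eq_zero
      (fun k => ((hg k).differentiableOn_taylorFst p).continuousOn) h3 k hw
  refine Lp.ext (hfF.trans ((?_ : F =ᵐ[siegelMeasure] 0).trans (Lp.coeFn_zero _ _ _).symm))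
  filter_upwards [ae_mem_siegel] with ζ hζ
  rw [hFdef, indicator_of_mem hζ, Finset.sum_apply]
  refine Finset.sum_eq_zero fun k _ => ?_
  rw [Pi.mul_apply, (hg k).eq_zero_of_taylorFst (fun p => hzero p k) hζ, mul_zero]

/-- The component of `f` orthogonal to the closed wave space is still poly-analytic, because the
wave space consists of such functions; by totality it is zero. -/
theorem polyBergman_eq_waveSpace (n : ℕ) : polyBergman 1 n = waveSpace n := by
  refine le_antisymm (fun f hf => ?_) waveSpace_le_polyBergman
  have : CompleteSpace (waveSpace n) := (isClosed_waveSpace n).completeSpace_coe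
  set P := (waveSpace n).starProjection f with hP
  have h1 : P ∈ waveSpace n := (waveSpace n).starProjection_apply_mem f
  have h2 : f - P = 0 := by
    refine eq_zero_of_orthogonal (Submodule.sub_mem _ hf (waveSpace_le_polyBergman h1))
      fun p ψ => ?_
    exact (Submodule.sub_starProjection_mem_orthogonal f) _ (waveOp_mem_waveSpace p ψ)
  rw [sub_eq_zero.1 h2]
  exact h1

theorem isClosed_polyBergman (n : ℕ) : IsClosed (polyBergman 1 n : Set L2Siegel) := by
  rw [polyBergman_eq_waveSpace]
  exact isClosed_waveSpace n

end Totality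

/-! ### From operators to matrix functions. -/

section Isomorphism

open scoped InnerProductSpace

/-- A `⋆`-homomorphism which is injective on the `C⋆`-algebra generated by a set restricts to a
`⋆`-isomorphism onto the `C⋆`-algebra generated by the image of the set. -/
theorem exists_starAlgEquiv_cstarGenerated {A B : Type*} [CStarAlgebra A] [CStarAlgebra B]
    (φ : A →⋆ₐ[ℂ] B) (s : Set A) (h : ∀ a ∈ cstarGenerated s, φ a = 0 → a = 0) :
    ∃ e : cstarGenerated s ≃⋆ₐ[ℂ] cstarGenerated (φ '' s), ∀ a, (e a : B) = φ a := by
  have hcl : IsClosed (cstarGenerated s : Set A) := StarSubalgebra.isClosed_topologicalClosure _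
  have hφ : Continuous φ := (NonUnitalStarAlgHom.norm_apply_le φ |> fun h =>
    AddMonoidHomClass.continuous_of_bound φ 1 (by simpa using h))
  let ρ : cstarGenerated s →⋆ₐ[ℂ] B := φ.comp (cstarGenerated s).subtype
  have hinj : Function.Injective ρ := (injective_iff_map_eq_zero ρ).2 fun a ha =>
    Subtype.ext (h a a.2 ha)
  have hiso : Isometry ρ := NonUnitalStarAlgHom.isometry ρ hinj
  -- An injective `⋆`-homomorphism is isometric, so the image is already closed.
  have hrange : (cstarGenerated s).map φ = cstarGenerated (φ '' s) := by
    refine le_antisymm ?_ ?_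
    · rw [cstarGenerated, cstarGenerated, ← StarAlgHom.map_adjoin]
      exact StarSubalgebra.map_topologicalClosure_le _ φ hφ
    · refine StarSubalgebra.topologicalClosure_minimal ?_ ?_
      · rw [← StarAlgHom.map_adjoin]
        exact StarSubalgebra.map_mono (StarSubalgebra.le_topologicalClosure _)
      · have : ((cstarGenerated s).map φ : Set B) = range ρ := by
          ext x
          simp [ρ]
        rw [this]
        exact hiso.isClosedEmbedding.isClosed_range
  have hmem : ∀ a : cstarGenerated s, ρ a ∈ cstarGenerated (φ '' s) := fun a => by
    rw [← hrange]
    exact ⟨a, a.2, rfl⟩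
  refine ⟨StarAlgEquiv.ofBijective (StarAlgHom.codRestrict ρ _ hmem) ⟨?_, ?_⟩, fun a => rfl⟩
  · exact fun a b hab => hinj (congrArg Subtype.val hab)
  · rintro ⟨x, hx⟩
    rw [← hrange] at hx
    obtain ⟨a, ha, rfl⟩ := hx
    exact ⟨⟨a, ha⟩, rfl⟩

/-- If both projections are injective on the `C⋆`-algebra generated by a set of pairs, then the
`C⋆`-algebras generated by the first and by the second components are isomorphic. -/
theorem exists_starAlgEquiv_of_pairs {A B : Type*} [CStarAlgebra A] [CStarAlgebra B]
    (s : Set (A × B)) (h₁ : ∀ x ∈ cstarGenerated s, x.1 = 0 → x = 0)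
    (h₂ : ∀ x ∈ cstarGenerated s, x.2 = 0 → x = 0) {s₁ : Set A} {s₂ : Set B}
    (hs₁ : StarAlgHom.fst ℂ A B '' s = s₁) (hs₂ : StarAlgHom.snd ℂ A B '' s = s₂) :
    ∃ Φ : cstarGenerated s₁ ≃⋆ₐ[ℂ] cstarGenerated s₂, ∀ x ∈ s, ∀ hx : x.1 ∈ cstarGenerated s₁,
      (Φ ⟨x.1, hx⟩ : B) = x.2 := by
  subst hs₁ hs₂
  obtain ⟨e₁, he₁⟩ := exists_starAlgEquiv_cstarGenerated (StarAlgHom.fst ℂ A B) s h₁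
  obtain ⟨e₂, he₂⟩ := exists_starAlgEquiv_cstarGenerated (StarAlgHom.snd ℂ A B) s h₂
  refine ⟨e₁.symm.trans e₂, fun x hx hx' => ?_⟩
  have h : e₁.symm ⟨x.1, hx'⟩ = ⟨x, mem_cstarGenerated hx⟩ := by
    rw [StarAlgEquiv.symm_apply_eq]
    exact Subtype.ext (he₁ ⟨x, mem_cstarGenerated hx⟩).symm
  rw [StarAlgEquiv.trans_apply]
  exact (congrArg (fun y => (e₂ y : B)) h).trans (he₂ _)

variable {n : ℕ}

/-- The operator `waveOp` with values in the Bergman space. -/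
def bergmanWave (n p : ℕ) : L2Freq n →ₗᵢ[ℂ] bergmanSpace n where
  toFun ψ := ⟨waveOp n p ψ, Submodule.le_topologicalClosure _ (waveOp_mem_polyBergman p ψ)⟩
  map_add' _ _ := Subtype.ext (map_add _ _ _)
  map_smul' _ _ := Subtype.ext (map_smul _ _ _)
  norm_map' ψ := (waveOp n p).norm_map ψ

theorem eq_of_inner_bergmanWave {f g : bergmanSpace n}
    (h : ∀ p ψ, ⟪bergmanWave n p ψ, f⟫_ℂ = ⟪bergmanWave n p ψ, g⟫_ℂ) : f = g := by
  rw [← sub_eq_zero]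
  refine Subtype.ext (eq_zero_of_orthogonal (n := n) ?_ fun p ψ => ?_)
  · rw [← (isClosed_polyBergman n).submodule_topologicalClosure_eq]
    exact (f - g).2
  · have : ⟪bergmanWave n p ψ, f - g⟫_ℂ = 0 := by rw [inner_sub_right, h, sub_self]
    exact this

theorem inner_bergmanWave_of_ne {p q : ℕ} (h : p ≠ q) (φ ψ : L2Freq n) :
    ⟪bergmanWave n p φ, bergmanWave n q ψ⟫_ℂ = 0 :=
  orthogonalFamily_waveOp n h φ ψ

theorem inner_bergmanWave_toeplitz (b : BSymbol) (p q : ℕ) (φ ψ : L2Freq n) :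
    ⟪bergmanWave n p φ, toeplitz n b (bergmanWave n q ψ)⟫_ℂ =
      ⟪waveOp n p φ, mulOp b (waveOp n q ψ)⟫_ℂ :=
  Submodule.inner_orthogonalProjectionOnto_eq_of_mem_left (bergmanWave n p φ) _

/-- Both sides have the same inner products with all waves, and the waves are total. -/
theorem toeplitz_bergmanWave {b : BSymbol} {M : MatFun n} (hM : IsSpectralFun n b M) (p : ℕ)
    (ψ : L2Freq n) : toeplitz n b (bergmanWave n p ψ) = bergmanWave n p (freqRep n M ψ) := by
  refine eq_of_inner_bergmanWave fun q φ => ?_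
  rw [inner_bergmanWave_toeplitz]
  by_cases h : q = p
  · subst h
    rw [inner_waveOp_mulOp_self hM, LinearIsometry.inner_map_map]
  · rw [inner_waveOp_mulOp_of_ne b h, inner_bergmanWave_of_ne h]

theorem star_toeplitz_bergmanWave {b : BSymbol} {M : MatFun n} (hM : IsSpectralFun n b M) (p : ℕ)
    (ψ : L2Freq n) :
    star (toeplitz n b) (bergmanWave n p ψ) = bergmanWave n p (freqRep n (star M) ψ) := by
  refine eq_of_inner_bergmanWave fun q φ => ?_
  rw [ContinuousLinearMap.star_eq_adjoint, ContinuousLinearMap.adjoint_inner_right,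
    toeplitz_bergmanWave hM]
  by_cases h : q = p
  · subst h
    rw [LinearIsometry.inner_map_map, LinearIsometry.inner_map_map, map_star,
      ContinuousLinearMap.star_eq_adjoint, ContinuousLinearMap.adjoint_inner_right]
  · rw [inner_bergmanWave_of_ne h, inner_bergmanWave_of_ne h]

/-- The pairs of an operator on the Bergman space and a matrix function which represents it. -/
def spectralPairs (n : ℕ) :
    StarSubalgebra ℂ ((bergmanSpace n →L[ℂ] bergmanSpace n) × MatFun n) where
  carrier := {x | ∀ p ψ, x.1 (bergmanWave n p ψ) = bergmanWave n p (freqRep n x.2 ψ) ∧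
    star x.1 (bergmanWave n p ψ) = bergmanWave n p (freqRep n (star x.2) ψ)}
  mul_mem' := by
    intro x y hx hy p ψ
    have h1 : star (x * y).1 = star y.1 * star x.1 := star_mul x.1 y.1
    have h2 : star (x * y).2 = star y.2 * star x.2 := star_mul x.2 y.2
    rw [h1, h2, Prod.fst_mul, Prod.snd_mul, map_mul, map_mul, mul_apply_eq_comp, mul_apply_eq_comp,
      mul_apply_eq_comp, mul_apply_eq_comp, (hy p ψ).1, (hx p _).1, (hx p ψ).2, (hy p _).2]
    exact ⟨rfl, rfl⟩
  add_mem' := by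
    intro x y hx hy p ψ
    have h1 : star (x + y).1 = star x.1 + star y.1 := star_add x.1 y.1
    have h2 : star (x + y).2 = star x.2 + star y.2 := star_add x.2 y.2
    rw [h1, h2, Prod.fst_add, Prod.snd_add, map_add, map_add, add_apply, add_apply, add_apply,
      add_apply, (hy p ψ).1, (hx p ψ).1, (hx p ψ).2, (hy p ψ).2, map_add, map_add]
    exact ⟨rfl, rfl⟩
  algebraMap_mem' c p ψ := by
    have h1 : (algebraMap ℂ ((bergmanSpace n →L[ℂ] bergmanSpace n) × MatFun n) c).1 = c • 1 := rfl
    have h2 : (algebraMap ℂ ((bergmanSpace n →L[ℂ] bergmanSpace n) × MatFun n) c).2 = c • 1 := by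
      change algebraMap ℂ (MatFun n) c = c • 1
      exact Algebra.algebraMap_eq_smul_one c
    have h3 : star (c • (1 : bergmanSpace n →L[ℂ] bergmanSpace n)) = star c • 1 :=
      (star_smul c _).trans (congrArg _ (star_one (bergmanSpace n →L[ℂ] bergmanSpace n)))
    rw [h1, h2, h3, star_smul, star_one, map_smul, map_smul, map_one, smul_apply, smul_apply,
      smul_apply, smul_apply, one_apply_eq_self, one_apply_eq_self, map_smul, map_smul]
    exact ⟨rfl, rfl⟩
  star_mem' := by
    intro x hx p ψ
    have h1 : star (star x).1 = x.1 := star_star x.1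
    have h2 : star (star x).2 = x.2 := star_star x.2
    rw [h1, h2]
    exact ⟨(hx p ψ).2, (hx p ψ).1⟩

theorem isClosed_spectralPairs (n : ℕ) :
    IsClosed (spectralPairs n : Set ((bergmanSpace n →L[ℂ] bergmanSpace n) × MatFun n)) := by
  have hc : Continuous (freqRep n) := AddMonoidHomClass.continuous_of_bound (freqRep n) 1
    (by simpa using NonUnitalStarAlgHom.norm_apply_le (freqRep n))
  have h : (spectralPairs n : Set ((bergmanSpace n →L[ℂ] bergmanSpace n) × MatFun n)) =
      ⋂ p, ⋂ ψ, {x : (bergmanSpace n →L[ℂ] bergmanSpace n) × MatFun n |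
        x.1 (bergmanWave n p ψ) = bergmanWave n p (freqRep n x.2 ψ) ∧
        star x.1 (bergmanWave n p ψ) = bergmanWave n p (freqRep n (star x.2) ψ)} := by
    ext x
    simp only [mem_iInter]
    rfl
  rw [h]
  refine isClosed_iInter fun p => isClosed_iInter fun ψ => ?_
  have h1 : ∀ {f : (bergmanSpace n →L[ℂ] bergmanSpace n) × MatFun n → L2Freq n →L[ℂ] L2Freq n},
      Continuous f → Continuous fun x => bergmanWave n p (f x ψ) := fun hf =>
    (bergmanWave n p).continuous.comp (hf.clm_apply continuous_const)
  have h2 : Continuous fun x : (bergmanSpace n →L[ℂ] bergmanSpace n) × MatFun n => star x.1 :=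
    ContinuousLinearMap.adjoint.continuous.comp continuous_fst
  refine (isClosed_eq (continuous_fst.clm_apply continuous_const) (h1 (hc.comp continuous_snd))).inter
    (isClosed_eq (h2.clm_apply continuous_const)
      (h1 (hc.comp continuous_snd.star)))

/-- The pairs of a Toeplitz operator and its spectral function. -/
def toeplitzPairs (n : ℕ) : Set ((bergmanSpace n →L[ℂ] bergmanSpace n) × MatFun n) :=
  {x | ∃ b, x.1 = toeplitz n b ∧ IsSpectralFun n b x.2}

theorem cstarGenerated_toeplitzPairs_le (n : ℕ) :
    cstarGenerated (toeplitzPairs n) ≤ spectralPairs n := by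
  refine StarSubalgebra.topologicalClosure_minimal (StarAlgebra.adjoin_le ?_)
    (isClosed_spectralPairs n)
  rintro ⟨T, M⟩ ⟨b, rfl, hM⟩ p ψ
  exact ⟨toeplitz_bergmanWave hM p ψ, star_toeplitz_bergmanWave hM p ψ⟩

/-- The single degree `p = 0` determines the matrix function, since the representation and the
isometry are injective. -/
theorem spectralPairs_eq_zero_of_fst {x : (bergmanSpace n →L[ℂ] bergmanSpace n) × MatFun n}
    (hx : x ∈ spectralPairs n) (h : x.1 = 0) : x = 0 := by
  refine Prod.ext h (freqRep_injective ?_)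
  rw [Prod.snd_zero, map_zero]
  refine ContinuousLinearMap.ext fun ψ => (bergmanWave n 0).injective ?_
  rw [← (hx 0 ψ).1, h, zero_apply, zero_apply, map_zero]

/-- When `x.2 = 0` the adjoint of `x.1` kills every wave, so the range of `x.1` is orthogonal to all
waves. For this the adjoint relation is part of the definition of the pairs. -/
theorem spectralPairs_eq_zero_of_snd {x : (bergmanSpace n →L[ℂ] bergmanSpace n) × MatFun n}
    (hx : x ∈ spectralPairs n) (h : x.2 = 0) : x = 0 := by
  refine Prod.ext (ContinuousLinearMap.ext fun f => eq_of_inner_bergmanWave fun p ψ => ?_) h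
  rw [← ContinuousLinearMap.adjoint_inner_left, ← ContinuousLinearMap.star_eq_adjoint,
    (hx p ψ).2, h, star_zero, map_zero, zero_apply, map_zero, inner_zero_left, Prod.fst_zero,
    zero_apply, inner_zero_right]

theorem fst_image_toeplitzPairs (n : ℕ) : Prod.fst '' toeplitzPairs n = range (toeplitz n) := by
  ext T
  constructor
  · rintro ⟨x, ⟨b, hb, _⟩, rfl⟩
    exact ⟨b, hb.symm⟩
  · rintro ⟨b, rfl⟩
    obtain ⟨M, _, hM⟩ := exists_mem_scalarEnds (n := n) b
    exact ⟨(toeplitz n b, M), ⟨b, rfl, hM⟩, rfl⟩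

theorem snd_image_toeplitzPairs (n : ℕ) :
    Prod.snd '' toeplitzPairs n = {M : MatFun n | ∃ b, IsSpectralFun n b M} := by
  ext M
  constructor
  · rintro ⟨x, ⟨b, _, hb⟩, rfl⟩
    exact ⟨b, hb⟩
  · rintro ⟨b, hb⟩
    exact ⟨(toeplitz n b, M), ⟨b, rfl, hb⟩, rfl⟩

theorem exists_toeplitzAlgebra_equiv (n : ℕ) :
    ∃ Φ : toeplitzAlgebra n ≃⋆ₐ[ℂ] scalarEnds n, ∀ b : BSymbol,
      IsSpectralFun n b (Φ ⟨toeplitz n b, toeplitz_mem n b⟩ : scalarEnds n) := by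
  rw [← spectralAlgebra_eq]
  obtain ⟨Φ, hΦ⟩ := exists_starAlgEquiv_of_pairs (toeplitzPairs n)
    (fun x hx => spectralPairs_eq_zero_of_fst (cstarGenerated_toeplitzPairs_le n hx))
    (fun x hx => spectralPairs_eq_zero_of_snd (cstarGenerated_toeplitzPairs_le n hx))
    (fst_image_toeplitzPairs n) (snd_image_toeplitzPairs n)
  refine ⟨Φ, fun b => ?_⟩
  obtain ⟨M, _, hM⟩ := exists_mem_scalarEnds (n := n) b
  have h : (Φ ⟨toeplitz n b, toeplitz_mem n b⟩ : MatFun n) = M :=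
    hΦ (toeplitz n b, M) ⟨b, rfl, hM⟩ (toeplitz_mem n b)
  intro x hx
  exact (congrArg (fun N : MatFun n => N (ENNReal.ofReal x)) h).trans (hM x hx)

end Isomorphism

end SiegelToeplitz

end

theorem mainTheorem7 (n : ℕ) (hn : 1 ≤ n) :
    IsClosed (SiegelToeplitz.polyBergman 1 n : Set SiegelToeplitz.L2Siegel) ∧
    (∀ b : SiegelToeplitz.BSymbol,
      ∃ M ∈ SiegelToeplitz.scalarEnds n, SiegelToeplitz.IsSpectralFun n b M) ∧
    SiegelToeplitz.spectralAlgebra n = SiegelToeplitz.scalarEnds n ∧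
    ∃ Φ : SiegelToeplitz.toeplitzAlgebra n ≃⋆ₐ[ℂ] SiegelToeplitz.scalarEnds n,
      ∀ b : SiegelToeplitz.BSymbol,
        SiegelToeplitz.IsSpectralFun n b
          (Φ ⟨SiegelToeplitz.toeplitz n b, SiegelToeplitz.toeplitz_mem n b⟩ :
            SiegelToeplitz.scalarEnds n) := by
  exact ⟨SiegelToeplitz.isClosed_polyBergman n,
    fun b => SiegelToeplitz.exists_mem_scalarEnds b, SiegelToeplitz.spectralAlgebra_eq,
    SiegelToeplitz.exists_toeplitzAlgebra_equiv n⟩
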